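/- **Setting.** Let $\mathfrak g$ be a real simple Lie algebra with negative definite Killing form $K$ (a compact simple Lie algebra), $\dim\mathfrak g\ge 8$, and let $\langle\cdot,\cdot\rangle=-K$. Its Cartan 3-form is $\omega_{\mathfrak g}(X,Y,Z)=K(X,[Y,Z])$. Let $M$ be a smooth (Hausdorff, second countable) manifold with a smooth 3-form $\omega^3$ of type $\omega_{\mathfrak g}$: for every $x\in M$ there is an adapted frame, i.e. a linear isomorphism $I:T_xM\to\mathfrak g$ with $I^*\omega_{\mathfrak g}=\omega^3_x$. Give $M$ the associated Riemannian metric $I^*\langle\cdot,\cdot\rangle$ with Levi-Civita connection $\nabla^{LC}$. An $\mathrm{Aut}(\mathfrak g)$-connection is a smooth affine connection $\nabla$ with $\nabla\omega^3=0$ (recall that $\mathrm{Aut}(\mathfrak g)$ is the stabilizer of $\omega_{\mathfrak g}$); it has skew-symmetric torsion if its affine torsion satisfies $\langle T(X,Y),Z\rangle=-\langle T(X,Z),Y\rangle$. Write $\mathfrak{so}(\mathfrak g)=\mathrm{ad}(\mathfrak g)\oplus\mathfrak g^\perp$ (orthogonal splitting for the trace form). The intrinsic torsion $\xi$ of $(M,\omega^3)$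 is the component of $\nabla-\nabla^{LC}$ in $T^*M\otimes\mathfrak g^\perp$, for any $\mathrm{Aut}(\mathfrak g)$-connection $\nabla$; by an adapted frame, $\xi(x)$ is regarded as an element of $\mathfrak g\otimes\mathfrak g^\perp\cong\mathrm{Hom}(\mathfrak g,\mathfrak g^\perp)$. $M$ is torsion-free if $\xi=0$, equivalently if $\nabla^{LC}$ is an $\mathrm{Aut}(\mathfrak g)$-connection. Let $W_{skew}\subset\mathfrak g\otimes\mathfrak g^\perp$ be the space of (pointwise) intrinsic torsions of connections with skew-symmetric torsion: all $\xi$ such that, for some linear $\beta:\mathfrak g\to\mathfrak g$, the tensor $\eta_u=\xi(u)+\mathrm{ad}_{\beta(u)}$ has $T(u,v)=\eta_uv-\eta_vu$ with $\langle T(u,v),w\rangle=-\langle T(u,w),v\rangle$. Let $\rho_*$ be the action of $\mathrm{End}(\mathfrak g)$ on 3-forms, $D_+(v\otimes\tau)=v\wedge\rho_*(\tau)\omega_{\mathfrak g}\in\Lambda^4$, $D_-(v\otimes\tau)=v\lrcorner\rho_*(\tau)\omega_{\mathfrak g}\in\Lambda^2$, and $W_d=W_{skew}\cap\ker D_+$,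 $W_\delta=W_{skew}\cap\ker D_-$. **Corollary 4.12.** 1. $W_{skew}$, $W_d$, $W_\delta$ are $\mathfrak g$-modules, and $W_{skew}=W_d\oplus W_\delta$. 2. The Levi-Civita connection and $\mathrm{Aut}(\mathfrak g)$-connections exist on $(M,\omega^3)$. The manifold $(M,\omega^3)$ has an $\mathrm{Aut}(\mathfrak g)$-connection with skew-symmetric torsion if and only if its intrinsic torsion (computed with any $\mathrm{Aut}(\mathfrak g)$-connection and in all adapted frames) takes values in $W_{skew}$. 3. If $(M,\omega^3)$ has an $\mathrm{Aut}(\mathfrak g)$-connection with skew-symmetric torsion, then at every $x\in M$, in every adapted frame, the intrinsic torsion $\xi(x)$ computed with that connection lies in $W_{skew}$, and $d\omega^3=0$ at $x$ if and only if $\xi(x)\in W_d$, and $d^*\omega^3=0$ at $x$ if and only if $\xi(x)\in W_\delta$. 4. Hence if moreover $\omega^3$ is harmonic, i.e. $d\omega^3=0$ and $d^*\omega^3=0$ on $M$, then $M$ is torsion-free: $\xi=0$, and $\nabla^{LC}$ is an $\mathrm{Aut}(\mathfrak g)$-connection. -/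

import Mathlib

open scoped Manifold ContDiff

noncomputable section

namespace CartanGeometry

section Algebra

variable {𝔤 : Type*} [LieRing 𝔤] [LieAlgebra ℝ 𝔤]

/-- The Cartan 3-form `ω_𝔤 (X, Y, Z) = ⟨X, [Y, Z]⟩`, with `⟨ , ⟩` the Killing form. -/
def cartanForm (X Y Z : 𝔤) : ℝ := killingForm ℝ 𝔤 X ⁅Y, Z⁆

/-- The metric on `𝔤` given by minus the Killing form. -/
def metric (X Y : 𝔤) : ℝ := -killingForm ℝ 𝔤 X Y

/-- The subspace `𝔤^⊥` of `𝔰𝔬(𝔤)` in the orthogonal splitting `𝔰𝔬(𝔤) = 𝔤 ⊕ 𝔤^⊥`. Here `𝔰𝔬(𝔤)`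
consists of the endomorphisms that are skew for the Killing form, `𝔤` is embedded in it by `ad`, and
orthogonality is with respect to the trace form, which is a multiple of the metric of
`Λ² 𝔤 ≅ 𝔰𝔬(𝔤)`. -/
def gPerp (𝔤 : Type*) [LieRing 𝔤] [LieAlgebra ℝ 𝔤] : Submodule ℝ (Module.End ℝ 𝔤) where
  carrier := {f | (∀ x y, metric (f x) y = -metric x (f y)) ∧
    ∀ a, LinearMap.trace ℝ 𝔤 (f * LieAlgebra.ad ℝ 𝔤 a) = 0}
  zero_mem' := by simp [metric]
  add_mem' := by
    rintro f g ⟨hf, hf'⟩ ⟨hg, hg'⟩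
    refine ⟨fun x y => ?_, fun a => ?_⟩
    · have h1 := hf x y
      have h2 := hg x y
      simp only [metric, LinearMap.add_apply, map_add] at *
      linarith
    · rw [add_mul, map_add, hf', hg', add_zero]
  smul_mem' := by
    rintro c f ⟨hf, hf'⟩
    refine ⟨fun x y => ?_, fun a => ?_⟩
    · have h1 := hf x y
      simp only [metric, LinearMap.smul_apply, map_smul, smul_eq_mul] at *
      linear_combination c * h1
    · rw [smul_mul_assoc, map_smul, hf', smul_zero]

/-- The `ad 𝔤`-part of an endomorphism `f` of `𝔤`: the element `b` of `𝔤` with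
`⟨b, a⟩ = tr (f ∘ ad a)` for all `a`. Since `tr (ad b ∘ ad a) = ⟨b, a⟩`, this says that
`f - ad b` is trace-orthogonal to `ad 𝔤`. -/
def adPart [Module.Finite ℝ 𝔤] [LieAlgebra.IsKilling ℝ 𝔤] : Module.End ℝ 𝔤 →ₗ[ℝ] 𝔤 :=
  ((killingForm ℝ 𝔤).toDual
    (LieAlgebra.IsKilling.killingForm_nondegenerate ℝ 𝔤)).symm.toLinearMap ∘ₗ
  { toFun := fun f => LinearMap.trace ℝ 𝔤 ∘ₗ LinearMap.mulLeft ℝ f ∘ₗ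
      (LieAlgebra.ad ℝ 𝔤 : 𝔤 →ₗ[ℝ] Module.End ℝ 𝔤)
    map_add' := fun f g => by ext a; simp [add_mul]
    map_smul' := fun c f => by ext a; simp }

/-- The projection `f ↦ f - ad b` along `ad 𝔤`, with `b` the `ad 𝔤`-part of `f`. Restricted to
`𝔰𝔬(𝔤)` it is the orthogonal projection onto `𝔤^⊥`. -/
def projPerp [Module.Finite ℝ 𝔤] [LieAlgebra.IsKilling ℝ 𝔤] :
    Module.End ℝ 𝔤 →ₗ[ℝ] Module.End ℝ 𝔤 :=
  LinearMap.id - (LieAlgebra.ad ℝ 𝔤 : 𝔤 →ₗ[ℝ] Module.End ℝ 𝔤) ∘ₗ adPart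

/-- The infinitesimal action `ρ_*(τ)` of an endomorphism `τ` of `𝔤` on the Cartan 3-form. -/
def rhoCartan (τ : 𝔤 →ₗ[ℝ] 𝔤) (X Y Z : 𝔤) : ℝ :=
  -(cartanForm (τ X) Y Z + cartanForm X (τ Y) Z + cartanForm X Y (τ Z))

/-- The map `D_+`, `v ⊗ τ ↦ v ∧ ρ_*(τ) ω_𝔤`, with values in 4-forms. An element of
`𝔤 ⊗ End 𝔤` is viewed as a linear map `ξ : 𝔤 → End 𝔤` by means of the metric of `𝔤`. -/
def dPlus (ξ : 𝔤 →ₗ[ℝ] 𝔤 →ₗ[ℝ] 𝔤) (a b c d : 𝔤) : ℝ :=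
  rhoCartan (ξ a) b c d - rhoCartan (ξ b) a c d + rhoCartan (ξ c) a b d - rhoCartan (ξ d) a b c

/-- The map `D_-`, `v ⊗ τ ↦ v ⌟ ρ_*(τ) ω_𝔤`, with values in 2-forms, computed in a basis `e`,
which has to be orthonormal. -/
def dMinus {ι : Type*} [Fintype ι] (e : Module.Basis ι ℝ 𝔤) (ξ : 𝔤 →ₗ[ℝ] 𝔤 →ₗ[ℝ] 𝔤)
    (y z : 𝔤) : ℝ :=
  ∑ i, rhoCartan (ξ (e i)) (e i) y z

/-- Elements `ξ` of `𝔤 ⊗ 𝔤^⊥`, viewed as linear maps `𝔤 → End 𝔤`, that are the intrinsic torsion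
of a connection with values in `𝔤 ⊗ 𝔰𝔬(𝔤)` and with skew-symmetric affine torsion: for some
`β ∈ 𝔤 ⊗ 𝔤`, the tensor `η = ξ + ad ∘ β` has affine torsion `T(u, v) = η_u v - η_v u` satisfying
`⟨T(u, v), w⟩ = -⟨T(u, w), v⟩`. -/
def skewTorsionModule (𝔤 : Type*) [LieRing 𝔤] [LieAlgebra ℝ 𝔤] :
    Submodule ℝ (𝔤 →ₗ[ℝ] 𝔤 →ₗ[ℝ] 𝔤) where
  carrier := {ξ | (∀ a, ξ a ∈ gPerp 𝔤) ∧ ∃ β : 𝔤 →ₗ[ℝ] 𝔤, ∀ u v w : 𝔤,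
    metric ((ξ u v + ⁅β u, v⁆) - (ξ v u + ⁅β v, u⁆)) w =
      -metric ((ξ u w + ⁅β u, w⁆) - (ξ w u + ⁅β w, u⁆)) v}
  zero_mem' := ⟨fun a => (gPerp 𝔤).zero_mem, 0, fun u v w => by simp [metric]⟩
  add_mem' := by
    rintro ξ ξ' ⟨h, β, hβ⟩ ⟨h', β', hβ'⟩
    refine ⟨fun a => (gPerp 𝔤).add_mem (h a) (h' a), β + β', fun u v w => ?_⟩
    have h1 := hβ u v w
    have h2 := hβ' u v w
    simp only [metric, LinearMap.add_apply, LinearMap.sub_apply, add_lie, map_add, map_sub] at *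
    linarith
  smul_mem' := by
    rintro c ξ ⟨h, β, hβ⟩
    refine ⟨fun a => (gPerp 𝔤).smul_mem c (h a), c • β, fun u v w => ?_⟩
    have h1 := hβ u v w
    simp only [metric, LinearMap.add_apply, LinearMap.sub_apply, LinearMap.smul_apply, smul_lie,
      map_add, map_sub, map_smul, smul_eq_mul] at *
    linear_combination c * h1

/-- The elements of `skewTorsionModule` annihilated by `D_+`. -/
def closedModule (𝔤 : Type*) [LieRing 𝔤] [LieAlgebra ℝ 𝔤] :
    Submodule ℝ (𝔤 →ₗ[ℝ] 𝔤 →ₗ[ℝ] 𝔤) where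
  carrier := {ξ | ξ ∈ skewTorsionModule 𝔤 ∧ ∀ a b c d, dPlus ξ a b c d = 0}
  zero_mem' := ⟨Submodule.zero_mem _, by simp [dPlus, rhoCartan, cartanForm]⟩
  add_mem' := by
    rintro ξ ξ' ⟨h, hd⟩ ⟨h', hd'⟩
    refine ⟨Submodule.add_mem _ h h', fun a b c d => ?_⟩
    have h1 := hd a b c d
    have h2 := hd' a b c d
    simp only [dPlus, rhoCartan, cartanForm, LinearMap.add_apply, map_add, add_lie, lie_add] at *
    linarith
  smul_mem' := by
    rintro r ξ ⟨h, hd⟩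
    refine ⟨Submodule.smul_mem _ r h, fun a b c d => ?_⟩
    have h1 := hd a b c d
    simp only [dPlus, rhoCartan, cartanForm, LinearMap.smul_apply, map_smul, smul_lie, lie_smul,
      smul_eq_mul] at *
    linear_combination r * h1

/-- The elements of `skewTorsionModule` annihilated by `D_-`. -/
def coclosedModule (𝔤 : Type*) [LieRing 𝔤] [LieAlgebra ℝ 𝔤] :
    Submodule ℝ (𝔤 →ₗ[ℝ] 𝔤 →ₗ[ℝ] 𝔤) where
  carrier := {ξ | ξ ∈ skewTorsionModule 𝔤 ∧
    ∀ e : Module.Basis (Fin (Module.finrank ℝ 𝔤)) ℝ 𝔤,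
      (∀ i j, metric (e i) (e j) = if i = j then 1 else 0) → ∀ y z, dMinus e ξ y z = 0}
  zero_mem' := ⟨Submodule.zero_mem _, by simp [dMinus, rhoCartan, cartanForm]⟩
  add_mem' := by
    rintro ξ ξ' ⟨h, hd⟩ ⟨h', hd'⟩
    refine ⟨Submodule.add_mem _ h h', fun e he y z => ?_⟩
    have h1 : dMinus e (ξ + ξ') y z = dMinus e ξ y z + dMinus e ξ' y z := by
      simp only [dMinus, ← Finset.sum_add_distrib]
      refine Finset.sum_congr rfl fun i _ => ?_
      simp only [rhoCartan, cartanForm, LinearMap.add_apply, map_add, add_lie, lie_add]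
      ring
    rw [h1, hd e he y z, hd' e he y z, add_zero]
  smul_mem' := by
    rintro r ξ ⟨h, hd⟩
    refine ⟨Submodule.smul_mem _ r h, fun e he y z => ?_⟩
    rw [← mul_zero r, ← hd e he y z]
    simp only [dMinus, Finset.mul_sum]
    refine Finset.sum_congr rfl fun i _ => ?_
    simp only [rhoCartan, cartanForm, LinearMap.smul_apply, map_smul, smul_lie, lie_smul,
      smul_eq_mul]
    ring

end Algebra

section Geometry

variable {E : Type*} [NormedAddCommGroup E] [NormedSpace ℝ E]
  {M : Type*} [TopologicalSpace M] [ChartedSpace E M]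
  {𝔤 : Type*} [LieRing 𝔤] [LieAlgebra ℝ 𝔤]

/-- A (not necessarily smooth) field of alternating 3-forms on `M`. -/
abbrev ThreeForm (E : Type*) [NormedAddCommGroup E] [NormedSpace ℝ E]
    (M : Type*) [TopologicalSpace M] [ChartedSpace E M] :=
  ∀ x : M, TangentSpace 𝓘(ℝ, E) x [⋀^Fin 3]→L[ℝ] ℝ

/-- The type of affine connections: covariant derivatives on the tangent bundle. -/
abbrev AffineConnection (E : Type*) [NormedAddCommGroup E] [NormedSpace ℝ E]
    (M : Type*) [TopologicalSpace M] [ChartedSpace E M] [IsManifold 𝓘(ℝ, E) ∞ M] :=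
  CovariantDerivative 𝓘(ℝ, E) E (TangentSpace 𝓘(ℝ, E) : M → Type _)

/-- The expression of a 3-form in the preferred chart at `x₀`, as a 3-form on the model space. -/
def ThreeForm.inChart (Ω : ThreeForm E M) (x₀ : M) : E → E [⋀^Fin 3]→L[ℝ] ℝ := fun y =>
  (Ω ((extChartAt 𝓘(ℝ, E) x₀).symm y)).compContinuousLinearMap
    (mfderiv 𝓘(ℝ, E) 𝓘(ℝ, E) (extChartAt 𝓘(ℝ, E) x₀).symm y)

/-- Smoothness of a 3-form, in charts. -/
def ThreeForm.IsSmooth (Ω : ThreeForm E M) : Prop :=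
  ∀ x₀ : M, ContDiffOn ℝ ∞ (Ω.inChart x₀) (extChartAt 𝓘(ℝ, E) x₀).target

/-- The exterior derivative of a 3-form at `x`, computed in the preferred chart at `x`. -/
def ThreeForm.extDerivAt (Ω : ThreeForm E M) (x : M) :
    TangentSpace 𝓘(ℝ, E) x [⋀^Fin 4]→L[ℝ] ℝ :=
  (extDeriv (Ω.inChart x) (extChartAt 𝓘(ℝ, E) x x)).compContinuousLinearMap
    (mfderiv 𝓘(ℝ, E) 𝓘(ℝ, E) (extChartAt 𝓘(ℝ, E) x) x)

/-- An adapted frame at `x`: a linear isomorphism `I : T_x M ≃ 𝔤` with `I^* ω_𝔤 = Ω x`. -/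
def IsAdapted (Ω : ThreeForm E M) (x : M) (I : TangentSpace 𝓘(ℝ, E) x ≃ₗ[ℝ] 𝔤) : Prop :=
  ∀ u v w, Ω x ![u, v, w] = cartanForm (I u) (I v) (I w)

/-- A smooth 3-form of type `ω_𝔤`: at each point it is linearly equivalent to `ω_𝔤`. -/
def IsOfCartanType (𝔤 : Type*) [LieRing 𝔤] [LieAlgebra ℝ 𝔤] (Ω : ThreeForm E M) : Prop :=
  Ω.IsSmooth ∧ ∀ x, ∃ I : TangentSpace 𝓘(ℝ, E) x ≃ₗ[ℝ] 𝔤, IsAdapted Ω x I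

open Classical in
/-- The metric on `M` associated with a 3-form of type `ω_𝔤`: the pull-back of minus the Killing
form by an adapted frame (junk value `0` if there is none). -/
def assocMetric (𝔤 : Type*) [LieRing 𝔤] [LieAlgebra ℝ 𝔤] (Ω : ThreeForm E M) (x : M)
    (u v : TangentSpace 𝓘(ℝ, E) x) : ℝ :=
  if h : ∃ I : TangentSpace 𝓘(ℝ, E) x ≃ₗ[ℝ] 𝔤, IsAdapted Ω x I then
    metric (h.choose u) (h.choose v)
  else 0

variable [IsManifold 𝓘(ℝ, E) ∞ M]

/-- The covariant derivative `(∇_v Ω)(u₁, u₂, u₃)` at `x`, computed with local extensions of the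
tangent vectors `uᵢ` to vector fields. -/
def covDerivForm (cov : AffineConnection E M) (Ω : ThreeForm E M) (x : M)
    (v u₁ u₂ u₃ : TangentSpace 𝓘(ℝ, E) x) : ℝ :=
  mvfderiv 𝓘(ℝ, E) (fun y => Ω y ![FiberBundle.extend E u₁ y, FiberBundle.extend E u₂ y,
      FiberBundle.extend E u₃ y]) x v
    - Ω x ![cov (FiberBundle.extend E u₁) x v, u₂, u₃]
    - Ω x ![u₁, cov (FiberBundle.extend E u₂) x v, u₃]
    - Ω x ![u₁, u₂, cov (FiberBundle.extend E u₃) x v]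

/-- An `Aut(𝔤)`-connection on `(M, Ω)`: a smooth affine connection preserving the
`Aut(𝔤)`-structure, that is, preserving the 3-form `Ω` of which `Aut(𝔤)` is the stabilizer. -/
def IsAutConnection (Ω : ThreeForm E M) (cov : AffineConnection E M) : Prop :=
  cov.ContMDiffCovariantDerivative ∞ ∧ ∀ x v u₁ u₂ u₃, covDerivForm cov Ω x v u₁ u₂ u₃ = 0

variable [FiniteDimensional ℝ E]

/-- A smooth torsion-free connection compatible with the associated metric. -/
def IsLeviCivita (𝔤 : Type*) [LieRing 𝔤] [LieAlgebra ℝ 𝔤] (Ω : ThreeForm E M)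
    (cov : AffineConnection E M) : Prop :=
  cov.ContMDiffCovariantDerivative ∞ ∧ cov.torsion = 0 ∧
  ∀ (X Y : ∀ x : M, TangentSpace 𝓘(ℝ, E) x) (x : M) (v : TangentSpace 𝓘(ℝ, E) x),
    MDiffAt (T% X) x → MDiffAt (T% Y) x →
    mvfderiv 𝓘(ℝ, E) (fun y => assocMetric 𝔤 Ω y (X y) (Y y)) x v =
      assocMetric 𝔤 Ω x (cov X x v) (Y x) + assocMetric 𝔤 Ω x (X x) (cov Y x v)

/-- The affine torsion of the connection is skew-symmetric for the associated metric. -/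
def HasSkewTorsion (𝔤 : Type*) [LieRing 𝔤] [LieAlgebra ℝ 𝔤] (Ω : ThreeForm E M)
    (cov : AffineConnection E M) : Prop :=
  ∀ (x : M) (u v w : TangentSpace 𝓘(ℝ, E) x),
    assocMetric 𝔤 Ω x (cov.torsion x u v) w = -assocMetric 𝔤 Ω x (cov.torsion x u w) v

/-- `d^* Ω = 0` at `x`, where `d^* Ω = - ∑ i, e_i ⌟ ∇_{e_i} Ω` in orthonormal bases, with `∇` the
Levi-Civita connection `lc`. -/
def IsCoclosedAt (𝔤 : Type*) [LieRing 𝔤] [LieAlgebra ℝ 𝔤] (lc : AffineConnection E M)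
    (Ω : ThreeForm E M) (x : M) : Prop :=
  ∀ e : Module.Basis (Fin (Module.finrank ℝ E)) ℝ (TangentSpace 𝓘(ℝ, E) x),
    (∀ i j, assocMetric 𝔤 Ω x (e i) (e j) = if i = j then 1 else 0) →
    ∀ v w, -∑ i, covDerivForm lc Ω x (e i) (e i) v w = 0

/-- The torsion tensor `η = ∇ - ∇^LC` at `x`, transported to `𝔤` by a frame `I`:
`a ↦ I ∘ η_{I⁻¹ a} ∘ I⁻¹`. -/
def torsionTensor (lc cov : AffineConnection E M) (x : M)
    (I : TangentSpace 𝓘(ℝ, E) x ≃ₗ[ℝ] 𝔤) : 𝔤 →ₗ[ℝ] 𝔤 →ₗ[ℝ] 𝔤 :=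
  LinearMap.mk₂ ℝ (fun a b => I (cov.difference lc x (I.symm b) (I.symm a)))
    (by intros; simp) (by intros; simp) (by intros; simp) (by intros; simp)

/-- The intrinsic torsion at `x`, transported to `𝔤` by a frame `I`: the component of the torsion
tensor `η` in `𝔤 ⊗ 𝔤^⊥`. -/
def intrinsicTorsion [Module.Finite ℝ 𝔤] [LieAlgebra.IsKilling ℝ 𝔤]
    (lc cov : AffineConnection E M) (x : M)
    (I : TangentSpace 𝓘(ℝ, E) x ≃ₗ[ℝ] 𝔤) : 𝔤 →ₗ[ℝ] 𝔤 →ₗ[ℝ] 𝔤 :=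
  projPerp ∘ₗ torsionTensor lc cov x I

end Geometry

end CartanGeometry

end

/-! Algebra. A metric tensor `η = ξ + ad ∘ β` has skew torsion exactly when `⟨η_u v, w⟩` is totally
skew, so W_skew is the image of Λ³𝔤 under the projection that forgets the `ad 𝔤`-part. Since `ad 𝔤`
annihilates the Cartan form, D₊ and D₋ may be computed on the 3-form η itself. There they are, up to
constants, the Chevalley–Eilenberg differential and its adjoint. A 3-form orthogonal to all closed
ones is orthogonal to every `dα`, hence coclosed; so closed and coclosed forms span Λ³𝔤. If η is
both, then `L_x η = d(ι_x η)` by Cartan's formula. This is exact and coclosed, hence zero. So `η_x`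
is a derivation, therefore inner, and its component `ξ_x` in 𝔤^⊥ vanishes
(`closedModule_inf_coclosedModule`, `closedModule_sup_coclosedModule`).

Smoothness. Adapted frames are given only pointwise, so the bracket and the metric have to be
recovered smoothly from the 3-form. For any bilinear b, the trilinear form `tr (b (b x y) ∘ b u)` is
polynomial in b, and for the Lie bracket it is the Cartan form. The inverse function theorem then
yields the bracket as a smooth function of the form (`exists_contDiffAt_bracket`). Injectivity of
the derivative and uniqueness of the bracket both reduce to one fact: in dimension greater than
three there is no nonzero symmetric D with `D[x,y] = -[Dx,y] - [x,Dy]` (`antiderivation_eq_zero`).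
In dimension three, `diag(1,1,-2)` on 𝔰𝔲(2) is a counterexample.

Connections. The derivative of the bracket field is a 2-cocycle with values in the adjoint
representation, hence a coboundary. So the linear equations for Christoffel symbols preserving the
form are solvable at each point. The data at any two points are linearly isomorphic, so these
systems have constant rank and smooth local solutions (`exists_contDiffAt_solution`). All conditions
are affine in the connection, so a partition of unity glues (`exists_affineConnection`). The same
scheme gives the Levi-Civita connection, and the connection with skew torsion once the latter exists
pointwise.

Conclusion. If ∇ preserves Ω and `η = ∇ - ∇^LC`, then `∇^LC Ω` is minus the action of η on Ω.
Alternating and contracting turn `dΩ` and `d^*Ω` into `-D₊η` and `D₋η`, and the geometric statements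
follow from the algebra. -/

noncomputable section

namespace CartanGeometry

/-! ### The metric `-K`: invariance, orthonormal bases and spectral theorem. -/

section MetricBasics

variable {𝔤 : Type*} [LieRing 𝔤] [LieAlgebra ℝ 𝔤]

lemma metric_add_left (x y z : 𝔤) : metric (x + y) z = metric x z + metric y z := by
  simp only [metric, map_add, LinearMap.add_apply]; ring

lemma metric_add_right (x y z : 𝔤) : metric x (y + z) = metric x y + metric x z := by
  simp only [metric, map_add]; ring

lemma metric_sub_left (x y z : 𝔤) : metric (x - y) z = metric x z - metric y z := by
  simp only [metric, map_sub, LinearMap.sub_apply]; ring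

lemma metric_sub_right (x y z : 𝔤) : metric x (y - z) = metric x y - metric x z := by
  simp only [metric, map_sub]; ring

lemma metric_neg_left (x y : 𝔤) : metric (-x) y = -metric x y := by
  simp [metric]

lemma metric_neg_right (x y : 𝔤) : metric x (-y) = -metric x y := by
  simp [metric]

lemma metric_smul_left (c : ℝ) (x y : 𝔤) : metric (c • x) y = c * metric x y := by
  simp [metric]

lemma metric_smul_right (c : ℝ) (x y : 𝔤) : metric x (c • y) = c * metric x y := by
  simp [metric]

@[simp] lemma metric_zero_left (y : 𝔤) : metric 0 y = 0 := by simp [metric]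

@[simp] lemma metric_zero_right (y : 𝔤) : metric y 0 = 0 := by simp [metric]

lemma metric_sum_left {ι : Type*} (s : Finset ι) (f : ι → 𝔤) (y : 𝔤) :
    metric (∑ i ∈ s, f i) y = ∑ i ∈ s, metric (f i) y := by
  simp [metric, map_sum, LinearMap.sum_apply]

lemma metric_sum_right {ι : Type*} (s : Finset ι) (f : ι → 𝔤) (y : 𝔤) :
    metric y (∑ i ∈ s, f i) = ∑ i ∈ s, metric y (f i) := by
  simp [metric, map_sum]

lemma metric_comm (x y : 𝔤) : metric x y = metric y x := by
  simp only [metric, LieModule.traceForm_comm ℝ 𝔤 𝔤 x y]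

lemma metric_lie_left (x y z : 𝔤) : metric ⁅x, y⁆ z = metric x ⁅y, z⁆ := by
  simp only [metric, LieModule.traceForm_apply_lie_apply]

/-- `ad x` is skew for the metric. -/
lemma metric_lie_skew (x y z : 𝔤) : metric ⁅x, y⁆ z = -metric y ⁅x, z⁆ := by
  rw [← lie_skew, metric_neg_left, metric_lie_left]

lemma cartanForm_eq (x y z : 𝔤) : cartanForm x y z = -metric x ⁅y, z⁆ := by
  simp [cartanForm, metric]

/-- Orthonormality of a basis for the metric. -/
def IsOrthonormal {ι : Type*} [DecidableEq ι] (e : Module.Basis ι ℝ 𝔤) : Prop :=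
  ∀ i j, metric (e i) (e j) = if i = j then 1 else 0

section Basis

variable {ι : Type*} [Fintype ι] [DecidableEq ι] {e : Module.Basis ι ℝ 𝔤}

lemma IsOrthonormal.repr_eq (he : IsOrthonormal e) (x : 𝔤) (i : ι) :
    e.repr x i = metric x (e i) := by
  conv_rhs => rw [← e.sum_repr x, metric_sum_left]
  simp only [metric_smul_left, he _ _]
  simp

lemma IsOrthonormal.sum_eq (he : IsOrthonormal e) (x : 𝔤) :
    ∑ i, metric x (e i) • e i = x := by
  conv_rhs => rw [← e.sum_repr x]
  simp [he.repr_eq]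

lemma IsOrthonormal.sum_mul (he : IsOrthonormal e) (x y : 𝔤) :
    ∑ i, metric x (e i) * metric y (e i) = metric x y := by
  conv_rhs => rw [← he.sum_eq y]
  simp [metric_sum_right, metric_smul_right, mul_comm]

lemma IsOrthonormal.trace_eq (he : IsOrthonormal e) (f : 𝔤 →ₗ[ℝ] 𝔤) :
    LinearMap.trace ℝ 𝔤 f = ∑ i, metric (f (e i)) (e i) := by
  rw [LinearMap.trace_eq_matrix_trace ℝ e, Matrix.trace]
  simp [LinearMap.toMatrix_apply, he.repr_eq]

/-- Invariance of the Casimir element `∑ e_i ⊗ e_i`. -/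
lemma IsOrthonormal.sum_lie {V : Type*} [AddCommGroup V] [Module ℝ V] (he : IsOrthonormal e)
    (S : 𝔤 →ₗ[ℝ] 𝔤 →ₗ[ℝ] V) (a : 𝔤) :
    ∑ i, S ⁅a, e i⁆ (e i) = -∑ i, S (e i) ⁅a, e i⁆ := by
  have h1 : ∀ i, S ⁅a, e i⁆ (e i) = ∑ j, metric ⁅a, e i⁆ (e j) • S (e j) (e i) := by
    intro i
    conv_lhs => rw [← he.sum_eq ⁅a, e i⁆]
    simp [map_sum, LinearMap.sum_apply]
  have h2 : ∀ i, S (e i) ⁅a, e i⁆ = ∑ j, metric ⁅a, e i⁆ (e j) • S (e i) (e j) := by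
    intro i
    conv_lhs => rw [← he.sum_eq ⁅a, e i⁆]
    simp [map_sum]
  simp only [h1, h2]
  rw [Finset.sum_comm, ← Finset.sum_neg_distrib]
  refine Finset.sum_congr rfl fun i _ => ?_
  rw [← Finset.sum_neg_distrib]
  refine Finset.sum_congr rfl fun j _ => ?_
  rw [metric_lie_skew, metric_comm, neg_smul]

end Basis

/-- The Killing form is negative definite. -/
def IsCompactType (𝔤 : Type*) [LieRing 𝔤] [LieAlgebra ℝ 𝔤] : Prop :=
  ∀ X : 𝔤, X ≠ 0 → killingForm ℝ 𝔤 X X < 0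

lemma IsCompactType.metric_pos (hc : IsCompactType 𝔤) {x : 𝔤} (hx : x ≠ 0) : 0 < metric x x := by
  have := hc x hx
  simp only [metric]; linarith

lemma IsCompactType.metric_nonneg (hc : IsCompactType 𝔤) (x : 𝔤) : 0 ≤ metric x x := by
  by_cases hx : x = 0
  · simp [hx]
  · exact (hc.metric_pos hx).le

lemma IsCompactType.eq_zero_of_metric_self (hc : IsCompactType 𝔤) {x : 𝔤} (h : metric x x = 0) :
    x = 0 := by
  by_contra hx
  exact (hc.metric_pos hx).ne' h

lemma IsCompactType.eq_of_metric (hc : IsCompactType 𝔤) {x y : 𝔤}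
    (h : ∀ z, metric x z = metric y z) : x = y := by
  rw [← sub_eq_zero]
  apply hc.eq_zero_of_metric_self
  rw [metric_sub_left, h, sub_self]

/-- The inner product space structure defined by minus the Killing form. -/
@[reducible] def IsCompactType.core (hc : IsCompactType 𝔤) : InnerProductSpace.Core ℝ 𝔤 where
  inner x y := metric x y
  conj_inner_symm x y := by simp [metric_comm y x]
  re_inner_nonneg x := by simpa using hc.metric_nonneg x
  add_left x y z := metric_add_left x y z
  smul_left x y r := by simp [metric_smul_left]
  definite x h := hc.eq_zero_of_metric_self h

/-- A metric-symmetric endomorphism has an orthonormal eigenbasis. -/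
lemma IsCompactType.exists_eigenbasis [Module.Finite ℝ 𝔤] (hc : IsCompactType 𝔤)
    (P : 𝔤 →ₗ[ℝ] 𝔤) (hP : ∀ x y, metric (P x) y = metric x (P y)) :
    ∃ (e : Module.Basis (Fin (Module.finrank ℝ 𝔤)) ℝ 𝔤)
      (p : Fin (Module.finrank ℝ 𝔤) → ℝ), IsOrthonormal e ∧ ∀ i, P (e i) = p i • e i := by
  let _ : NormedAddCommGroup 𝔤 := hc.core.toNormedAddCommGroup
  let _ : InnerProductSpace ℝ 𝔤 := InnerProductSpace.ofCore hc.core.toCore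
  have hS : P.IsSymmetric := fun x y => hP x y
  refine ⟨(hS.eigenvectorBasis rfl).toBasis, hS.eigenvalues rfl, fun i j => ?_, fun i => ?_⟩
  · have := orthonormal_iff_ite.1 (hS.eigenvectorBasis rfl).orthonormal i j
    simpa using! this
  · simp [hS.apply_eigenvectorBasis]

lemma IsCompactType.exists_orthonormal [Module.Finite ℝ 𝔤] (hc : IsCompactType 𝔤) :
    ∃ e : Module.Basis (Fin (Module.finrank ℝ 𝔤)) ℝ 𝔤, IsOrthonormal e := by
  obtain ⟨e, p, he, -⟩ := hc.exists_eigenbasis 0 (by simp)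
  exact ⟨e, he⟩

/-- A commuting family of metric-symmetric endomorphisms has a spanning set of joint
eigenvectors. -/
lemma IsCompactType.span_joint_eigenvectors [Module.Finite ℝ 𝔤] (hc : IsCompactType 𝔤)
    {ι : Type*} [Finite ι] (P : ι → 𝔤 →ₗ[ℝ] 𝔤) (hP : ∀ i x y, metric (P i x) y = metric x (P i y))
    (hcomm : ∀ i j x, P i (P j x) = P j (P i x)) :
    Submodule.span ℝ {x : 𝔤 | ∀ i, ∃ c : ℝ, P i x = c • x} = ⊤ := by
  let _ : NormedAddCommGroup 𝔤 := hc.core.toNormedAddCommGroup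
  let _ : InnerProductSpace ℝ 𝔤 := InnerProductSpace.ofCore hc.core.toCore
  have hS : ∀ i, (P i).IsSymmetric := fun i x y => hP i x y
  have h := LinearMap.IsSymmetric.iSup_iInf_eq_top_of_commute hS
    (fun i j _ => LinearMap.ext fun x => hcomm i j x)
  rw [eq_top_iff, ← h]
  refine iSup_le fun χ x hx => Submodule.subset_span fun i => ⟨χ i, ?_⟩
  rw [Submodule.mem_iInf] at hx
  exact Module.End.mem_eigenspace_iff.1 (hx i)

end MetricBasics

section Simple

variable {𝔤 : Type*} [LieRing 𝔤] [LieAlgebra ℝ 𝔤]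

/-- A central element has `ad x = 0`, so its Killing square vanishes, against definiteness. -/
lemma IsCompactType.eq_zero_of_forall_lie (hc : IsCompactType 𝔤) {x : 𝔤} (h : ∀ y : 𝔤, ⁅x, y⁆ = 0) :
    x = 0 := by
  by_contra hx
  have := hc x hx
  have h0 : LieAlgebra.ad ℝ 𝔤 x = 0 := LinearMap.ext h
  rw [killingForm_apply_apply, h0] at this
  simp at this

/-- A nonzero subspace of a simple Lie algebra stable under brackets is everything. -/
lemma eq_top_of_lie_mem [LieAlgebra.IsSimple ℝ 𝔤] (S : Submodule ℝ 𝔤) (hS : S ≠ ⊥)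
    (h : ∀ x : 𝔤, ∀ y ∈ S, ⁅x, y⁆ ∈ S) : S = ⊤ := by
  let I : LieIdeal ℝ 𝔤 := { S with lie_mem := fun {x m} hm => h x m hm }
  rcases LieAlgebra.IsSimple.eq_bot_or_eq_top I with h' | h'
  · exact absurd (by simpa [I] using congrArg LieSubmodule.toSubmodule h') hS
  · simpa [I] using congrArg LieSubmodule.toSubmodule h'

lemma lie_span_le {S : Set 𝔤} {W : Submodule ℝ 𝔤} {x y : 𝔤} (h : ∀ s ∈ S, ⁅x, s⁆ ∈ W)
    (hy : y ∈ Submodule.span ℝ S) : ⁅x, y⁆ ∈ W := by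
  induction hy using Submodule.span_induction with
  | mem s hs => exact h s hs
  | zero => simp
  | add a b _ _ ha hb => rw [lie_add]; exact W.add_mem ha hb
  | smul c a _ ha => rw [lie_smul]; exact W.smul_mem c ha

end Simple

end CartanGeometry

end

noncomputable section

namespace CartanGeometry

/-! ### Symmetric endomorphisms with `D[x,y] = -[Dx,y] - [x,Dy]`. -/

section Antiderivations

variable {𝔤 : Type*} [LieRing 𝔤] [LieAlgebra ℝ 𝔤]

lemma IsOrthonormal.eq_zero {ι : Type*} [Fintype ι] [DecidableEq ι] {e : Module.Basis ι ℝ 𝔤}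
    (he : IsOrthonormal e) {x : 𝔤} (h : ∀ i, metric x (e i) = 0) : x = 0 := by
  rw [← he.sum_eq x]
  simp [h]

lemma IsOrthonormal.lie_mem {ι : Type*} [Fintype ι] [DecidableEq ι] {e : Module.Basis ι ℝ 𝔤}
    (he : IsOrthonormal e) {S : Submodule ℝ 𝔤} {y : 𝔤} (h : ∀ i, ⁅e i, y⁆ ∈ S) (x : 𝔤) :
    ⁅x, y⁆ ∈ S := by
  rw [← he.sum_eq x, _root_.sum_lie]
  exact S.sum_mem fun i _ => by rw [smul_lie]; exact S.smul_mem _ (h i)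

/-- A compact simple Lie algebra with a `ℤ/2`-grading whose even part is abelian has dimension at
most three. -/
lemma finrank_le_three_of_grading [Module.Finite ℝ 𝔤] [LieAlgebra.IsSimple ℝ 𝔤]
    (hc : IsCompactType 𝔤) {ι : Type*} [Fintype ι] [DecidableEq ι] {e : Module.Basis ι ℝ 𝔤}
    (he : IsOrthonormal e) (k : ι → Prop)
    (hkk : ∀ i j, k i → k j → ⁅e i, e j⁆ = 0)
    (hmm : ∀ i j l, ¬ k i → ¬ k j → ¬ k l → metric ⁅e i, e j⁆ (e l) = 0) :
    Module.finrank ℝ 𝔤 ≤ 3 := by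
  have hcom : ∀ i j, k i → k j → ∀ x : 𝔤, ⁅e i, ⁅e j, x⁆⁆ = ⁅e j, ⁅e i, x⁆⁆ := by
    intro i j hi hj x
    rw [leibniz_lie, hkk i j hi hj, zero_lie, zero_add]
  have hne : ∀ i, e i ≠ 0 := fun i => e.ne_zero i
  -- the odd part
  have hm3 : ∀ x y : 𝔤, (∀ j, k j → metric x (e j) = 0) → (∀ j, k j → metric y (e j) = 0) →
      ∀ l, ¬ k l → metric ⁅x, y⁆ (e l) = 0 := by
    intro x y hx hy l hl
    rw [← he.sum_eq x, ← he.sum_eq y, sum_lie, metric_sum_left]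
    refine Finset.sum_eq_zero fun i _ => ?_
    rw [lie_sum, metric_sum_left]
    refine Finset.sum_eq_zero fun j _ => ?_
    rw [smul_lie, lie_smul, metric_smul_left, metric_smul_left]
    by_cases hi : k i
    · simp [hx i hi]
    by_cases hj : k j
    · simp [hy j hj]
    simp [hmm i j l hi hj hl]
  have hk0 : ∀ x : 𝔤, (∀ j, ¬ k j → metric x (e j) = 0) → ∀ i, k i → ⁅e i, x⁆ = 0 := by
    intro x hx i hi
    rw [← he.sum_eq x, lie_sum]
    refine Finset.sum_eq_zero fun j _ => ?_
    by_cases hj : k j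
    · simp [hkk i j hi hj]
    · simp [hx j hj]
  -- The skew operators `ad e_i` with `i` even need not have real eigenvectors, but the products `ad
  -- e_i ∘ ad e_j` are symmetric and commute, so real joint eigenvectors span.
  have hspan := hc.span_joint_eigenvectors
    (fun q : {i // k i} × {i // k i} =>
      (LieAlgebra.ad ℝ 𝔤 (e q.1) : 𝔤 →ₗ[ℝ] 𝔤) ∘ₗ (LieAlgebra.ad ℝ 𝔤 (e q.2) : 𝔤 →ₗ[ℝ] 𝔤))
    (by
      rintro ⟨⟨i, hi⟩, ⟨j, hj⟩⟩ x y
      simp only [LinearMap.comp_apply, LieAlgebra.ad_apply]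
      rw [metric_lie_skew, metric_lie_skew, neg_neg, hcom i j hi hj])
    (by
      rintro ⟨⟨i, hi⟩, ⟨j, hj⟩⟩ ⟨⟨i', hi'⟩, ⟨j', hj'⟩⟩ x
      simp only [LinearMap.comp_apply, LieAlgebra.ad_apply]
      rw [hcom j i' hj hi', hcom i i' hi hi', hcom j j' hj hj', hcom i j' hi hj'])
  by_cases hex : ∃ z : 𝔤, (∀ q : {i // k i} × {i // k i}, ∃ c : ℝ,
      ((LieAlgebra.ad ℝ 𝔤 (e q.1) : 𝔤 →ₗ[ℝ] 𝔤) ∘ₗ (LieAlgebra.ad ℝ 𝔤 (e q.2) : 𝔤 →ₗ[ℝ] 𝔤)) z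
        = c • z) ∧ ∃ i, k i ∧ ⁅e i, z⁆ ≠ 0
  swap
  -- If even basis vectors kill all joint eigenvectors, they are central, so there are none. Then
  -- every bracket vanishes, every basis vector is central, and the dimension is zero.
  · push Not at hex
    have hk : ∀ i, ¬ k i := by
      intro i hi
      refine hne i (hc.eq_zero_of_forall_lie fun y => ?_)
      have hy : y ∈ Submodule.span ℝ _ := hspan ▸ Submodule.mem_top
      have := lie_span_le (W := ⊥) (x := e i) (fun s hs => by simpa using hex s hs i hi) hy
      simpa using this
    have : IsEmpty ι := by
      refine ⟨fun i => hne i (hc.eq_zero_of_forall_lie fun y => ?_)⟩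
      exact he.eq_zero fun l => hm3 _ _ (fun j hj => absurd hj (hk j))
        (fun j hj => absurd hj (hk j)) l (hk l)
    rw [Module.finrank_eq_card_basis e]
    simp
  obtain ⟨z, hz, o, ho, hoz⟩ := hex
  have hz' : ∀ i, k i → ∃ c : ℝ, ⁅e i, ⁅e o, z⁆⁆ = c • z := fun i hi => hz ⟨⟨i, hi⟩, ⟨o, ho⟩⟩
  choose! b hb using hz'
  -- The plane spanned by `z` and `w` is stable under the even part, which acts on it by multiples
  -- of a single operator. The aim is that `z`, `w` and `[z, w]` span an ideal.
  set w := ⁅e o, z⁆ with hw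
  have hww : metric w w = -(b o * metric z z) := by
    conv_lhs => rw [hw, metric_lie_skew, ← hw, hb o ho, metric_smul_right]
  have hb0 : b o ≠ 0 := by
    intro h
    rw [h, zero_mul, neg_zero] at hww
    exact hoz (hc.eq_zero_of_metric_self hww)
  have hzz : metric z z ≠ 0 := by
    intro h
    rw [h, mul_zero, neg_zero] at hww
    exact hoz (hc.eq_zero_of_metric_self hww)
  have hwne : metric w w ≠ 0 := by rw [hww]; exact neg_ne_zero.2 (mul_ne_zero hb0 hzz)
  have hzeq : z = (b o)⁻¹ • ⁅e o, w⁆ := by rw [hb o ho, smul_smul, inv_mul_cancel₀ hb0, one_smul]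
  have hez : ∀ i, k i → ⁅e i, z⁆ = ((b o)⁻¹ * b i) • w := by
    intro i hi
    conv_lhs => rw [hzeq, lie_smul, hcom i o hi ho, hb i hi, lie_smul, smul_smul]
  have hwm : ∀ j, k j → metric w (e j) = 0 := by
    intro j hj
    rw [hw, metric_lie_skew, hkk o j ho hj]; simp
  have hzm : ∀ j, k j → metric z (e j) = 0 := by
    intro j hj
    rw [hzeq, metric_smul_left, metric_lie_skew, hkk o j ho hj]; simp
  have hzw : metric z w = 0 := by
    have : metric w z = -metric z w := by
      conv_lhs => rw [hw, metric_lie_skew]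
    rw [metric_comm w z] at this
    linarith
  set t := ⁅z, w⁆ with ht
  have hkt : ∀ i, k i → ⁅e i, t⁆ = 0 := fun i hi => hk0 t (hm3 z w hzm hwm) i hi
  set S : Submodule ℝ 𝔤 := Submodule.span ℝ {z, w, t} with hS
  have hzS : z ∈ S := Submodule.subset_span (by simp)
  have hwS : w ∈ S := Submodule.subset_span (by simp)
  have htS : t ∈ S := Submodule.subset_span (by simp)
  have htz : ∀ x : 𝔤, (∀ j, ¬ k j → metric x (e j) = 0) → ⁅x, z⁆ ∈ S ∧ ⁅x, w⁆ ∈ S := by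
    intro x hx
    rw [← he.sum_eq x, sum_lie, sum_lie]
    constructor
    all_goals
      refine S.sum_mem fun i _ => ?_
      rw [smul_lie]
      by_cases hi : k i
      · first
        | rw [hez i hi]; exact S.smul_mem _ (S.smul_mem _ hwS)
        | rw [hb i hi]; exact S.smul_mem _ (S.smul_mem _ hzS)
      · rw [hx i hi, zero_smul]; exact S.zero_mem
  -- For odd `y` the bracket `[y, z]` has no odd component. Its even components are pairings of `y`
  -- with `[z, e_l]`, a multiple of `w`, hence zero; likewise for `[y, w]`. Jacobi then gives `[y,
  -- t] = 0`.
  have hodd : ∀ y : 𝔤, (∀ j, k j → metric y (e j) = 0) → metric y z = 0 → metric y w = 0 →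
      ⁅y, z⁆ = 0 ∧ ⁅y, w⁆ = 0 ∧ ⁅y, t⁆ = 0 := by
    intro y hy hyz hyw
    have h1 : ⁅y, z⁆ = 0 := by
      refine he.eq_zero fun l => ?_
      by_cases hl : k l
      · rw [metric_lie_left, ← lie_skew, metric_neg_right, hez l hl, metric_smul_right, hyw]; simp
      · exact hm3 y z hy hzm l hl
    have h2 : ⁅y, w⁆ = 0 := by
      refine he.eq_zero fun l => ?_
      by_cases hl : k l
      · rw [metric_lie_left, ← lie_skew, metric_neg_right, hb l hl, metric_smul_right, hyz]; simp
      · exact hm3 y w hy hwm l hl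
    exact ⟨h1, h2, by rw [ht, leibniz_lie, h1, h2]; simp⟩
  have htmem := htz t (hm3 z w hzm hwm)
  have hbasis : ∀ i, ⁅e i, z⁆ ∈ S ∧ ⁅e i, w⁆ ∈ S ∧ ⁅e i, t⁆ ∈ S := by
    intro i
    by_cases hi : k i
    · refine ⟨?_, ?_, ?_⟩
      · rw [hez i hi]; exact S.smul_mem _ hwS
      · rw [hb i hi]; exact S.smul_mem _ hzS
      · rw [hkt i hi]; exact S.zero_mem
    -- An odd basis vector is split into its components along `z` and `w` and a remainder to which
    -- `hodd` applies.
    · set α := metric (e i) z / metric z z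
      set β := metric (e i) w / metric w w
      obtain ⟨h1, h2, h3⟩ := hodd (e i - α • z - β • w)
        (by
          intro j hj
          have : i ≠ j := fun h => hi (h ▸ hj)
          simp [metric_sub_left, metric_smul_left, hzm j hj, hwm j hj, he i j, this])
        (by
          rw [metric_sub_left, metric_sub_left, metric_smul_left, metric_smul_left,
            metric_comm w z, hzw, div_mul_cancel₀ _ hzz]; ring)
        (by
          rw [metric_sub_left, metric_sub_left, metric_smul_left, metric_smul_left,
            hzw, div_mul_cancel₀ _ hwne]; ring)
      have hsplit : ∀ s : 𝔤, ⁅e i, s⁆ = ⁅e i - α • z - β • w, s⁆ + α • ⁅z, s⁆ + β • ⁅w, s⁆ := by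
        intro s
        simp only [sub_lie, smul_lie]; abel
      refine ⟨?_, ?_, ?_⟩
      · rw [hsplit, h1, lie_self, ← lie_skew w z, ← ht]
        simpa using S.smul_mem β htS
      · rw [hsplit, h2, lie_self, ← ht]
        simpa using S.smul_mem α htS
      · rw [hsplit, h3, ← lie_skew z t, ← lie_skew w t, zero_add]
        exact S.add_mem (S.smul_mem _ (S.neg_mem htmem.1)) (S.smul_mem _ (S.neg_mem htmem.2))
  have htop : S = ⊤ := by
    refine eq_top_of_lie_mem S (fun h => ?_) (fun x y hy => lie_span_le ?_ hy)
    · rw [h, Submodule.mem_bot] at hzS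
      exact hzz (by simp [hzS])
    · rintro s (rfl | rfl | rfl)
      · exact he.lie_mem (fun i => (hbasis i).1) x
      · exact he.lie_mem (fun i => (hbasis i).2.1) x
      · exact he.lie_mem (fun i => (hbasis i).2.2) x
  rw [← finrank_top ℝ 𝔤, ← htop, hS]
  classical
  have := finrank_span_finset_le_card (R := ℝ) ({z, w, t} : Finset 𝔤)
  rw [Finset.coe_insert, Finset.coe_insert, Finset.coe_singleton] at this
  exact this.trans (Finset.card_le_three)

lemma antiderivation_eigen {D : 𝔤 →ₗ[ℝ] 𝔤} (hD : ∀ x y : 𝔤, D ⁅x, y⁆ = -⁅D x, y⁆ - ⁅x, D y⁆)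
    {x y : 𝔤} {a b : ℝ} (hx : D x = a • x) (hy : D y = b • y) :
    D ⁅x, y⁆ = (-a - b) • ⁅x, y⁆ := by
  rw [hD, hx, hy, smul_lie, lie_smul, sub_smul, neg_smul]

/-- The three Jacobi terms are eigenvectors of `D` with eigenvalues `b+c-a`, `c+a-b`, `a+b-c`.
Applying the polynomial in `D` that kills the first two to the Jacobi identity leaves `4(c-a)(c-b)`
times the third. -/
lemma antiderivation_lie_lie_eq_zero {D : 𝔤 →ₗ[ℝ] 𝔤}
    (hD : ∀ x y : 𝔤, D ⁅x, y⁆ = -⁅D x, y⁆ - ⁅x, D y⁆)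
    {x y z : 𝔤} {a b c : ℝ} (hx : D x = a • x) (hy : D y = b • y) (hz : D z = c • z)
    (hca : c ≠ a) (hcb : c ≠ b) : ⁅z, ⁅x, y⁆⁆ = 0 := by
  have hA := antiderivation_eigen hD hx (antiderivation_eigen hD hy hz)
  have hB := antiderivation_eigen hD hy (antiderivation_eigen hD hz hx)
  have hC := antiderivation_eigen hD hz (antiderivation_eigen hD hx hy)
  have h0 : ⁅x, ⁅y, z⁆⁆ + ⁅y, ⁅z, x⁆⁆ + ⁅z, ⁅x, y⁆⁆ = 0 := lie_jacobi x y z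
  have h1 := congrArg D h0
  have h2 := congrArg D h1
  simp only [map_add, map_zero, map_smul, hA, hB, hC] at h1 h2
  set A := ⁅x, ⁅y, z⁆⁆
  set B := ⁅y, ⁅z, x⁆⁆
  set C := ⁅z, ⁅x, y⁆⁆
  have hkey : (4 * (c - a) * (c - b)) • C = 0 := by
    have hA' : A = -B - C := by
      rw [eq_sub_iff_add_eq, eq_neg_iff_add_eq_zero, ← h0]; abel
    rw [hA'] at h1 h2
    have h3 : (2 * (a - b)) • B + (2 * (a - c)) • C = 0 := by
      rw [← h1]; module
    have h4 : ((a + b - c) ^ 2 - (b + c - a) ^ 2) • C + ((c + a - b) ^ 2 - (b + c - a) ^ 2) • B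
        = 0 := by
      rw [← h2]; module
    have h5 : (4 * (c - a) * (c - b)) • C = ((a + b - c) ^ 2 - (b + c - a) ^ 2) • C +
        ((c + a - b) ^ 2 - (b + c - a) ^ 2) • B - (2 * c) • ((2 * (a - b)) • B +
          (2 * (a - c)) • C) := by module
    rw [h5, h3, h4]; simp
  refine (smul_eq_zero.1 hkey).resolve_left ?_
  exact mul_ne_zero (mul_ne_zero (by norm_num) (sub_ne_zero.2 hca)) (sub_ne_zero.2 hcb)

/-- A symmetric endomorphism `D` of a compact simple Lie algebra of dimension greater than three
with `D [x, y] = -[D x, y] - [x, D y]` vanishes. -/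
theorem antiderivation_eq_zero [Module.Finite ℝ 𝔤] [LieAlgebra.IsSimple ℝ 𝔤]
    (hc : IsCompactType 𝔤) (hdim : 3 < Module.finrank ℝ 𝔤)
    {D : 𝔤 →ₗ[ℝ] 𝔤} (hsymm : ∀ x y, metric (D x) y = metric x (D y))
    (hD : ∀ x y : 𝔤, D ⁅x, y⁆ = -⁅D x, y⁆ - ⁅x, D y⁆) : D = 0 := by
  obtain ⟨e, p, he, hp⟩ := hc.exists_eigenbasis D hsymm
  by_contra hD0
  have horth : ∀ {x y : 𝔤} {a b : ℝ}, D x = a • x → D y = b • y → a ≠ b → metric x y = 0 := by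
    intro x y a b hx hy hab
    have h := hsymm x y
    rw [hx, hy, metric_smul_left, metric_smul_right] at h
    have h' : (a - b) * metric x y = 0 := by linarith
    exact (mul_eq_zero.1 h').resolve_left (sub_ne_zero.2 hab)
  obtain ⟨i, hi⟩ : ∃ i, p i ≠ 0 := by
    by_contra! h
    exact hD0 (e.ext fun i => by simp [hp, h])
  obtain ⟨j, hij⟩ : ∃ j, ⁅e i, e j⁆ ≠ 0 := by
    by_contra! h
    refine e.ne_zero i (hc.eq_zero_of_forall_lie fun y => ?_)
    rw [← he.sum_eq y, lie_sum]
    simp [h]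
  -- The eigenvalues of `e i`, `e j` and their bracket sum to zero and are not all equal, because `p
  -- i ≠ 0`. One of them is therefore nonzero and different from the other two; it is named `s`.
  obtain ⟨s, q, r, hs0, hsq, hsr, hsum, hT⟩ : ∃ s q r : ℝ, s ≠ 0 ∧ s ≠ q ∧ s ≠ r ∧ s + q + r = 0 ∧
      ∀ v, (v = p i ∨ v = p j ∨ v = -p i - p j) ↔ (v = s ∨ v = q ∨ v = r) := by
    by_cases h1 : p i = p j
    · refine ⟨-p i - p j, p i, p j, ?_, ?_, ?_, by ring, fun v => by tauto⟩
      · rw [← h1]; intro h; apply hi; linarith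
      · rw [← h1]; intro h; apply hi; linarith
      · rw [← h1]; intro h; apply hi; linarith
    by_cases h2 : p i = -p i - p j
    · refine ⟨p j, p i, -p i - p j, ?_, ?_, ?_, by ring, fun v => by tauto⟩
      · intro h; apply hi; linarith
      · intro h; exact h1 h.symm
      · intro h; apply hi; linarith
    · exact ⟨p i, p j, -p i - p j, hi, h1, h2, by ring, fun v => by tauto⟩
  let T : ℝ → Prop := fun v => v = s ∨ v = q ∨ v = r
  -- These brackets span an ideal. By the vanishing lemma `[e l, [x, y]]` is nonzero only if `p l`
  -- is `a` or `b`, and then it is again such a bracket, because the triple `a, b, -a-b` is merely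
  -- permuted.
  let G : Set 𝔤 := {u | ∃ x y : 𝔤, ∃ a b : ℝ, D x = a • x ∧ D y = b • y ∧ T a ∧ T b ∧ T (-a - b) ∧
    ¬ (a = 0 ∧ b = 0) ∧ u = ⁅x, y⁆}
  have htop : Submodule.span ℝ G = ⊤ := by
    refine eq_top_of_lie_mem _ (fun h => hij ?_) fun x y hy => lie_span_le ?_ hy
    · have : ⁅e i, e j⁆ ∈ Submodule.span ℝ G := Submodule.subset_span
        ⟨e i, e j, p i, p j, hp i, hp j, (hT _).1 (by tauto), (hT _).1 (by tauto),
          (hT _).1 (by tauto), by tauto, rfl⟩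
      rwa [h, Submodule.mem_bot] at this
    · rintro _ ⟨u, v, a, b, hu, hv, ha, hb, hab, hne, rfl⟩
      refine he.lie_mem (fun l => ?_) x
      by_cases h1 : p l = a
      · refine Submodule.subset_span ⟨e l, ⁅u, v⁆, a, -a - b, h1 ▸ hp l,
          antiderivation_eigen hD hu hv, ha, hab, by convert hb using 1; ring, ?_, rfl⟩
        rintro ⟨h, h'⟩; exact hne ⟨h, by linarith⟩
      by_cases h2 : p l = b
      · refine Submodule.subset_span ⟨e l, ⁅u, v⁆, b, -a - b, h2 ▸ hp l,
          antiderivation_eigen hD hu hv, hb, hab, by convert ha using 1; ring, ?_, rfl⟩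
        rintro ⟨h, h'⟩; exact hne ⟨by linarith, h⟩
      · rw [antiderivation_lie_lie_eq_zero hD hu hv (hp l) h1 h2]
        exact Submodule.zero_mem _
  -- Elements of `G` have eigenvalue `-a-b` in `T`, so an eigenvector with any other eigenvalue
  -- would be orthogonal to everything.
  have hpT : ∀ l, T (p l) := by
    intro l
    by_contra hl
    refine e.ne_zero l (hc.eq_of_metric fun z => ?_)
    have hz : z ∈ Submodule.span ℝ G := htop ▸ Submodule.mem_top
    rw [metric_zero_left]
    induction hz using Submodule.span_induction with
    | mem u hu =>
      obtain ⟨x, y, a, b, hx, hy, -, -, hab, -, rfl⟩ := hu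
      exact horth (hp l) (antiderivation_eigen hD hx hy) (fun h => hl (h ▸ hab))
    | zero => simp
    | add a b _ _ ha hb => rw [metric_add_right, ha, hb, add_zero]
    | smul c a _ ha => rw [metric_smul_right, ha, mul_zero]
  -- The bracket of two null vectors commutes with every eigenvector of nonzero eigenvalue. Each
  -- generator in `G` is such an eigenvector, or a bracket of two of them; this is why the pair `a =
  -- b = 0` is excluded from `G`.
  have h00 : ∀ i j, p i = 0 → p j = 0 → ⁅e i, e j⁆ = 0 := by
    intro i j hi hj
    refine hc.eq_zero_of_forall_lie fun y => ?_
    have hcomm : ∀ {z : 𝔤} {c : ℝ}, D z = c • z → c ≠ 0 → ⁅z, ⁅e i, e j⁆⁆ = 0 := fun hz hc0 =>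
      antiderivation_lie_lie_eq_zero hD (hp i) (hp j) hz (by rwa [hi]) (by rwa [hj])
    have hy : y ∈ Submodule.span ℝ G := htop ▸ Submodule.mem_top
    have := lie_span_le (W := ⊥) (x := ⁅e i, e j⁆) ?_ hy
    · simpa using this
    rintro _ ⟨u, v, a, b, hu, hv, ha, hb, hab, hne, rfl⟩
    rw [Submodule.mem_bot]
    by_cases h1 : a = 0
    · have hb0 : b ≠ 0 := fun h => hne ⟨h1, h⟩
      rw [← lie_skew, hcomm (antiderivation_eigen hD hu hv) (by rw [h1]; simpa using hb0), neg_zero]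
    by_cases h2 : b = 0
    · rw [← lie_skew, hcomm (antiderivation_eigen hD hu hv) (by rw [h2]; simpa using h1), neg_zero]
    · have hu' : ⁅⁅e i, e j⁆, u⁆ = 0 := by rw [← lie_skew, hcomm hu h1, neg_zero]
      have hv' : ⁅⁅e i, e j⁆, v⁆ = 0 := by rw [← lie_skew, hcomm hv h2, neg_zero]
      rw [leibniz_lie, hu', hv']
      simp
  have hzero : ∀ i j l, p i + p j + p l ≠ 0 → metric ⁅e i, e j⁆ (e l) = 0 := by
    intro i j l h
    exact horth (antiderivation_eigen hD (hp i) (hp j)) (hp l) (fun h' => h (by linarith))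
  -- The eigenspace of `s` is the even part of a grading. It is abelian because `-2s` is not an
  -- eigenvalue in `T`. Three odd eigenvalues can sum to zero only if all vanish, since `2q + r = 0`
  -- would force `s = q`.
  refine absurd (finrank_le_three_of_grading hc he (fun l => p l = s) ?_ ?_) (by omega)
  · intro i j hi hj
    refine he.eq_zero fun l => hzero i j l fun h => ?_
    rcases hpT l with hl | hl | hl
    · apply hs0; linarith
    · apply hsr; linarith
    · apply hsq; linarith
  · intro i j l hi hj hl
    by_cases h : p i + p j + p l = 0
    · have hii : p i = q ∨ p i = r := (hpT i).resolve_left hi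
      have hjj : p j = q ∨ p j = r := (hpT j).resolve_left hj
      have hll : p l = q ∨ p l = r := (hpT l).resolve_left hl
      have : p i = 0 ∧ p j = 0 := by
        rcases hii with h1 | h1 <;> rcases hjj with h2 | h2 <;> rcases hll with h3 | h3 <;>
          first
          | exact ⟨by linarith, by linarith⟩
          | exact absurd (by linarith : s = q) hsq
          | exact absurd (by linarith : s = r) hsr
      rw [h00 i j this.1 this.2, metric_zero_left]
    · exact hzero i j l h

end Antiderivations

end CartanGeometry

end

/-! ### Rigidity of the bracket and vanishing of second cohomology. -/

noncomputable section

namespace CartanGeometry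

lemma basis_induction {ι V : Type*} [AddCommGroup V] [Module ℝ V] (e : Module.Basis ι ℝ V)
    {p : V → Prop} (hb : ∀ i, p (e i)) (h0 : p 0) (ha : ∀ x y, p x → p y → p (x + y))
    (hs : ∀ (c : ℝ) x, p x → p (c • x)) (x : V) : p x := by
  have hx : x ∈ Submodule.span ℝ (Set.range e) := by rw [e.span_eq]; exact Submodule.mem_top
  induction hx using Submodule.span_induction with
  | mem u hu => obtain ⟨i, rfl⟩ := hu; exact hb i
  | zero => exact h0
  | add a b _ _ h1 h2 => exact ha a b h1 h2
  | smul c a _ h => exact hs c a h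

section Rigidity

variable {𝔤 : Type*} [LieRing 𝔤] [LieAlgebra ℝ 𝔤]

section Basis

variable {ι : Type*} [Fintype ι] [DecidableEq ι] {e : Module.Basis ι ℝ 𝔤}

lemma IsOrthonormal.trace_ad_ad (he : IsOrthonormal e) (x y : 𝔤) :
    ∑ i, metric ⁅x, e i⁆ ⁅y, e i⁆ = metric x y := by
  have h : metric x y = -LinearMap.trace ℝ 𝔤 (LieAlgebra.ad ℝ 𝔤 x ∘ₗ LieAlgebra.ad ℝ 𝔤 y) := by
    rw [metric, killingForm_apply_apply]
  rw [h, he.trace_eq, ← Finset.sum_neg_distrib]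
  refine Finset.sum_congr rfl fun i _ => ?_
  simp only [LinearMap.comp_apply, LieAlgebra.ad_apply]
  rw [metric_lie_skew x, metric_comm]

/-- The constant is exactly `-1` because the metric is minus the trace form of the adjoint
representation itself: pairing with `y` gives minus the sum in `trace_ad_ad`. -/
lemma IsOrthonormal.casimir (hc : IsCompactType 𝔤) (he : IsOrthonormal e) (x : 𝔤) :
    ∑ i, ⁅e i, ⁅e i, x⁆⁆ = -x := by
  refine hc.eq_of_metric fun y => ?_
  rw [metric_sum_left, metric_neg_left, ← he.trace_ad_ad, ← Finset.sum_neg_distrib]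
  refine Finset.sum_congr rfl fun i _ => ?_
  rw [metric_lie_skew, ← lie_skew x, ← lie_skew y, metric_neg_left, metric_neg_right, neg_neg]

/-- This is the common core of both rigidity theorems. Multiplying the hypothesis by `x a`, summing
over `a` and using the symmetry of the squared structure constants gives a vanishing sum of terms
`c² φ(s) s`, with `s = x a + x k + x l`. All terms are nonnegative, so `s = 0` wherever the
structure constant is nonzero, which makes `diag(x)` an antiderivation. -/
lemma eq_zero_of_weighted_sum [Module.Finite ℝ 𝔤] [LieAlgebra.IsSimple ℝ 𝔤]
    (hc : IsCompactType 𝔤) (hdim : 3 < Module.finrank ℝ 𝔤) (he : IsOrthonormal e)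
    (x : ι → ℝ) (φ : ℝ → ℝ) (hφ : ∀ y, y ≠ 0 → 0 < φ y * y)
    (h : ∀ a, ∑ k, ∑ l, metric ⁅e a, e k⁆ (e l) ^ 2 * φ (x a + x k + x l) = 0) (i : ι) :
    x i = 0 := by
  set g : ι → ι → ι → ℝ := fun a k l => metric ⁅e a, e k⁆ (e l) ^ 2 * φ (x a + x k + x l) with hg
  have hcyc : ∀ a k l, g a k l = g k l a := by
    intro a k l
    simp only [hg]
    rw [metric_lie_left, metric_comm, show x a + x k + x l = x k + x l + x a by ring]
  have h1 : ∑ a, ∑ k, ∑ l, x a * g a k l = 0 := by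
    refine Finset.sum_eq_zero fun a _ => ?_
    simp only [← Finset.mul_sum]
    rw [h a, mul_zero]
  have h2 : ∑ a, ∑ k, ∑ l, x k * g a k l = 0 := by
    rw [Finset.sum_comm, ← h1]
    refine Finset.sum_congr rfl fun k _ => ?_
    rw [Finset.sum_comm]
    exact Finset.sum_congr rfl fun l _ => Finset.sum_congr rfl fun a _ => by rw [hcyc]
  have h3 : ∑ a, ∑ k, ∑ l, x l * g a k l = 0 := by
    rw [← h2]
    rw [Finset.sum_comm]
    rw [Finset.sum_comm]
    refine Finset.sum_congr rfl fun a _ => ?_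
    rw [Finset.sum_comm]
    refine Finset.sum_congr rfl fun l _ => Finset.sum_congr rfl fun k _ => ?_
    simp only [hg]
    have : metric ⁅e a, e k⁆ (e l) = -metric ⁅e a, e l⁆ (e k) := by
      rw [metric_lie_skew, metric_comm]
    rw [this, neg_sq, show x a + x k + x l = x a + x l + x k by ring]
  have hsum : ∑ a, ∑ k, ∑ l, (x a + x k + x l) * g a k l = 0 := by
    simp only [add_mul, Finset.sum_add_distrib, h1, h2, h3, add_zero]
  have hnn : ∀ a k l, 0 ≤ (x a + x k + x l) * g a k l := by
    intro a k l
    by_cases h0 : x a + x k + x l = 0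
    · simp [h0]
    · have := hφ _ h0
      have : (x a + x k + x l) * g a k l =
        metric ⁅e a, e k⁆ (e l) ^ 2 * (φ (x a + x k + x l) * (x a + x k + x l)) := by
        simp only [hg]; ring
      rw [this]; positivity
  have hterm : ∀ a k l, (x a + x k + x l) * g a k l = 0 := by
    intro a k l
    have e1 := (Finset.sum_eq_zero_iff_of_nonneg (fun a _ => Finset.sum_nonneg fun k _ =>
      Finset.sum_nonneg fun l _ => hnn a k l)).1 hsum a (Finset.mem_univ _)
    have e2 := (Finset.sum_eq_zero_iff_of_nonneg (fun k _ =>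
      Finset.sum_nonneg fun l _ => hnn a k l)).1 e1 k (Finset.mem_univ _)
    exact (Finset.sum_eq_zero_iff_of_nonneg (fun l _ => hnn a k l)).1 e2 l (Finset.mem_univ _)
  have hf : ∀ a k l, (x a + x k + x l) * metric ⁅e a, e k⁆ (e l) = 0 := by
    intro a k l
    by_cases h0 : x a + x k + x l = 0
    · simp [h0]
    · have h1 := hterm a k l
      simp only [hg] at h1
      have h2 := hφ _ h0
      have h3 : metric ⁅e a, e k⁆ (e l) ^ 2 * (φ (x a + x k + x l) * (x a + x k + x l)) = 0 := by
        rw [← h1]; ring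
      have h4 := (mul_eq_zero.1 h3).resolve_right h2.ne'
      rw [pow_eq_zero_iff (by norm_num)] at h4
      rw [h4, mul_zero]
  set D : 𝔤 →ₗ[ℝ] 𝔤 := e.constr ℝ fun i => x i • e i with hDdef
  have hDe : ∀ i, D (e i) = x i • e i := fun i => e.constr_basis ℝ _ i
  have hDm : ∀ u l, metric (D u) (e l) = x l * metric u (e l) := by
    intro u l
    refine basis_induction e (p := fun u => metric (D u) (e l) = x l * metric u (e l))
      (fun i => ?_) (by simp) (fun a b ha hb => ?_) (fun c a ha => ?_) u
    · rw [hDe, metric_smul_left, he]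
      by_cases hil : i = l <;> simp [hil]
    · rw [map_add, metric_add_left, metric_add_left, ha, hb]; ring
    · rw [map_smul, metric_smul_left, metric_smul_left, ha]; ring
  have hD0 : D = 0 := by
    refine antiderivation_eq_zero hc hdim (fun u v => ?_) fun u v => ?_
    · rw [← he.sum_mul, ← he.sum_mul]
      exact Finset.sum_congr rfl fun i _ => by rw [hDm, hDm]; ring
    · refine basis_induction e (p := fun u => D ⁅u, v⁆ = -⁅D u, v⁆ - ⁅u, D v⁆) (fun i => ?_)
        (by simp) (fun a b ha hb => ?_) (fun c a ha => ?_) u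
      · refine basis_induction e (p := fun v => D ⁅e i, v⁆ = -⁅D (e i), v⁆ - ⁅e i, D v⁆)
          (fun j => ?_) (by simp) (fun a b ha hb => ?_) (fun c a ha => ?_) v
        · rw [← sub_eq_zero]
          refine he.eq_zero fun l => ?_
          rw [hDe, hDe, metric_sub_left, metric_sub_left, metric_neg_left, hDm, smul_lie, lie_smul,
            metric_smul_left, metric_smul_left]
          linarith [hf i j l]
        · simp only [map_add, lie_add, ha, hb]; abel
        · simp only [map_smul, lie_smul, ha, smul_sub, smul_neg]
      · simp only [map_add, add_lie, ha, hb]; abel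
      · simp only [map_smul, smul_lie, ha, smul_sub, smul_neg]
  have := hDe i
  rw [hD0, LinearMap.zero_apply, eq_comm, smul_eq_zero] at this
  exact this.resolve_right (e.ne_zero i)

end Basis

/-- A bilinear form is represented by an endomorphism with respect to the metric. -/
lemma IsCompactType.exists_repr [Module.Finite ℝ 𝔤] (hc : IsCompactType 𝔤)
    (h : 𝔤 →ₗ[ℝ] 𝔤 →ₗ[ℝ] ℝ) : ∃ P : 𝔤 →ₗ[ℝ] 𝔤, ∀ x y, metric (P x) y = h x y := by
  obtain ⟨e, he⟩ := hc.exists_orthonormal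
  refine ⟨∑ i, (h.flip (e i)).smulRight (e i), fun x y => ?_⟩
  conv_rhs => rw [← he.sum_eq y]
  simp only [LinearMap.sum_apply, LinearMap.smulRight_apply, LinearMap.flip_apply,
    metric_sum_left, metric_smul_left, map_sum, map_smul, smul_eq_mul]
  exact Finset.sum_congr rfl fun i _ => by rw [metric_comm y]; ring

/-- A bracket `b` with positive definite `h (x, y) = -tr (b x ∘ b y)` that has the same 3-form as
the Lie bracket of a compact simple Lie algebra of dimension greater than three is the Lie
bracket. -/
theorem bracket_eq_of_form_eq [Module.Finite ℝ 𝔤] [LieAlgebra.IsSimple ℝ 𝔤]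
    (hc : IsCompactType 𝔤) (hdim : 3 < Module.finrank ℝ 𝔤) (b : 𝔤 →ₗ[ℝ] 𝔤 →ₗ[ℝ] 𝔤)
    (hpos : ∀ x, x ≠ 0 → LinearMap.trace ℝ 𝔤 (b x ∘ₗ b x) < 0)
    (hform : ∀ x y z, -LinearMap.trace ℝ 𝔤 (b (b x y) ∘ₗ b z) = metric ⁅x, y⁆ z) (x y : 𝔤) :
    b x y = ⁅x, y⁆ := by
  -- `P` compares the trace form of `b` with the metric. Equality of the 3-forms says `P (b x y) =
  -- [x, y]`, so `b` is known once the eigenvalues of `P` are shown to be 1.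
  obtain ⟨P, hP⟩ := hc.exists_repr (LinearMap.mk₂ ℝ (fun x y => -LinearMap.trace ℝ 𝔤 (b x ∘ₗ b y))
    (by intros; simp [LinearMap.add_comp]; ring) (by intros; simp [LinearMap.smul_comp])
    (by intros; simp [LinearMap.comp_add]; ring) (by intros; simp [LinearMap.comp_smul]))
  simp only [LinearMap.mk₂_apply] at hP
  have hPsymm : ∀ x y, metric (P x) y = metric x (P y) := by
    intro x y
    rw [hP, metric_comm, hP, LinearMap.trace_comp_comm']
  have hPb : ∀ x y, P (b x y) = ⁅x, y⁆ := fun x y => hc.eq_of_metric fun z => by rw [hP, hform]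
  obtain ⟨e, p, he, hp⟩ := hc.exists_eigenbasis P hPsymm
  have hp0 : ∀ i, 0 < p i := by
    intro i
    have h1 := hP (e i) (e i)
    rw [hp, metric_smul_left, he] at h1
    have h2 := hpos (e i) (e.ne_zero i)
    simp at h1
    linarith
  have hPm : ∀ u l, metric (P u) (e l) = p l * metric u (e l) := by
    intro u l
    rw [hPsymm, hp, metric_smul_right]
  have hbm : ∀ u v l, metric (b u v) (e l) = (p l)⁻¹ * metric ⁅u, v⁆ (e l) := by
    intro u v l
    rw [← hPb, hPm, inv_mul_cancel_left₀ (hp0 l).ne']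
  -- In an eigenbasis the trace form of `b` reads `p_a = ∑ c² / (p_k p_l)`, while the Killing form
  -- itself gives `1 = ∑ c²`.
  have htr : ∀ a, ∑ k, ∑ l, metric ⁅e a, e k⁆ (e l) ^ 2 * ((p k)⁻¹ * (p l)⁻¹) = p a := by
    intro a
    have h1 := hP (e a) (e a)
    rw [hp, metric_smul_left, he, if_pos rfl, mul_one, he.trace_eq, ← Finset.sum_neg_distrib] at h1
    rw [h1]
    refine Finset.sum_congr rfl fun k _ => ?_
    rw [LinearMap.comp_apply, hbm, metric_lie_skew, ← he.sum_mul, mul_neg, neg_neg, Finset.mul_sum]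
    refine Finset.sum_congr rfl fun l _ => ?_
    rw [hbm]; ring
  have hone : ∀ a, ∑ k, ∑ l, metric ⁅e a, e k⁆ (e l) ^ 2 = 1 := by
    intro a
    have h1 := he.trace_ad_ad (e a) (e a)
    rw [he, if_pos rfl] at h1
    rw [← h1]
    refine Finset.sum_congr rfl fun k _ => ?_
    rw [← he.sum_mul]
    exact Finset.sum_congr rfl fun l _ => sq _
  -- The two trace identities combine to `∑ c² (1 - 1/(p_a p_k p_l)) = 0`, which is the weighted sum
  -- for `x = log p` and `φ(y) = 1 - exp(-y)`.
  have hx := eq_zero_of_weighted_sum hc hdim he (fun i => Real.log (p i))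
    (fun y => 1 - Real.exp (-y))
    (by
      intro y hy
      rcases lt_or_gt_of_ne hy with h | h
      · exact mul_pos_of_neg_of_neg (by
          have := Real.one_lt_exp_iff.2 (by linarith : 0 < -y); linarith) h
      · refine mul_pos ?_ h
        have := Real.exp_lt_one_iff.2 (by linarith : -y < 0)
        linarith)
    (by
      intro a
      have hterm : ∀ k l, metric ⁅e a, e k⁆ (e l) ^ 2 *
          (1 - Real.exp (-(Real.log (p a) + Real.log (p k) + Real.log (p l)))) =
          metric ⁅e a, e k⁆ (e l) ^ 2 - (p a)⁻¹ * (metric ⁅e a, e k⁆ (e l) ^ 2 *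
            ((p k)⁻¹ * (p l)⁻¹)) := by
        intro k l
        rw [Real.exp_neg, Real.exp_add, Real.exp_add, Real.exp_log (hp0 a), Real.exp_log (hp0 k),
          Real.exp_log (hp0 l), mul_inv, mul_inv]
        ring
      simp only [hterm, Finset.sum_sub_distrib, ← Finset.mul_sum, htr, hone]
      rw [inv_mul_cancel₀ (hp0 a).ne', sub_self])
  have hp1 : ∀ i, p i = 1 := fun i => by
    rw [← Real.exp_log (hp0 i), hx i, Real.exp_zero]
  rw [← sub_eq_zero]
  refine he.eq_zero fun l => ?_
  rw [metric_sub_left, hbm, hp1, inv_one, one_mul, sub_self]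

/-- The infinitesimal version of `bracket_eq_of_form_eq`. -/
theorem bracket_variation_eq_zero [Module.Finite ℝ 𝔤] [LieAlgebra.IsSimple ℝ 𝔤]
    (hc : IsCompactType 𝔤) (hdim : 3 < Module.finrank ℝ 𝔤) (b : 𝔤 →ₗ[ℝ] 𝔤 →ₗ[ℝ] 𝔤)
    (hform : ∀ x y z : 𝔤, -(LinearMap.trace ℝ 𝔤 (b ⁅x, y⁆ ∘ₗ LieAlgebra.ad ℝ 𝔤 z) +
      LinearMap.trace ℝ 𝔤 (LieAlgebra.ad ℝ 𝔤 ⁅x, y⁆ ∘ₗ b z)) + metric (b x y) z = 0) (x y : 𝔤) :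
    b x y = 0 := by
  obtain ⟨S, hS⟩ := hc.exists_repr (LinearMap.mk₂ ℝ
    (fun x y => -(LinearMap.trace ℝ 𝔤 (b x ∘ₗ LieAlgebra.ad ℝ 𝔤 y) +
      LinearMap.trace ℝ 𝔤 (LieAlgebra.ad ℝ 𝔤 x ∘ₗ b y)))
    (by intros; simp [LinearMap.add_comp]; ring) (by intros; simp [LinearMap.smul_comp]; ring)
    (by intros; simp [LinearMap.comp_add]; ring) (by intros; simp [LinearMap.comp_smul]; ring))
  simp only [LinearMap.mk₂_apply] at hS
  have hSsymm : ∀ x y, metric (S x) y = metric x (S y) := by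
    intro x y
    rw [hS, metric_comm, hS, LinearMap.trace_comp_comm', add_comm,
      LinearMap.trace_comp_comm' (LieAlgebra.ad ℝ 𝔤 x : 𝔤 →ₗ[ℝ] 𝔤)]
  have hSb : ∀ x y, b x y = -S ⁅x, y⁆ := fun x y => hc.eq_of_metric fun z => by
    rw [metric_neg_left, hS]; linarith [hform x y z]
  obtain ⟨e, p, he, hp⟩ := hc.exists_eigenbasis S hSsymm
  have hSm : ∀ u l, metric (S u) (e l) = p l * metric u (e l) := by
    intro u l
    rw [hSsymm, hp, metric_smul_right]
  -- Linearising gives `b = -S[·,·]` and `p_a = -∑ c² (p_k + p_l)`. With `∑ c² = 1` this is the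
  -- weighted sum for `φ = id`.
  have hx := eq_zero_of_weighted_sum hc hdim he p id (fun y hy => by
      simpa using mul_self_pos.2 hy)
    (by
      intro a
      have hone : ∑ k, ∑ l, metric ⁅e a, e k⁆ (e l) ^ 2 = 1 := by
        have h1 := he.trace_ad_ad (e a) (e a)
        rw [he, if_pos rfl] at h1
        rw [← h1]
        refine Finset.sum_congr rfl fun k _ => ?_
        rw [← he.sum_mul]
        exact Finset.sum_congr rfl fun l _ => sq _
      have h1 := hS (e a) (e a)
      rw [hp, metric_smul_left, he, if_pos rfl, mul_one, he.trace_eq, he.trace_eq] at h1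
      have h2 : ∀ k, metric (((b (e a)) ∘ₗ (LieAlgebra.ad ℝ 𝔤 (e a) : 𝔤 →ₗ[ℝ] 𝔤)) (e k)) (e k) =
          ∑ l, metric ⁅e a, e k⁆ (e l) ^ 2 * p k := by
        intro k
        rw [LinearMap.comp_apply, LieAlgebra.ad_apply, hSb, metric_neg_left, hSm, metric_lie_skew,
          ← he.sum_mul, mul_neg, neg_neg, Finset.mul_sum]
        exact Finset.sum_congr rfl fun l _ => by ring
      have h3 : ∀ k, metric (((LieAlgebra.ad ℝ 𝔤 (e a) : 𝔤 →ₗ[ℝ] 𝔤) ∘ₗ (b (e a))) (e k)) (e k) =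
          ∑ l, metric ⁅e a, e k⁆ (e l) ^ 2 * p l := by
        intro k
        rw [LinearMap.comp_apply, LieAlgebra.ad_apply, hSb, metric_lie_skew, metric_neg_left,
          neg_neg, ← he.sum_mul]
        exact Finset.sum_congr rfl fun l _ => by rw [hSm]; ring
      simp only [h2, h3] at h1
      simp only [id, mul_add, Finset.sum_add_distrib]
      simp only [← Finset.sum_mul _ _ (p a), hone]
      linarith)
  rw [hSb]
  have : S = 0 := e.ext fun i => by rw [hp, hx]; simp
  rw [this]; simp

/-- Derivations of a compact Lie algebra are inner. -/
lemma exists_ad_of_derivation [Module.Finite ℝ 𝔤] [LieAlgebra.IsKilling ℝ 𝔤] (f : 𝔤 →ₗ[ℝ] 𝔤)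
    (hf : ∀ x y : 𝔤, f ⁅x, y⁆ = ⁅f x, y⁆ + ⁅x, f y⁆) : ∃ a : 𝔤, ∀ x, f x = ⁅a, x⁆ := by
  obtain ⟨a, ha⟩ := LieDerivation.IsKilling.exists_eq_ad (R := ℝ)
    (⟨f, fun x y => by rw [hf, ← lie_skew y (f x)]; abel⟩ : LieDerivation ℝ 𝔤 𝔤)
  exact ⟨a, fun x => by simpa using (congrArg (fun D : LieDerivation ℝ 𝔤 𝔤 => D x) ha).symm⟩

/-- The second cohomology of a compact Lie algebra with coefficients in the adjoint
representation vanishes. -/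
theorem exists_primitive_of_cocycle [Module.Finite ℝ 𝔤] (hc : IsCompactType 𝔤)
    (ψ : 𝔤 →ₗ[ℝ] 𝔤 →ₗ[ℝ] 𝔤) (hskew : ∀ x y, ψ x y = -ψ y x)
    (hψ : ∀ x y z : 𝔤, ψ x ⁅y, z⁆ + ⁅x, ψ y z⁆ + (ψ y ⁅z, x⁆ + ⁅y, ψ z x⁆) +
      (ψ z ⁅x, y⁆ + ⁅z, ψ x y⁆) = 0) :
    ∃ τ : 𝔤 →ₗ[ℝ] 𝔤, ∀ x y, ψ x y = ⁅x, τ y⁆ + ⁅τ x, y⁆ - τ ⁅x, y⁆ := by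
  obtain ⟨e, he⟩ := hc.exists_orthonormal
  -- The Casimir homotopy: contracting the cocycle with `∑ e_i ⊗ e_i` produces a primitive, up to
  -- the Casimir eigenvalue `-1`.
  let h : 𝔤 →ₗ[ℝ] 𝔤 := ∑ i, (LieAlgebra.ad ℝ 𝔤 (e i) : 𝔤 →ₗ[ℝ] 𝔤) ∘ₗ ψ (e i)
  have hh : ∀ x, h x = ∑ i, ⁅e i, ψ (e i) x⁆ := fun x => by simp [h, LinearMap.sum_apply]
  refine ⟨-h, fun y z => ?_⟩
  have inv : ∀ a u : 𝔤, ∑ i, ⁅⁅a, e i⁆, ψ (e i) u⁆ = -∑ i, ⁅e i, ψ ⁅a, e i⁆ u⁆ := by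
    intro a u
    exact he.sum_lie (LinearMap.mk₂ ℝ (fun p q => ⁅p, ψ q u⁆) (by intros; simp) (by intros; simp)
      (by intros; simp) (by intros; simp)) a
  -- The cocycle identity at `(e_i, y, z)`, bracketed with `e_i` and summed. The Casimir turns the
  -- second term into `-ψ y z`; invariance of `∑ e_i ⊗ e_i` cancels what is not a bracket with, or a
  -- value of, `h`.
  have hsum : ∑ i, ⁅e i, ψ (e i) ⁅y, z⁆ + ⁅e i, ψ y z⁆ + (ψ y ⁅z, e i⁆ + ⁅y, ψ z (e i)⁆) +
      (ψ z ⁅e i, y⁆ + ⁅z, ψ (e i) y⁆)⁆ = 0 :=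
    Finset.sum_eq_zero fun i _ => by rw [hψ]; simp
  have t1 : ∀ i, ⁅e i, ψ y ⁅z, e i⁆⁆ = -⁅e i, ψ ⁅z, e i⁆ y⁆ := fun i => by
    rw [hskew, lie_neg]
  have t2 : ∀ i, ⁅e i, ψ z ⁅e i, y⁆⁆ = ⁅e i, ψ ⁅y, e i⁆ z⁆ := fun i => by
    rw [hskew, ← lie_skew (e i) y, map_neg, LinearMap.neg_apply, neg_neg]
  have t3 : ∀ i, ⁅e i, ⁅y, ψ z (e i)⁆⁆ = ⁅⁅y, e i⁆, ψ (e i) z⁆ - ⁅y, ⁅e i, ψ (e i) z⁆⁆ := fun i => by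
    rw [hskew z, leibniz_lie y, lie_neg, lie_neg]; abel
  have t4 : ∀ i, ⁅e i, ⁅z, ψ (e i) y⁆⁆ = ⁅z, ⁅e i, ψ (e i) y⁆⁆ - ⁅⁅z, e i⁆, ψ (e i) y⁆ := fun i => by
    rw [leibniz_lie z]; abel
  simp only [lie_add, Finset.sum_add_distrib, t1, t2, t3, t4, Finset.sum_sub_distrib,
    Finset.sum_neg_distrib, inv, ← lie_sum, ← hh, he.casimir hc] at hsum
  simp only [LinearMap.neg_apply, lie_neg, neg_lie]
  rw [← lie_skew (h y) z, neg_neg]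
  rw [← sub_eq_zero, ← neg_eq_zero, ← hsum]
  abel

end Rigidity

end CartanGeometry

end

noncomputable section

namespace CartanGeometry

/-! ### Skew torsion tensors as 3-forms and their Hodge decomposition. -/

section TorsionModules

variable {𝔤 : Type*} [LieRing 𝔤] [LieAlgebra ℝ 𝔤]

lemma rhoCartan_eq (τ : 𝔤 →ₗ[ℝ] 𝔤) (x y z : 𝔤) :
    rhoCartan τ x y z = metric (τ x) ⁅y, z⁆ + metric x ⁅τ y, z⁆ + metric x ⁅y, τ z⁆ := by
  simp only [rhoCartan, cartanForm_eq]; ring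

lemma rhoCartan_add (τ τ' : 𝔤 →ₗ[ℝ] 𝔤) (x y z : 𝔤) :
    rhoCartan (τ + τ') x y z = rhoCartan τ x y z + rhoCartan τ' x y z := by
  simp only [rhoCartan_eq, LinearMap.add_apply, metric_add_left, metric_add_right, add_lie, lie_add]
  ring

lemma rhoCartan_ad (a x y z : 𝔤) : rhoCartan (LieAlgebra.ad ℝ 𝔤 a) x y z = 0 := by
  simp only [rhoCartan_eq, LieAlgebra.ad_apply]
  rw [metric_lie_skew, leibniz_lie a y z, metric_add_right]
  ring

lemma cartanForm_lie (x a b c : 𝔤) :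
    cartanForm ⁅x, a⁆ b c + cartanForm a ⁅x, b⁆ c + cartanForm a b ⁅x, c⁆ = 0 := by
  have := rhoCartan_ad x a b c
  simp only [rhoCartan, LieAlgebra.ad_apply] at this
  linarith

lemma lie_end_apply (x : 𝔤) (τ : 𝔤 →ₗ[ℝ] 𝔤) (a : 𝔤) : ⁅x, τ⁆ a = ⁅x, τ a⁆ - τ ⁅x, a⁆ := by
  rw [LieHom.lie_apply]

lemma lie_tensor_apply (x : 𝔤) (ξ : 𝔤 →ₗ[ℝ] 𝔤 →ₗ[ℝ] 𝔤) (a : 𝔤) :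
    ⁅x, ξ⁆ a = ⁅x, ξ a⁆ - ξ ⁅x, a⁆ := by
  rw [LieHom.lie_apply]

lemma rhoCartan_lie (x : 𝔤) (τ : 𝔤 →ₗ[ℝ] 𝔤) (a b c : 𝔤) :
    rhoCartan ⁅x, τ⁆ a b c =
      -(rhoCartan τ ⁅x, a⁆ b c + rhoCartan τ a ⁅x, b⁆ c + rhoCartan τ a b ⁅x, c⁆) := by
  have h1 := cartanForm_lie x (τ a) b c
  have h2 := cartanForm_lie x a (τ b) c
  have h3 := cartanForm_lie x a b (τ c)
  simp only [rhoCartan, lie_end_apply]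
  have e1 : ∀ u v : 𝔤, cartanForm (u - v) b c = cartanForm u b c - cartanForm v b c := by
    intro u v; simp [cartanForm]
  have e2 : ∀ u v : 𝔤, cartanForm a (u - v) c = cartanForm a u c - cartanForm a v c := by
    intro u v; simp [cartanForm]
  have e3 : ∀ u v : 𝔤, cartanForm a b (u - v) = cartanForm a b u - cartanForm a b v := by
    intro u v; simp [cartanForm]
  rw [e1, e2, e3]
  linear_combination -h1 - h2 - h3

/-- The tensor `u ↦ ad (β u)`. -/
def adComp (β : 𝔤 →ₗ[ℝ] 𝔤) : 𝔤 →ₗ[ℝ] 𝔤 →ₗ[ℝ] 𝔤 :=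
  (LieAlgebra.ad ℝ 𝔤 : 𝔤 →ₗ[ℝ] Module.End ℝ 𝔤) ∘ₗ β

@[simp] lemma adComp_apply (β : 𝔤 →ₗ[ℝ] 𝔤) (u v : 𝔤) : adComp β u v = ⁅β u, v⁆ := rfl

/-- Invariance of the Cartan form under `ad 𝔤` makes both D₊ and D₋ depend only on the component in
𝔤^⊥, so they can be evaluated on the 3-form instead. -/
lemma rhoCartan_add_adComp (ξ : 𝔤 →ₗ[ℝ] 𝔤 →ₗ[ℝ] 𝔤) (β : 𝔤 →ₗ[ℝ] 𝔤) (u x y z : 𝔤) :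
    rhoCartan ((ξ + adComp β) u) x y z = rhoCartan (ξ u) x y z := by
  rw [LinearMap.add_apply, rhoCartan_add]
  have : rhoCartan (adComp β u) x y z = 0 := rhoCartan_ad (β u) x y z
  rw [this, add_zero]

lemma dPlus_add_adComp (ξ : 𝔤 →ₗ[ℝ] 𝔤 →ₗ[ℝ] 𝔤) (β : 𝔤 →ₗ[ℝ] 𝔤) (a b c d : 𝔤) :
    dPlus (ξ + adComp β) a b c d = dPlus ξ a b c d := by
  simp only [dPlus, rhoCartan_add_adComp]

lemma dMinus_add_adComp {ι : Type*} [Fintype ι] (e : Module.Basis ι ℝ 𝔤)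
    (ξ : 𝔤 →ₗ[ℝ] 𝔤 →ₗ[ℝ] 𝔤) (β : 𝔤 →ₗ[ℝ] 𝔤) (y z : 𝔤) :
    dMinus e (ξ + adComp β) y z = dMinus e ξ y z := by
  simp only [dMinus, rhoCartan_add_adComp]

/-- The totally skew-symmetric tensors in `𝔤 ⊗ 𝔰𝔬(𝔤)`, that is, `Λ³ 𝔤`. -/
def skewTensors (𝔤 : Type*) [LieRing 𝔤] [LieAlgebra ℝ 𝔤] :
    Submodule ℝ (𝔤 →ₗ[ℝ] 𝔤 →ₗ[ℝ] 𝔤) where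
  carrier := {η | (∀ u v, η u v = -η v u) ∧ ∀ u v w, metric (η u v) w = -metric v (η u w)}
  zero_mem' := by simp
  add_mem' := by
    rintro η η' ⟨h1, h2⟩ ⟨h1', h2'⟩
    refine ⟨fun u v => ?_, fun u v w => ?_⟩
    · simp only [LinearMap.add_apply, h1 u v, h1' u v]; abel
    · simp only [LinearMap.add_apply, metric_add_left, metric_add_right, h2 u v w, h2' u v w]; ring
  smul_mem' := by
    rintro c η ⟨h1, h2⟩
    refine ⟨fun u v => ?_, fun u v w => ?_⟩
    · simp only [LinearMap.smul_apply, h1 u v, smul_neg]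
    · simp only [LinearMap.smul_apply, metric_smul_left, metric_smul_right, h2 u v w]; ring

/-- Metric skewness cancels the two `η_u` terms in the torsion condition. What remains is invariance
of `⟨η_u v, w⟩` under cyclic permutation, and together with skewness in the last two slots this is
total skewness. -/
lemma skewTensors_of_skew_torsion {η : 𝔤 →ₗ[ℝ] 𝔤 →ₗ[ℝ] 𝔤} (hc : IsCompactType 𝔤)
    (h : ∀ u v w, metric (η u v) w = -metric v (η u w))
    (hT : ∀ u v w, metric (η u v - η v u) w = -metric (η u w - η w u) v) :
    η ∈ skewTensors 𝔤 := by
  refine ⟨fun u v => hc.eq_of_metric fun w => ?_, h⟩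
  have key : ∀ u v w, metric (η v u) w = metric (η w v) u := by
    intro u v w
    have h1 := hT u v w
    simp only [metric_sub_left] at h1
    have h2 := h u v w
    have h3 := h w u v
    have c1 := metric_comm v (η u w)
    have c2 := metric_comm u (η w v)
    linarith
  rw [metric_neg_left, h u v w, metric_comm, ← key, key u v w]

lemma skew_torsion_of_skewTensors {η : 𝔤 →ₗ[ℝ] 𝔤 →ₗ[ℝ] 𝔤} (h : η ∈ skewTensors 𝔤) (u v w : 𝔤) :
    metric (η u v - η v u) w = -metric (η u w - η w u) v := by
  rw [h.1 v u, h.1 w u, sub_neg_eq_add, sub_neg_eq_add, metric_add_left, metric_add_left,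
    h.2 u v w, metric_comm v]
  ring

lemma gPerp_skew {f : 𝔤 →ₗ[ℝ] 𝔤} (hf : f ∈ gPerp 𝔤) (x y : 𝔤) :
    metric (f x) y = -metric x (f y) := hf.1 x y

lemma mem_skewTorsionModule_iff (hc : IsCompactType 𝔤) {ξ : 𝔤 →ₗ[ℝ] 𝔤 →ₗ[ℝ] 𝔤} :
    ξ ∈ skewTorsionModule 𝔤 ↔ (∀ a, ξ a ∈ gPerp 𝔤) ∧ ∃ β : 𝔤 →ₗ[ℝ] 𝔤,
      ξ + adComp β ∈ skewTensors 𝔤 := by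
  constructor
  · rintro ⟨h, β, hβ⟩
    refine ⟨h, β, skewTensors_of_skew_torsion hc (fun u v w => ?_) hβ⟩
    simp only [LinearMap.add_apply, adComp_apply, metric_add_left, metric_add_right]
    rw [gPerp_skew (h u), metric_lie_skew]; ring
  · rintro ⟨h, β, hβ⟩
    refine ⟨h, β, fun u v w => ?_⟩
    have := skew_torsion_of_skewTensors hβ u v w
    simp only [LinearMap.add_apply, adComp_apply] at this
    exact this

lemma adPart_spec [Module.Finite ℝ 𝔤] [LieAlgebra.IsKilling ℝ 𝔤] (f : Module.End ℝ 𝔤) (a : 𝔤) :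
    killingForm ℝ 𝔤 (adPart f) a = LinearMap.trace ℝ 𝔤 (f * LieAlgebra.ad ℝ 𝔤 a) := by
  unfold adPart
  rw [LinearMap.comp_apply, LinearEquiv.coe_toLinearMap,
    LinearMap.BilinForm.apply_toDual_symm_apply]
  rfl

lemma projPerp_apply [Module.Finite ℝ 𝔤] [LieAlgebra.IsKilling ℝ 𝔤] (f : Module.End ℝ 𝔤) (x : 𝔤) :
    projPerp f x = f x - ⁅adPart f, x⁆ := rfl

lemma adPart_ad [Module.Finite ℝ 𝔤] [LieAlgebra.IsKilling ℝ 𝔤] (hc : IsCompactType 𝔤) (a : 𝔤) :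
    adPart (LieAlgebra.ad ℝ 𝔤 a) = a := by
  refine hc.eq_of_metric fun z => ?_
  rw [metric, metric, adPart_spec, killingForm_apply_apply]
  rfl

lemma projPerp_ad [Module.Finite ℝ 𝔤] [LieAlgebra.IsKilling ℝ 𝔤] (hc : IsCompactType 𝔤) (a : 𝔤) :
    projPerp (LieAlgebra.ad ℝ 𝔤 a) = 0 := by
  ext x
  rw [projPerp_apply, adPart_ad hc]
  simp

lemma projPerp_mem [Module.Finite ℝ 𝔤] [LieAlgebra.IsKilling ℝ 𝔤] {f : Module.End ℝ 𝔤}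
    (hf : ∀ x y, metric (f x) y = -metric x (f y)) : projPerp f ∈ gPerp 𝔤 := by
  refine ⟨fun x y => ?_, fun a => ?_⟩
  · rw [projPerp_apply, projPerp_apply, metric_sub_left, metric_sub_right, hf, metric_lie_skew]
    ring
  · have h : projPerp f = f - LieAlgebra.ad ℝ 𝔤 (adPart f) := rfl
    have h2 := adPart_spec f a
    rw [killingForm_apply_apply] at h2
    rw [h, sub_mul, map_sub, sub_eq_zero]
    exact h2.symm

lemma projPerp_of_mem [Module.Finite ℝ 𝔤] [LieAlgebra.IsKilling ℝ 𝔤] (hc : IsCompactType 𝔤)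
    {f : Module.End ℝ 𝔤} (hf : f ∈ gPerp 𝔤) : projPerp f = f := by
  have : adPart f = 0 := by
    refine hc.eq_of_metric fun z => ?_
    rw [metric, adPart_spec, metric_zero_left, neg_eq_zero]
    exact hf.2 z
  ext x
  rw [projPerp_apply, this]; simp

lemma projPerp_comp_eq [Module.Finite ℝ 𝔤] [LieAlgebra.IsKilling ℝ 𝔤]
    (η : 𝔤 →ₗ[ℝ] 𝔤 →ₗ[ℝ] 𝔤) : projPerp ∘ₗ η + adComp (adPart ∘ₗ η) = η := by
  ext u v
  simp [projPerp_apply]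

/-- The projection changes a tensor only by an `adComp` term, which is exactly the freedom `β` in
the definition of W_skew. Thus Λ³𝔤 projects into W_skew. -/
lemma projPerp_comp_mem [Module.Finite ℝ 𝔤] [LieAlgebra.IsKilling ℝ 𝔤] (hc : IsCompactType 𝔤)
    {η : 𝔤 →ₗ[ℝ] 𝔤 →ₗ[ℝ] 𝔤} (h : η ∈ skewTensors 𝔤) :
    projPerp ∘ₗ η ∈ skewTorsionModule 𝔤 :=
  (mem_skewTorsionModule_iff hc).2
    ⟨fun a => projPerp_mem (h.2 a), adPart ∘ₗ η, by rwa [projPerp_comp_eq]⟩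

lemma projPerp_comp_add_adComp [Module.Finite ℝ 𝔤] [LieAlgebra.IsKilling ℝ 𝔤]
    (hc : IsCompactType 𝔤) {ξ : 𝔤 →ₗ[ℝ] 𝔤 →ₗ[ℝ] 𝔤} (hξ : ∀ a, ξ a ∈ gPerp 𝔤) (β : 𝔤 →ₗ[ℝ] 𝔤) :
    projPerp ∘ₗ (ξ + adComp β) = ξ := by
  refine LinearMap.ext fun a => ?_
  rw [LinearMap.comp_apply, LinearMap.add_apply, map_add, projPerp_of_mem hc (hξ a)]
  have : projPerp (adComp β a) = 0 := projPerp_ad hc (β a)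
  rw [this, add_zero]

/-- An endomorphism in `𝔰𝔬(𝔤)` annihilating the Cartan 3-form is inner. -/
lemma exists_ad_of_rhoCartan [Module.Finite ℝ 𝔤] [LieAlgebra.IsKilling ℝ 𝔤]
    (hc : IsCompactType 𝔤) {τ : 𝔤 →ₗ[ℝ] 𝔤} (hτ : ∀ x y, metric (τ x) y = -metric x (τ y))
    (h : ∀ x y z, rhoCartan τ x y z = 0) : ∃ a : 𝔤, τ = LieAlgebra.ad ℝ 𝔤 a := by
  obtain ⟨a, ha⟩ := exists_ad_of_derivation τ fun x y => hc.eq_of_metric fun z => by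
    have := h z x y
    rw [rhoCartan_eq, hτ] at this
    rw [metric_comm, metric_comm _ z, metric_add_right]
    linarith
  exact ⟨a, LinearMap.ext ha⟩

/-! ### Invariance under the Lie algebra -/

lemma lie_adComp (x : 𝔤) (β : 𝔤 →ₗ[ℝ] 𝔤) : ⁅x, adComp β⁆ = adComp ⁅x, β⁆ := by
  ext u v
  simp only [lie_tensor_apply, LinearMap.sub_apply, lie_end_apply, adComp_apply, sub_lie]
  rw [leibniz_lie x]
  abel

lemma lie_mem_skewTensors (x : 𝔤) {η : 𝔤 →ₗ[ℝ] 𝔤 →ₗ[ℝ] 𝔤} (h : η ∈ skewTensors 𝔤) :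
    ⁅x, η⁆ ∈ skewTensors 𝔤 := by
  have hl : ∀ u v, ⁅x, η⁆ u v = ⁅x, η u v⁆ - η u ⁅x, v⁆ - η ⁅x, u⁆ v := by
    intro u v
    rw [lie_tensor_apply, LinearMap.sub_apply, lie_end_apply]
  refine ⟨fun u v => ?_, fun u v w => ?_⟩
  · rw [hl, hl, h.1 u v, h.1 u ⁅x, v⁆, h.1 ⁅x, u⁆ v, lie_neg]; abel
  · rw [hl, hl]
    simp only [metric_sub_left, metric_sub_right]
    rw [metric_lie_skew, h.2 u v, h.2 u ⁅x, v⁆, h.2 ⁅x, u⁆ v, metric_lie_skew]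
    ring

lemma lie_mem_gPerp (x : 𝔤) {f : 𝔤 →ₗ[ℝ] 𝔤} (hf : f ∈ gPerp 𝔤) : ⁅x, f⁆ ∈ gPerp 𝔤 := by
  refine ⟨fun u v => ?_, fun a => ?_⟩
  · rw [lie_end_apply, lie_end_apply, metric_sub_left, metric_sub_right, metric_lie_skew,
      gPerp_skew hf, gPerp_skew hf, metric_lie_skew]
    ring
  · have h1 : (⁅x, f⁆ : Module.End ℝ 𝔤) * LieAlgebra.ad ℝ 𝔤 a =
        LieAlgebra.ad ℝ 𝔤 x * (f * LieAlgebra.ad ℝ 𝔤 a)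
          - f * (LieAlgebra.ad ℝ 𝔤 x * LieAlgebra.ad ℝ 𝔤 a) := by
      ext u
      simp [Module.End.mul_apply]
    have h2 : f * (LieAlgebra.ad ℝ 𝔤 a * LieAlgebra.ad ℝ 𝔤 x)
          - f * (LieAlgebra.ad ℝ 𝔤 x * LieAlgebra.ad ℝ 𝔤 a) = f * LieAlgebra.ad ℝ 𝔤 ⁅a, x⁆ := by
      ext u
      simp only [LinearMap.sub_apply, Module.End.mul_apply, LieAlgebra.ad_apply, ← map_sub]
      rw [lie_lie]
    rw [h1, map_sub, LinearMap.trace_mul_comm, mul_assoc, ← map_sub, h2, hf.2]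

lemma lie_mem_skewTorsionModule (hc : IsCompactType 𝔤) (x : 𝔤) {ξ : 𝔤 →ₗ[ℝ] 𝔤 →ₗ[ℝ] 𝔤}
    (h : ξ ∈ skewTorsionModule 𝔤) : ⁅x, ξ⁆ ∈ skewTorsionModule 𝔤 := by
  rw [mem_skewTorsionModule_iff hc] at h ⊢
  obtain ⟨h, β, hβ⟩ := h
  refine ⟨fun a => ?_, ⁅x, β⁆, ?_⟩
  · rw [lie_tensor_apply]
    exact (gPerp 𝔤).sub_mem (lie_mem_gPerp x (h a)) (h _)
  · rw [← lie_adComp, ← lie_add]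
    exact lie_mem_skewTensors x hβ

lemma rhoCartan_sub (τ τ' : 𝔤 →ₗ[ℝ] 𝔤) (x y z : 𝔤) :
    rhoCartan (τ - τ') x y z = rhoCartan τ x y z - rhoCartan τ' x y z := by
  simp only [rhoCartan_eq, LinearMap.sub_apply, metric_sub_left, metric_sub_right, sub_lie, lie_sub]
  ring

lemma dPlus_lie (x : 𝔤) (ξ : 𝔤 →ₗ[ℝ] 𝔤 →ₗ[ℝ] 𝔤) (a b c d : 𝔤) :
    dPlus ⁅x, ξ⁆ a b c d = -(dPlus ξ ⁅x, a⁆ b c d + dPlus ξ a ⁅x, b⁆ c d + dPlus ξ a b ⁅x, c⁆ d +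
      dPlus ξ a b c ⁅x, d⁆) := by
  simp only [dPlus, lie_tensor_apply, rhoCartan_sub, rhoCartan_lie]
  ring

lemma dMinus_lie {ι : Type*} [Fintype ι] [DecidableEq ι] {e : Module.Basis ι ℝ 𝔤}
    (he : IsOrthonormal e) (x : 𝔤) (ξ : 𝔤 →ₗ[ℝ] 𝔤 →ₗ[ℝ] 𝔤) (y z : 𝔤) :
    dMinus e ⁅x, ξ⁆ y z = -(dMinus e ξ ⁅x, y⁆ z + dMinus e ξ y ⁅x, z⁆) := by
  have h := he.sum_lie (LinearMap.mk₂ ℝ (fun u v => rhoCartan (ξ u) v y z)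
    (by
      intros; simp only [rhoCartan_eq, LinearMap.add_apply, map_add, metric_add_left,
        metric_add_right, add_lie, lie_add]; ring)
    (by
      intros; simp only [rhoCartan_eq, LinearMap.smul_apply, map_smul, metric_smul_left,
        metric_smul_right, smul_lie, lie_smul, smul_eq_mul]; ring)
    (by intros; simp only [rhoCartan_eq, map_add, metric_add_left]; ring)
    (by intros; simp only [rhoCartan_eq, map_smul, metric_smul_left, smul_eq_mul]; ring)) x
  simp only [LinearMap.mk₂_apply] at h
  simp only [dMinus, lie_tensor_apply, rhoCartan_sub, rhoCartan_lie, neg_add,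
    Finset.sum_sub_distrib, Finset.sum_add_distrib, Finset.sum_neg_distrib]
  rw [h]; ring

lemma lie_mem_closedModule (hc : IsCompactType 𝔤) (x : 𝔤) {ξ : 𝔤 →ₗ[ℝ] 𝔤 →ₗ[ℝ] 𝔤}
    (h : ξ ∈ closedModule 𝔤) : ⁅x, ξ⁆ ∈ closedModule 𝔤 :=
  ⟨lie_mem_skewTorsionModule hc x h.1, fun a b c d => by rw [dPlus_lie]; simp [h.2]⟩

lemma lie_mem_coclosedModule (hc : IsCompactType 𝔤) (x : 𝔤) {ξ : 𝔤 →ₗ[ℝ] 𝔤 →ₗ[ℝ] 𝔤}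
    (h : ξ ∈ coclosedModule 𝔤) : ⁅x, ξ⁆ ∈ coclosedModule 𝔤 :=
  ⟨lie_mem_skewTorsionModule hc x h.1, fun e he y z => by
    rw [dMinus_lie (e := e) he, h.2 e he, h.2 e he]; simp⟩

/-! ### The Chevalley-Eilenberg complex -/

/-- The Chevalley-Eilenberg differential of an endomorphism `α`, a 1-cochain with values in the
adjoint representation; for skew `α` it is the differential of the corresponding 2-form. -/
def cochainDiff (α : 𝔤 →ₗ[ℝ] 𝔤) : 𝔤 →ₗ[ℝ] 𝔤 →ₗ[ℝ] 𝔤 :=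
  LinearMap.mk₂ ℝ (fun u v => ⁅α u, v⁆ + ⁅u, α v⁆ - α ⁅u, v⁆)
    (by intros; simp only [map_add, add_lie]; abel)
    (by intros; simp only [map_smul, smul_lie, smul_add, smul_sub])
    (by intros; simp only [map_add, lie_add]; abel)
    (by intros; simp only [map_smul, lie_smul, smul_add, smul_sub])

lemma cochainDiff_apply (α : 𝔤 →ₗ[ℝ] 𝔤) (u v : 𝔤) :
    cochainDiff α u v = ⁅α u, v⁆ + ⁅u, α v⁆ - α ⁅u, v⁆ := rfl

lemma metric_cochainDiff {α : 𝔤 →ₗ[ℝ] 𝔤} (hα : ∀ x y, metric (α x) y = -metric x (α y))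
    (u v w : 𝔤) : metric (cochainDiff α u v) w =
      metric (α u) ⁅v, w⁆ - metric (α v) ⁅u, w⁆ + metric (α w) ⁅u, v⁆ := by
  rw [cochainDiff_apply, metric_sub_left, metric_add_left, metric_lie_left, metric_lie_skew u,
    hα ⁅u, v⁆ w, metric_comm ⁅u, v⁆]
  ring

lemma cochainDiff_mem {α : 𝔤 →ₗ[ℝ] 𝔤} (hα : ∀ x y, metric (α x) y = -metric x (α y)) :
    cochainDiff α ∈ skewTensors 𝔤 := by
  refine ⟨fun u v => ?_, fun u v w => ?_⟩
  · rw [cochainDiff_apply, cochainDiff_apply, ← lie_skew (α u), ← lie_skew u v, ← lie_skew u (α v),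
      map_neg]
    abel
  · rw [metric_comm v, metric_cochainDiff hα, metric_cochainDiff hα, ← lie_skew w v,
      metric_neg_right]
    ring

lemma rhoCartan_of_skewTensors {η : 𝔤 →ₗ[ℝ] 𝔤 →ₗ[ℝ] 𝔤} (a b c d : 𝔤) :
    rhoCartan (η a) b c d = metric (η a b) ⁅c, d⁆ - metric (η a c) ⁅b, d⁆ +
      metric (η a d) ⁅b, c⁆ := by
  rw [rhoCartan_eq, ← metric_lie_left b c, metric_comm ⁅b, c⁆, ← lie_skew (η a c) d,
    metric_neg_right, ← metric_lie_left b d, metric_comm ⁅b, d⁆]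
  ring

/-- Total skewness makes each pairing occur twice. The six remaining terms are minus the
Chevalley–Eilenberg differential of the 3-form η. -/
lemma dPlus_of_skewTensors {η : 𝔤 →ₗ[ℝ] 𝔤 →ₗ[ℝ] 𝔤} (h : η ∈ skewTensors 𝔤) (a b c d : 𝔤) :
    dPlus η a b c d = 2 * (metric (η a b) ⁅c, d⁆ - metric (η a c) ⁅b, d⁆ + metric (η a d) ⁅b, c⁆ +
      metric (η b c) ⁅a, d⁆ - metric (η b d) ⁅a, c⁆ + metric (η c d) ⁅a, b⁆) := by
  simp only [dPlus, rhoCartan_of_skewTensors]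
  rw [h.1 b a, h.1 c a, h.1 d a, h.1 c b, h.1 d b, h.1 d c]
  simp only [metric_neg_left]
  ring

/-- This is `d² = 0`: the Jacobi identity disposes of four triples of terms, and skewness of α
cancels the three pairs of the shape `⟨α[a,b], [c,d]⟩`. -/
lemma dPlus_cochainDiff {α : 𝔤 →ₗ[ℝ] 𝔤} (hα : ∀ x y, metric (α x) y = -metric x (α y))
    (a b c d : 𝔤) : dPlus (cochainDiff α) a b c d = 0 := by
  rw [dPlus_of_skewTensors (cochainDiff_mem hα)]
  simp only [metric_cochainDiff hα]
  have key : ∀ x u v w : 𝔤,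
      metric (α x) ⁅u, ⁅v, w⁆⁆ - metric (α x) ⁅v, ⁅u, w⁆⁆ + metric (α x) ⁅w, ⁅u, v⁆⁆ = 0 := by
    intro x u v w
    rw [leibniz_lie u v w, ← lie_skew w, metric_add_right, metric_neg_right]; ring
  have s : ∀ u v : 𝔤, metric (α u) v = -metric (α v) u := fun u v => by rw [hα, metric_comm]
  have s1 := s ⁅c, d⁆ ⁅a, b⁆
  have s2 := s ⁅b, d⁆ ⁅a, c⁆
  have s3 := s ⁅b, c⁆ ⁅a, d⁆
  linear_combination 2 * key a b c d - 2 * key b a c d + 2 * key c a b d - 2 * key d a b c +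
    2 * s1 - 2 * s2 + 2 * s3

section Basis

variable {ι : Type*} [Fintype ι] {e : Module.Basis ι ℝ 𝔤}

/-- The contraction `y ↦ ∑ [e_i, η_{e_i} y]`. -/
def contraction (e : Module.Basis ι ℝ 𝔤) (η : 𝔤 →ₗ[ℝ] 𝔤 →ₗ[ℝ] 𝔤) : 𝔤 →ₗ[ℝ] 𝔤 :=
  ∑ i, (LieAlgebra.ad ℝ 𝔤 (e i) : 𝔤 →ₗ[ℝ] 𝔤) ∘ₗ η (e i)

lemma contraction_apply (η : 𝔤 →ₗ[ℝ] 𝔤 →ₗ[ℝ] 𝔤) (y : 𝔤) :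
    contraction e η y = ∑ i, ⁅e i, η (e i) y⁆ := by
  simp [contraction, LinearMap.sum_apply]

/-- Since `η_{e_i} e_i = 0`, only twice the skew part of the contraction survives. In particular
coclosed means that the contraction is a symmetric endomorphism. -/
lemma dMinus_of_skewTensors {η : 𝔤 →ₗ[ℝ] 𝔤 →ₗ[ℝ] 𝔤} (h : η ∈ skewTensors 𝔤) (y z : 𝔤) :
    dMinus e η y z = metric (contraction e η y) z - metric y (contraction e η z) := by
  have h0 : ∀ u, η u u = 0 := fun u => by
    have h1 := h.1 u u
    rw [eq_neg_iff_add_eq_zero, ← two_smul ℝ, smul_eq_zero] at h1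
    exact h1.resolve_left two_ne_zero
  simp only [dMinus, contraction_apply, metric_sum_left, metric_sum_right, ← Finset.sum_sub_distrib]
  refine Finset.sum_congr rfl fun i _ => ?_
  rw [rhoCartan_of_skewTensors, h0, metric_zero_left, metric_lie_skew, metric_comm y,
    metric_lie_skew]
  ring

lemma IsOrthonormal.tensor_eq_zero (hc : IsCompactType 𝔤) {η : 𝔤 →ₗ[ℝ] 𝔤 →ₗ[ℝ] 𝔤}
    (h : ∑ i, ∑ j, metric (η (e i) (e j)) (η (e i) (e j)) = 0) : η = 0 := by
  refine e.ext fun i => e.ext fun j => ?_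
  rw [Finset.sum_eq_zero_iff_of_nonneg
    (fun i _ => Finset.sum_nonneg fun j _ => hc.metric_nonneg _)] at h
  have h' := (Finset.sum_eq_zero_iff_of_nonneg (fun j _ => hc.metric_nonneg _)).1
    (h i (Finset.mem_univ _)) j (Finset.mem_univ _)
  simpa using hc.eq_zero_of_metric_self h'

variable [DecidableEq ι]

/-- The differential on skew endomorphisms is adjoint to the contraction. -/
lemma sum_metric_cochainDiff (he : IsOrthonormal e) {η : 𝔤 →ₗ[ℝ] 𝔤 →ₗ[ℝ] 𝔤}
    (h : η ∈ skewTensors 𝔤) {α : 𝔤 →ₗ[ℝ] 𝔤} (hα : ∀ x y, metric (α x) y = -metric x (α y)) :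
    ∑ i, ∑ j, metric (η (e i) (e j)) (cochainDiff α (e i) (e j)) =
      -- The factor 3 arises because, by total skewness of η, the three terms of the differential
      -- contribute equally.
      -3 * ∑ j, metric (contraction e η (e j)) (α (e j)) := by
  have h2 : ∑ i, ∑ j, metric (η (e i) (e j)) ⁅e i, α (e j)⁆ =
      -∑ j, metric (contraction e η (e j)) (α (e j)) := by
    rw [Finset.sum_comm, ← Finset.sum_neg_distrib]
    refine Finset.sum_congr rfl fun j _ => ?_
    rw [contraction_apply, metric_sum_left, ← Finset.sum_neg_distrib]
    refine Finset.sum_congr rfl fun i _ => ?_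
    rw [metric_lie_skew, neg_neg]
  have h1 : ∑ i, ∑ j, metric (η (e i) (e j)) ⁅α (e i), e j⁆ =
      -∑ j, metric (contraction e η (e j)) (α (e j)) := by
    rw [← h2, Finset.sum_comm]
    refine Finset.sum_congr rfl fun j _ => Finset.sum_congr rfl fun i _ => ?_
    rw [h.1, ← lie_skew, metric_neg_left, metric_neg_right, neg_neg]
  have h3 : ∑ i, ∑ j, metric (η (e i) (e j)) (α ⁅e i, e j⁆) =
      ∑ j, metric (contraction e η (e j)) (α (e j)) := by
    have e1 : ∀ i j, metric (η (e i) (e j)) (α ⁅e i, e j⁆) =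
        -∑ k, metric (η (e i) (e j)) (e k) * metric (α ⁅e i, e j⁆) (e k) * (-1) := by
      intro i j
      rw [← he.sum_mul, ← Finset.sum_neg_distrib]
      exact Finset.sum_congr rfl fun k _ => by ring
    have e2 : ∀ i j k, metric (η (e i) (e j)) (e k) * metric (α ⁅e i, e j⁆) (e k) * (-1) =
        metric (η (e i) (e k)) (e j) * metric ⁅e i, α (e k)⁆ (e j) := by
      intro i j k
      rw [h.2 (e i) (e j) (e k), metric_comm (e j), hα, metric_lie_skew, metric_comm ⁅e i, α (e k)⁆]
      ring
    have e3 : ∑ i, ∑ j, metric (η (e i) (e j)) (α ⁅e i, e j⁆) =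
        -∑ i, ∑ k, metric (η (e i) (e k)) ⁅e i, α (e k)⁆ := by
      rw [← Finset.sum_neg_distrib]
      refine Finset.sum_congr rfl fun i _ => ?_
      simp only [e1, e2]
      rw [Finset.sum_neg_distrib, Finset.sum_comm]
      simp only [he.sum_mul]
    rw [e3, h2, neg_neg]
  simp only [cochainDiff_apply, metric_sub_right, metric_add_right, Finset.sum_sub_distrib,
    Finset.sum_add_distrib, h1, h2, h3]
  ring

/-- For a closed tensor `η`, the Lie derivative is the differential of the contraction. -/
lemma lie_eq_cochainDiff (hc : IsCompactType 𝔤) {η : 𝔤 →ₗ[ℝ] 𝔤 →ₗ[ℝ] 𝔤}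
    (h : η ∈ skewTensors 𝔤) (hd : ∀ a b c d, dPlus η a b c d = 0) (x : 𝔤) :
    ⁅x, η⁆ = cochainDiff (η x) := by
  refine LinearMap.ext fun u => LinearMap.ext fun v => hc.eq_of_metric fun w => ?_
  rw [metric_cochainDiff (h.2 x), lie_tensor_apply, LinearMap.sub_apply, lie_end_apply]
  simp only [metric_sub_left]
  -- With `x` in the first slot, half of `dPlus` is the difference of the two sides: Cartan's
  -- formula `L_x η = d(ι_x η) + ι_x dη`.
  have h1 := hd x u v w
  rw [dPlus_of_skewTensors h] at h1
  have e1 : metric (η u ⁅x, v⁆) w = -metric (η u w) ⁅x, v⁆ := by rw [h.2, metric_comm]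
  have e2 : metric (η ⁅x, u⁆ v) w = metric (η v w) ⁅x, u⁆ := by
    rw [h.1, metric_neg_left, h.2, neg_neg, metric_comm]
  rw [metric_lie_skew, e1, e2]
  linarith

/-- The contraction part of the differential vanishes when `dMinus` does. -/
lemma sum_metric_contraction_eq_zero [Module.Finite ℝ 𝔤] (he : IsOrthonormal e) {η : 𝔤 →ₗ[ℝ] 𝔤 →ₗ[ℝ] 𝔤}
    (h : η ∈ skewTensors 𝔤) (hd : ∀ y z, dMinus e η y z = 0) {α : 𝔤 →ₗ[ℝ] 𝔤}
    (hα : ∀ x y, metric (α x) y = -metric x (α y)) :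
    ∑ j, metric (contraction e η (e j)) (α (e j)) = 0 := by
  -- The contraction is symmetric and α is skew, so the sum equals both `tr(hα)` and `-tr(αh)`.
  have h1 : ∑ j, metric (contraction e η (e j)) (α (e j)) =
      LinearMap.trace ℝ 𝔤 (contraction e η ∘ₗ α) := by
    rw [he.trace_eq]
    refine Finset.sum_congr rfl fun j _ => ?_
    have := hd (e j) (α (e j))
    rw [dMinus_of_skewTensors h] at this
    rw [LinearMap.comp_apply, metric_comm _ (e j)]
    linarith
  have h2 : ∑ j, metric (contraction e η (e j)) (α (e j)) =
      -LinearMap.trace ℝ 𝔤 (α ∘ₗ contraction e η) := by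
    rw [he.trace_eq, ← Finset.sum_neg_distrib]
    refine Finset.sum_congr rfl fun j _ => ?_
    rw [LinearMap.comp_apply, hα, neg_neg]
  rw [LinearMap.trace_comp_comm', ← h1] at h2
  linarith

end Basis

/-- For the 3-form η representing ξ, `L_x η` is exact by Cartan's formula and coclosed by invariance
of D₋, hence orthogonal to itself. So `η_x` is a derivation, therefore inner, and ξ_x lies in both
`ad 𝔤` and 𝔤^⊥. -/
theorem closedModule_inf_coclosedModule [Module.Finite ℝ 𝔤] [LieAlgebra.IsKilling ℝ 𝔤]
    (hc : IsCompactType 𝔤) : closedModule 𝔤 ⊓ coclosedModule 𝔤 = ⊥ := by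
  rw [eq_bot_iff]
  rintro ξ ⟨⟨hξ, hplus⟩, -, hminus⟩
  obtain ⟨hperp, β, hη⟩ := (mem_skewTorsionModule_iff hc).1 hξ
  set η := ξ + adComp β with hηdef
  obtain ⟨e, he⟩ := hc.exists_orthonormal
  have hp : ∀ a b c d, dPlus η a b c d = 0 := fun a b c d => by
    rw [hηdef, dPlus_add_adComp, hplus]
  have hm : ∀ y z, dMinus e η y z = 0 := fun y z => by
    rw [hηdef, dMinus_add_adComp, hminus e he]
  rw [Submodule.mem_bot]
  refine LinearMap.ext fun x => ?_
  have hL := lie_eq_cochainDiff hc hη hp x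
  have hL0 : ⁅x, η⁆ = 0 := by
    refine IsOrthonormal.tensor_eq_zero (e := e) hc ?_
    have h1 := sum_metric_cochainDiff he (lie_mem_skewTensors x hη) (hη.2 x)
    rw [sum_metric_contraction_eq_zero he (lie_mem_skewTensors x hη)
      (fun y z => by rw [dMinus_lie he, hm, hm]; simp) (hη.2 x), mul_zero, ← hL] at h1
    exact h1
  rw [hL] at hL0
  obtain ⟨a, ha⟩ := exists_ad_of_derivation (η x) fun u v => by
    have := congrArg (fun f : 𝔤 →ₗ[ℝ] 𝔤 →ₗ[ℝ] 𝔤 => f u v) hL0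
    simp only [cochainDiff_apply, LinearMap.zero_apply] at this
    exact (sub_eq_zero.1 this).symm
  have hx : ξ x = LieAlgebra.ad ℝ 𝔤 (a - β x) := by
    ext u
    have := ha u
    simp only [hηdef, LinearMap.add_apply, adComp_apply] at this
    rw [LieAlgebra.ad_apply, sub_lie, ← this]; abel
  rw [← projPerp_of_mem hc (hperp x), hx, projPerp_ad hc, LinearMap.zero_apply]

/-- Totally skew tensors are sums of closed and coclosed ones. -/
lemma exists_closed_add_coclosed [Module.Finite ℝ 𝔤] (hc : IsCompactType 𝔤)
    {e : Module.Basis (Fin (Module.finrank ℝ 𝔤)) ℝ 𝔤} (he : IsOrthonormal e)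
    {η : 𝔤 →ₗ[ℝ] 𝔤 →ₗ[ℝ] 𝔤} (hη : η ∈ skewTensors 𝔤) :
    ∃ η₁ ∈ skewTensors 𝔤, ∃ η₂ ∈ skewTensors 𝔤, (∀ a b c d, dPlus η₁ a b c d = 0) ∧
      (∀ y z, dMinus e η₂ y z = 0) ∧ η₁ + η₂ = η := by
  let core : InnerProductSpace.Core ℝ (𝔤 →ₗ[ℝ] 𝔤 →ₗ[ℝ] 𝔤) :=
    { inner := fun η η' => ∑ i, ∑ j, metric (η (e i) (e j)) (η' (e i) (e j))
      conj_inner_symm := fun η η' => by simp [metric_comm]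
      re_inner_nonneg := fun η => by
        simpa using! Finset.sum_nonneg fun i _ => Finset.sum_nonneg fun j _ => hc.metric_nonneg _
      add_left := fun η η' θ => by
        simp only [LinearMap.add_apply, metric_add_left, Finset.sum_add_distrib]
      smul_left := fun η η' r => by
        simp only [LinearMap.smul_apply, metric_smul_left, Finset.mul_sum, conj_trivial]
      definite := fun η h => IsOrthonormal.tensor_eq_zero hc h }
  let _ : NormedAddCommGroup (𝔤 →ₗ[ℝ] 𝔤 →ₗ[ℝ] 𝔤) := core.toNormedAddCommGroup
  let _ : InnerProductSpace ℝ (𝔤 →ₗ[ℝ] 𝔤 →ₗ[ℝ] 𝔤) := InnerProductSpace.ofCore core.toCore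
  have hdm : ∀ (η η' : 𝔤 →ₗ[ℝ] 𝔤 →ₗ[ℝ] 𝔤) y z,
      dMinus e (η + η') y z = dMinus e η y z + dMinus e η' y z := by
    intro η η' y z
    simp only [dMinus, LinearMap.add_apply, rhoCartan_add, Finset.sum_add_distrib]
  have hrs : ∀ (r : ℝ) (τ : 𝔤 →ₗ[ℝ] 𝔤) x y z, rhoCartan (r • τ) x y z = r * rhoCartan τ x y z := by
    intro r τ x y z
    simp only [rhoCartan_eq, LinearMap.smul_apply, metric_smul_left, metric_smul_right, smul_lie,
      lie_smul]
    ring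
  let C : Submodule ℝ (𝔤 →ₗ[ℝ] 𝔤 →ₗ[ℝ] 𝔤) :=
    { carrier := {η | η ∈ skewTensors 𝔤 ∧ ∀ a b c d, dPlus η a b c d = 0}
      zero_mem' := ⟨Submodule.zero_mem _, by simp [dPlus, rhoCartan_eq]⟩
      add_mem' := fun {η η'} h h' => ⟨Submodule.add_mem _ h.1 h'.1, fun a b c d => by
        have h1 := h.2 a b c d
        have h2 := h'.2 a b c d
        simp only [dPlus, LinearMap.add_apply, rhoCartan_add] at *
        linarith⟩
      smul_mem' := fun r {η} h => ⟨Submodule.smul_mem _ r h.1, fun a b c d => by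
        have h1 := h.2 a b c d
        simp only [dPlus, LinearMap.smul_apply, hrs] at *
        linear_combination r * h1⟩ }
  let D : Submodule ℝ (𝔤 →ₗ[ℝ] 𝔤 →ₗ[ℝ] 𝔤) :=
    { carrier := {η | η ∈ skewTensors 𝔤 ∧ ∀ y z, dMinus e η y z = 0}
      zero_mem' := ⟨Submodule.zero_mem _, by simp [dMinus, rhoCartan_eq]⟩
      add_mem' := fun {η η'} h h' => ⟨Submodule.add_mem _ h.1 h'.1, fun y z => by
        rw [hdm, h.2, h'.2, add_zero]⟩
      smul_mem' := fun r {η} h => ⟨Submodule.smul_mem _ r h.1, fun y z => by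
        have h1 := h.2 y z
        simp only [dMinus, LinearMap.smul_apply, hrs, ← Finset.mul_sum] at *
        rw [h1, mul_zero]⟩ }
  have hle : C ⊔ D ≤ skewTensors 𝔤 := sup_le (fun η h => h.1) (fun η h => h.1)
  -- A 3-form orthogonal to the closed ones is shown to be coclosed; being also orthogonal to the
  -- coclosed ones, it vanishes.
  have hbot : (C ⊔ D)ᗮ ⊓ skewTensors 𝔤 = ⊥ := by
    rw [eq_bot_iff]
    rintro X ⟨hX, hXs⟩
    have hXC : ∀ Y ∈ C, ∑ i, ∑ j, metric (Y (e i) (e j)) (X (e i) (e j)) = 0 := fun Y hY =>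
      (Submodule.mem_orthogonal _ _).1 hX Y (Submodule.mem_sup_left hY)
    have hXD : ∀ Y ∈ D, ∑ i, ∑ j, metric (Y (e i) (e j)) (X (e i) (e j)) = 0 := fun Y hY =>
      (Submodule.mem_orthogonal _ _).1 hX Y (Submodule.mem_sup_right hY)
    set h := contraction e X with hh
    -- The test form is `dα` with α twice the skew part of the contraction. Orthogonality to it
    -- gives `|α|² = 0`, because α pairs only with the skew part.
    obtain ⟨α, hα⟩ := hc.exists_repr (LinearMap.mk₂ ℝ (fun y z => metric (h y) z - metric y (h z))
      (by intros; simp only [map_add, metric_add_left]; ring)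
      (by intros; simp only [map_smul, metric_smul_left, smul_eq_mul]; ring)
      (by intros; simp only [map_add, metric_add_right]; ring)
      (by intros; simp only [map_smul, metric_smul_right, smul_eq_mul]; ring))
    simp only [LinearMap.mk₂_apply] at hα
    have hαs : ∀ x y, metric (α x) y = -metric x (α y) := by
      intro x y
      rw [metric_comm x, hα, hα, metric_comm y, metric_comm (h y)]; ring
    have h1 : ∑ j, metric (h (e j)) (α (e j)) = 0 := by
      have h2 := hXC (cochainDiff α) ⟨cochainDiff_mem hαs, dPlus_cochainDiff hαs⟩
      have h3 := sum_metric_cochainDiff he hXs hαs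
      simp only [metric_comm (X _ _)] at h3
      rw [h2] at h3
      linarith
    have h2 : ∑ j, metric (α (e j)) (α (e j)) = 0 := by
      have e1 : ∀ j, metric (α (e j)) (α (e j)) =
        metric (h (e j)) (α (e j)) - metric ((h ∘ₗ α) (e j)) (e j) := fun j => by
          conv_lhs => rw [hα, metric_comm (e j)]
          rfl
      have e2 : ∀ j, metric ((α ∘ₗ h) (e j)) (e j) = -metric (h (e j)) (α (e j)) := fun j => by
        rw [LinearMap.comp_apply, hαs]
      simp only [e1, Finset.sum_sub_distrib]
      rw [← he.trace_eq, LinearMap.trace_comp_comm', he.trace_eq]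
      simp only [e2, Finset.sum_neg_distrib, h1]
      ring
    have hα0 : α = 0 := e.ext fun j => by
      have := (Finset.sum_eq_zero_iff_of_nonneg (fun j _ => hc.metric_nonneg _)).1 h2 j
        (Finset.mem_univ _)
      simpa using hc.eq_zero_of_metric_self this
    have hXD' : X ∈ D := ⟨hXs, fun y z => by
      rw [dMinus_of_skewTensors hXs, ← hh, ← hα, hα0]; simp⟩
    exact (Submodule.mem_bot _).2 (IsOrthonormal.tensor_eq_zero hc (hXD X hXD'))
  have hsup := Submodule.sup_orthogonal_inf_of_hasOrthogonalProjection hle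
  rw [hbot, sup_bot_eq] at hsup
  rw [← hsup] at hη
  obtain ⟨η₁, h₁, η₂, h₂, h⟩ := Submodule.mem_sup.1 hη
  exact ⟨η₁, h₁.1, η₂, h₂.1, h₁.2, h₂.2, h⟩

/-- The vanishing of `dMinus` does not depend on the orthonormal basis. -/
lemma dMinus_eq_of_orthonormal {ι ι' : Type*} [Fintype ι] [DecidableEq ι] [Fintype ι']
    [DecidableEq ι'] {e : Module.Basis ι ℝ 𝔤} {f : Module.Basis ι' ℝ 𝔤} (he : IsOrthonormal e)
    (hf : IsOrthonormal f) (ξ : 𝔤 →ₗ[ℝ] 𝔤 →ₗ[ℝ] 𝔤) (y z : 𝔤) : dMinus e ξ y z = dMinus f ξ y z := by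
  let S : 𝔤 →ₗ[ℝ] 𝔤 →ₗ[ℝ] ℝ := LinearMap.mk₂ ℝ (fun u v => rhoCartan (ξ u) v y z)
    (by
      intros; simp only [rhoCartan_eq, LinearMap.add_apply, map_add, metric_add_left,
        metric_add_right, add_lie, lie_add]; ring)
    (by
      intros; simp only [rhoCartan_eq, LinearMap.smul_apply, map_smul, metric_smul_left,
        metric_smul_right, smul_lie, lie_smul, smul_eq_mul]; ring)
    (by intros; simp only [rhoCartan_eq, map_add, metric_add_left]; ring)
    (by intros; simp only [rhoCartan_eq, map_smul, metric_smul_left, smul_eq_mul]; ring)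
  change ∑ i, S (e i) (e i) = ∑ i, S (f i) (f i)
  have h1 : ∀ i, S (e i) (e i) = ∑ j, metric (e i) (f j) * S (f j) (e i) := by
    intro i
    calc S (e i) (e i) = S (∑ j, metric (e i) (f j) • f j) (e i) := by rw [hf.sum_eq]
      _ = _ := by simp only [map_sum, LinearMap.sum_apply, map_smul, LinearMap.smul_apply,
                    smul_eq_mul]
  have h2 : ∀ j, S (f j) (f j) = ∑ i, metric (f j) (e i) * S (f j) (e i) := by
    intro j
    calc S (f j) (f j) = S (f j) (∑ i, metric (f j) (e i) • e i) := by rw [he.sum_eq]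
      _ = _ := by simp only [map_sum, map_smul, smul_eq_mul]
  simp only [h1, h2]
  rw [Finset.sum_comm]
  exact Finset.sum_congr rfl fun j _ => Finset.sum_congr rfl fun i _ => by rw [metric_comm]

/-- The decomposition is made for the totally skew representative and then projected. The projection
recovers ξ and does not affect D₊ or D₋. -/
theorem closedModule_sup_coclosedModule [Module.Finite ℝ 𝔤] [LieAlgebra.IsKilling ℝ 𝔤]
    (hc : IsCompactType 𝔤) : closedModule 𝔤 ⊔ coclosedModule 𝔤 = skewTorsionModule 𝔤 := by
  refine le_antisymm (sup_le (fun ξ h => h.1) (fun ξ h => h.1)) fun ξ hξ => ?_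
  obtain ⟨hperp, β, hη⟩ := (mem_skewTorsionModule_iff hc).1 hξ
  obtain ⟨e, he⟩ := hc.exists_orthonormal
  obtain ⟨η₁, h₁, η₂, h₂, hp, hm, hsum⟩ := exists_closed_add_coclosed hc he hη
  have hdec : ξ = projPerp ∘ₗ η₁ + projPerp ∘ₗ η₂ := by
    rw [← LinearMap.comp_add, hsum, projPerp_comp_add_adComp hc hperp]
  rw [hdec]
  refine Submodule.add_mem_sup ⟨projPerp_comp_mem hc h₁, fun a b c d => ?_⟩
    ⟨projPerp_comp_mem hc h₂, fun f hf y z => ?_⟩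
  · rw [← dPlus_add_adComp _ (adPart ∘ₗ η₁), projPerp_comp_eq, hp]
  · rw [← dMinus_add_adComp _ _ (adPart ∘ₗ η₂), projPerp_comp_eq,
      dMinus_eq_of_orthonormal (e := f) hf he, hm]

end TorsionModules

end CartanGeometry

end

/-! ### The bracket as a smooth function of the 3-form. -/

noncomputable section

namespace CartanGeometry

open Filter Topology

lemma eq_zero_of_basis₃ {ι V : Type*} [AddCommGroup V] [Module ℝ V] (e : Module.Basis ι ℝ V)
    {f : V → V → V → ℝ} (h1 : ∀ y u, IsLinearMap ℝ fun x => f x y u)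
    (h2 : ∀ x u, IsLinearMap ℝ fun y => f x y u) (h3 : ∀ x y, IsLinearMap ℝ fun u => f x y u)
    (h : ∀ i j k, f (e i) (e j) (e k) = 0) (x y u : V) : f x y u = 0 := by
  have e3 : ∀ i j u, f (e i) (e j) u = 0 := fun i j u =>
    congrArg (fun l => l u) (e.ext (f₁ := (h3 (e i) (e j)).mk') (f₂ := 0) fun k => h i j k)
  have e2 : ∀ i y u, f (e i) y u = 0 := fun i y u =>
    congrArg (fun l => l y) (e.ext (f₁ := (h2 (e i) u).mk') (f₂ := 0) fun j => e3 i j u)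
  exact congrArg (fun l => l x) (e.ext (f₁ := (h1 y u).mk') (f₂ := 0) fun i => e2 i y u)

section FormBracket

variable {E : Type*} [NormedAddCommGroup E] [NormedSpace ℝ E]
  {𝔤 : Type*} [LieRing 𝔤] [LieAlgebra ℝ 𝔤]

/-- The bilinear map on `𝔤` corresponding to one on `E`. -/
def pushBilin (I : E ≃ₗ[ℝ] 𝔤) (b : E →L[ℝ] E →L[ℝ] E) : 𝔤 →ₗ[ℝ] 𝔤 →ₗ[ℝ] 𝔤 :=
  LinearMap.mk₂ ℝ (fun x y => I (b (I.symm x) (I.symm y))) (by intros; simp) (by intros; simp)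
    (by intros; simp) (by intros; simp)

@[simp] lemma pushBilin_apply (I : E ≃ₗ[ℝ] 𝔤) (b : E →L[ℝ] E →L[ℝ] E) (x y : 𝔤) :
    pushBilin I b x y = I (b (I.symm x) (I.symm y)) := rfl

variable [FiniteDimensional ℝ E]

/-- Bilinear maps on a finite-dimensional space are continuous. -/
def toCLM₂ (E F : Type*) [NormedAddCommGroup E] [NormedSpace ℝ E] [FiniteDimensional ℝ E]
    [NormedAddCommGroup F] [NormedSpace ℝ F] : (E →ₗ[ℝ] E →ₗ[ℝ] F) ≃ₗ[ℝ] (E →L[ℝ] E →L[ℝ] F) :=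
  (LinearEquiv.congrRight LinearMap.toContinuousLinearMap) ≪≫ₗ LinearMap.toContinuousLinearMap

@[simp] lemma toCLM₂_apply {F : Type*} [NormedAddCommGroup F] [NormedSpace ℝ F]
    (b : E →ₗ[ℝ] E →ₗ[ℝ] F) (x y : E) : toCLM₂ E F b x y = b x y := rfl

/-- The trace of a continuous endomorphism. -/
def traceCLM (E : Type*) [NormedAddCommGroup E] [NormedSpace ℝ E] [FiniteDimensional ℝ E] :
    (E →L[ℝ] E) →L[ℝ] ℝ :=
  LinearMap.toContinuousLinearMap (LinearMap.trace ℝ E ∘ₗ ContinuousLinearMap.coeLM ℝ)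

lemma traceCLM_apply (f : E →L[ℝ] E) :
    traceCLM E f = LinearMap.trace ℝ E (f : E →ₗ[ℝ] E) := rfl

/-- The frame `I` is adapted to the 3-form `w` on a vector space. -/
def IsAdaptedForm (w : E [⋀^Fin 3]→L[ℝ] ℝ) (I : E ≃ₗ[ℝ] 𝔤) : Prop :=
  ∀ u v x, w ![u, v, x] = cartanForm (I u) (I v) (I x)

/-- The Lie bracket transported by a frame. -/
def pullBracket (I : E ≃ₗ[ℝ] 𝔤) : E →L[ℝ] E →L[ℝ] E :=
  toCLM₂ E E (LinearMap.mk₂ ℝ (fun x y => I.symm ⁅I x, I y⁆) (by intros; simp) (by intros; simp)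
    (by intros; simp) (by intros; simp))

@[simp] lemma pullBracket_apply (I : E ≃ₗ[ℝ] 𝔤) (x y : E) :
    pullBracket I x y = I.symm ⁅I x, I y⁆ := rfl

lemma pushBilin_pullBracket (I : E ≃ₗ[ℝ] 𝔤) (x : 𝔤) :
    pushBilin I (pullBracket I) x = LieAlgebra.ad ℝ 𝔤 x := by
  ext y; simp

lemma trace_pushBilin_comp (I : E ≃ₗ[ℝ] 𝔤) (b c : E →L[ℝ] E →L[ℝ] E) (x y : 𝔤) :
    LinearMap.trace ℝ 𝔤 (pushBilin I b x ∘ₗ pushBilin I c y) =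
      traceCLM E (b (I.symm x) ∘L c (I.symm y)) := by
  rw [traceCLM_apply, ← LinearMap.trace_conj' _ I]
  congr 1
  ext u
  simp [LinearEquiv.conj_apply]

lemma trace_pullBracket (I : E ≃ₗ[ℝ] 𝔤) (x y : E) :
    traceCLM E (pullBracket I x ∘L pullBracket I y) = -metric (I x) (I y) := by
  have := trace_pushBilin_comp I (pullBracket I) (pullBracket I) (I x) (I y)
  rw [I.symm_apply_apply, I.symm_apply_apply] at this
  rw [← this, pushBilin_pullBracket, pushBilin_pullBracket, metric, killingForm_apply_apply,
    neg_neg]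

/-- The trilinear form `tr (ad [x, y] ∘ ad u)` of a bracket `b`. -/
def bracketForm (b : E →L[ℝ] E →L[ℝ] E) (x y u : E) : ℝ :=
  traceCLM E (b (b x y) ∘L b u)

/-- By invariance of the Killing form, the 3-form is recovered from the bracket by an expression
cubic in the bracket. Smooth dependence is obtained by inverting this polynomial map. -/
lemma bracketForm_pullBracket {w : E [⋀^Fin 3]→L[ℝ] ℝ} {I : E ≃ₗ[ℝ] 𝔤} (h : IsAdaptedForm w I)
    (x y u : E) : bracketForm (pullBracket I) x y u = w ![x, y, u] := by
  rw [bracketForm, trace_pullBracket, h, cartanForm_eq, pullBracket_apply, I.apply_symm_apply,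
    metric_lie_left]

section Deriv

variable {F : Type*} [NormedAddCommGroup F] [NormedSpace ℝ F]

lemma _root_.HasFDerivAt.traceCLM_comp {b c : F → E →L[ℝ] E} {b' c' : F →L[ℝ] E →L[ℝ] E} {z : F}
    (hb : HasFDerivAt b b' z) (hc : HasFDerivAt c c' z) :
    ∃ L : F →L[ℝ] ℝ, HasFDerivAt (fun z => traceCLM E (b z ∘L c z)) L z ∧
      ∀ v, L v = traceCLM E (b' v ∘L c z) + traceCLM E (b z ∘L c' v) := by
  refine ⟨_, (traceCLM E).hasFDerivAt.comp z (hb.clm_comp hc), fun v => ?_⟩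
  simp [add_comm]

lemma _root_.HasFDerivAt.bracketForm {b : F → E →L[ℝ] E →L[ℝ] E} {b' : F →L[ℝ] E →L[ℝ] E →L[ℝ] E}
    {z : F} (hb : HasFDerivAt b b' z) (x y u : E) :
    ∃ L : F →L[ℝ] ℝ, HasFDerivAt (fun z => bracketForm (b z) x y u) L z ∧
      ∀ v, L v = traceCLM E (b' v (b z x y) ∘L b z u) + traceCLM E (b z (b' v x y) ∘L b z u) +
        traceCLM E (b z (b z x y) ∘L b' v u) := by
  have h1 : ∀ x, HasFDerivAt (fun z => b z x) (b'.flip x) z := fun x => by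
    simpa using! hb.clm_apply (hasFDerivAt_const x z)
  have h2 : HasFDerivAt (fun z => b z x y) ((b'.flip x).flip y) z := by
    simpa using! (h1 x).clm_apply (hasFDerivAt_const y z)
  obtain ⟨L, hL, hv⟩ := (hb.clm_apply h2).traceCLM_comp (h1 u)
  refine ⟨L, hL, fun v => ?_⟩
  rw [hv]
  simp [ContinuousLinearMap.add_comp, add_comm]

end Deriv

lemma contDiff_bracketForm (x y u : E) :
    ContDiff ℝ ∞ (fun b : E →L[ℝ] E →L[ℝ] E => bracketForm b x y u) := by
  unfold bracketForm
  refine (traceCLM E).contDiff.comp (ContDiff.clm_comp ?_ ?_)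
  · exact contDiff_id.clm_apply ((contDiff_id.clm_apply contDiff_const).clm_apply contDiff_const)
  · exact contDiff_id.clm_apply contDiff_const

/-- The quadratic form needs control only on the compact unit sphere; homogeneity does the rest. -/
lemma eventually_trace_neg {b₀ : E →L[ℝ] E →L[ℝ] E}
    (h : ∀ x, x ≠ 0 → traceCLM E (b₀ x ∘L b₀ x) < 0) :
    ∀ᶠ b in 𝓝 b₀, ∀ x, x ≠ 0 → traceCLM E (b x ∘L b x) < 0 := by
  have hcont : Continuous fun p : (E →L[ℝ] E →L[ℝ] E) × E =>
      traceCLM E (p.1 p.2 ∘L p.1 p.2) := by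
    fun_prop
  have h1 : ∀ᶠ b in 𝓝 b₀, ∀ x ∈ Metric.sphere (0 : E) 1, traceCLM E (b x ∘L b x) < 0 := by
    refine (isCompact_sphere (0 : E) 1).eventually_forall_of_forall_eventually fun x hx => ?_
    have hx0 : x ≠ 0 := by
      rintro rfl
      simp at hx
    exact hcont.continuousAt.eventually_lt continuousAt_const (h x hx0)
  filter_upwards [h1] with b hb x hx
  have h2 := hb (‖x‖⁻¹ • x) (by simp [norm_smul, hx])
  simp only [map_smul, ContinuousLinearMap.smul_comp, ContinuousLinearMap.comp_smul, smul_eq_mul]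
    at h2
  have h3 : 0 < ‖x‖⁻¹ := by positivity
  by_contra hcon
  push Not at hcon
  have := mul_nonneg h3.le (mul_nonneg h3.le hcon)
  linarith

/-- Both dimensions are n³. The target consists of all trilinear coordinates, not merely the
alternating ones, so that an injective derivative is invertible. -/
lemma finrank_bilin {ι : Type*} [Fintype ι] (e : Module.Basis ι ℝ E) :
    Module.finrank ℝ (E →L[ℝ] E →L[ℝ] E) = Module.finrank ℝ (ι × ι × ι → ℝ) := by
  rw [← (toCLM₂ E E).finrank_eq, Module.finrank_linearMap, Module.finrank_linearMap,
    Module.finrank_fintype_fun_eq_card, Fintype.card_prod, Fintype.card_prod,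
    Module.finrank_eq_card_basis e]

/-- The 3-forms given by brackets, evaluated on triples of basis vectors. -/
def bracketCoords {ι : Type*} (e : Module.Basis ι ℝ E) (b : E →L[ℝ] E →L[ℝ] E)
    (j : ι × ι × ι) : ℝ := bracketForm b (e j.1) (e j.2.1) (e j.2.2)

lemma contDiff_bracketCoords {ι : Type*} [Fintype ι] (e : Module.Basis ι ℝ E) :
    ContDiff ℝ ∞ (bracketCoords e) :=
  contDiff_pi.2 fun _ => contDiff_bracketForm _ _ _

lemma bracketForm_of_bracketCoords {ι : Type*} (e : Module.Basis ι ℝ E) {b : E →L[ℝ] E →L[ℝ] E}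
    {w : E [⋀^Fin 3]→L[ℝ] ℝ} {I : E ≃ₗ[ℝ] 𝔤} (hI : IsAdaptedForm w I)
    (h : ∀ j, bracketCoords e b j = w ![e j.1, e j.2.1, e j.2.2]) (x y u : E) :
    bracketForm b x y u = w ![x, y, u] := by
  rw [← sub_eq_zero, hI]
  refine eq_zero_of_basis₃ e (f := fun x y u => bracketForm b x y u - cartanForm (I x) (I y) (I u))
    (fun y u => ⟨fun _ _ => ?_, fun _ _ => ?_⟩) (fun x u => ⟨fun _ _ => ?_, fun _ _ => ?_⟩)
    (fun x y => ⟨fun _ _ => ?_, fun _ _ => ?_⟩) (fun i j k => ?_) x y u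
  · simp only [bracketForm, cartanForm, map_add, _root_.add_apply, ContinuousLinearMap.add_comp,
      LinearMap.add_apply]
    ring
  · simp only [bracketForm, cartanForm, map_smul, _root_.smul_apply, ContinuousLinearMap.smul_comp,
      smul_eq_mul, LinearMap.smul_apply]
    ring
  · simp only [bracketForm, cartanForm, map_add, ContinuousLinearMap.add_comp, add_lie]; ring
  · simp only [bracketForm, cartanForm, map_smul, ContinuousLinearMap.smul_comp, smul_lie,
      smul_eq_mul]
    ring
  · simp only [bracketForm, cartanForm, map_add, ContinuousLinearMap.comp_add, lie_add]; ring
  · simp only [bracketForm, cartanForm, map_smul, ContinuousLinearMap.comp_smul, lie_smul,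
      smul_eq_mul]
    ring
  · rw [← hI, sub_eq_zero]
    exact h (i, j, k)

variable [Module.Finite ℝ 𝔤] [LieAlgebra.IsSimple ℝ 𝔤]

lemma bracket_variation_pullBracket (hc : IsCompactType 𝔤) (hdim : 3 < Module.finrank ℝ 𝔤)
    (I : E ≃ₗ[ℝ] 𝔤) {c : E →L[ℝ] E →L[ℝ] E}
    (h : ∀ x y u, traceCLM E (c (pullBracket I x y) ∘L pullBracket I u) +
      traceCLM E (pullBracket I (c x y) ∘L pullBracket I u) +
        traceCLM E (pullBracket I (pullBracket I x y) ∘L c u) = 0) : c = 0 := by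
  have h0 := bracket_variation_eq_zero hc hdim (pushBilin I c) fun x y z => by
    rw [← pushBilin_pullBracket I z, ← pushBilin_pullBracket I ⁅x, y⁆, trace_pushBilin_comp,
      trace_pushBilin_comp]
    have := h (I.symm x) (I.symm y) (I.symm z)
    rw [trace_pullBracket I (c _ _)] at this
    simp only [pullBracket_apply, I.apply_symm_apply] at this
    rw [pushBilin_apply]
    linarith
  ext x y
  simpa using h0 (I x) (I y)

/-- A vector in the kernel is a variation of the bracket that leaves the 3-form unchanged to first
order, which infinitesimal rigidity excludes. -/
lemma injective_fderiv_bracketCoords {ι : Type*} [Fintype ι] (e : Module.Basis ι ℝ E)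
    (hc : IsCompactType 𝔤) (hdim : 3 < Module.finrank ℝ 𝔤) (I : E ≃ₗ[ℝ] 𝔤) :
    Function.Injective (fderiv ℝ (bracketCoords e) (pullBracket I)) := by
  have hd := ((contDiff_bracketCoords e).differentiable (by simp)).differentiableAt.hasFDerivAt
    (x := pullBracket I)
  rw [injective_iff_map_eq_zero]
  intro c hc0
  set b₀ := pullBracket I with hb₀
  refine bracket_variation_pullBracket hc hdim I (eq_zero_of_basis₃ e
    (fun y u => ⟨fun _ _ => ?_, fun _ _ => ?_⟩) (fun x u => ⟨fun _ _ => ?_, fun _ _ => ?_⟩)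
    (fun x y => ⟨fun _ _ => ?_, fun _ _ => ?_⟩) fun i j k => ?_)
  · simp only [map_add, _root_.add_apply, ContinuousLinearMap.add_comp]; ring
  · simp only [map_smul, _root_.smul_apply, ContinuousLinearMap.smul_comp, smul_eq_mul]; ring
  · simp only [map_add, ContinuousLinearMap.add_comp]; ring
  · simp only [map_smul, ContinuousLinearMap.smul_comp, smul_eq_mul]; ring
  · simp only [map_add, ContinuousLinearMap.comp_add]; ring
  · simp only [map_smul, ContinuousLinearMap.comp_smul, smul_eq_mul]; ring
  · obtain ⟨L, hL, hv⟩ := HasFDerivAt.bracketForm (b := fun b => b)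
      (b' := ContinuousLinearMap.id ℝ _) (hasFDerivAt_id b₀) (e i) (e j) (e k)
    have h1 := (hasFDerivAt_pi'.1 hd (i, j, k)).unique hL
    have h2 := congrArg (fun l => l c) h1
    simp only [ContinuousLinearMap.comp_apply, hc0, map_zero] at h2
    rw [hv] at h2
    exact h2.symm

/-- A bracket close to a compact simple one is determined by its 3-form. -/
lemma eq_pullBracket (hc : IsCompactType 𝔤) (hdim : 3 < Module.finrank ℝ 𝔤)
    {b : E →L[ℝ] E →L[ℝ] E} (hb : ∀ x, x ≠ 0 → traceCLM E (b x ∘L b x) < 0)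
    {w : E [⋀^Fin 3]→L[ℝ] ℝ} {I : E ≃ₗ[ℝ] 𝔤} (hI : IsAdaptedForm w I)
    (hform : ∀ x y u, bracketForm b x y u = w ![x, y, u]) : b = pullBracket I := by
  have h2 := bracket_eq_of_form_eq hc hdim (pushBilin I b)
    (fun x hx => by
      rw [trace_pushBilin_comp]
      exact hb _ fun h => hx (by simpa using h))
    (fun x y z => by
      rw [trace_pushBilin_comp, pushBilin_apply, I.symm_apply_apply]
      have := hform (I.symm x) (I.symm y) (I.symm z)
      rw [hI, I.apply_symm_apply, I.apply_symm_apply, I.apply_symm_apply, cartanForm_eq,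
        ← metric_lie_left] at this
      rw [← neg_eq_iff_eq_neg.2 this]
      rfl)
  ext x y
  rw [pullBracket_apply, ← h2, pushBilin_apply]
  simp

/-- The bracket depends smoothly on the 3-form. -/
theorem exists_contDiffAt_bracket (hc : IsCompactType 𝔤) (hdim : 3 < Module.finrank ℝ 𝔤)
    {w₀ : E [⋀^Fin 3]→L[ℝ] ℝ} {I₀ : E ≃ₗ[ℝ] 𝔤} (h₀ : IsAdaptedForm w₀ I₀) :
    ∃ B : E [⋀^Fin 3]→L[ℝ] ℝ → E →L[ℝ] E →L[ℝ] E, ContDiffAt ℝ ∞ B w₀ ∧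
      ∀ᶠ w in 𝓝 w₀, ∀ I : E ≃ₗ[ℝ] 𝔤, IsAdaptedForm w I → B w = pullBracket I := by
  let e := Module.finBasis ℝ E
  have hΦ := contDiff_bracketCoords e
  set b₀ := pullBracket I₀ with hb₀
  have hd : HasFDerivAt (bracketCoords e) (fderiv ℝ (bracketCoords e) b₀) b₀ :=
    (hΦ.differentiable (by simp)).differentiableAt.hasFDerivAt
  let Φ' := (LinearEquiv.ofInjectiveOfFinrankEq
    (fderiv ℝ (bracketCoords e) b₀ : (E →L[ℝ] E →L[ℝ] E) →ₗ[ℝ] _)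
    (injective_fderiv_bracketCoords e hc hdim I₀) (finrank_bilin e)).toContinuousLinearEquiv
  have hd' : HasFDerivAt (bracketCoords e)
      (Φ' : (E →L[ℝ] E →L[ℝ] E) →L[ℝ] (_ × _ × _ → ℝ)) b₀ := by
    convert hd
    ext1 b
    rfl
  -- The local inverse of the polynomial map, evaluated on the coordinates `J w` of the form, is the
  -- required smooth bracket.
  let P := hΦ.contDiffAt.toOpenPartialHomeomorph (bracketCoords e) hd' (by simp)
  have hP : ⇑P = bracketCoords e := rfl
  have hmem := hΦ.contDiffAt.image_mem_toOpenPartialHomeomorph_target hd' (by simp)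
  have hsrc := hΦ.contDiffAt.mem_toOpenPartialHomeomorph_source hd' (by simp)
  let J : E [⋀^Fin 3]→L[ℝ] ℝ → (_ × _ × _ → ℝ) := fun w j => w ![e j.1, e j.2.1, e j.2.2]
  have hJ : ContDiff ℝ ∞ J := contDiff_pi.2 fun j =>
    (ContinuousAlternatingMap.apply ℝ E ℝ ![e j.1, e j.2.1, e j.2.2]).contDiff
  have hJ₀ : J w₀ = bracketCoords e b₀ :=
    funext fun j => (bracketForm_pullBracket h₀ _ _ _).symm
  have hsymm : P.symm (bracketCoords e b₀) = b₀ := P.left_inv hsrc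
  have hB : ContDiffAt ℝ ∞ (fun w => P.symm (J w)) w₀ := by
    refine ContDiffAt.comp w₀ ?_ hJ.contDiffAt
    rw [hJ₀]
    exact hΦ.contDiffAt.to_localInverse hd' (by simp)
  refine ⟨fun w => P.symm (J w), hB, ?_⟩
  have hneg : ∀ x, x ≠ 0 → traceCLM E (b₀ x ∘L b₀ x) < 0 := fun x hx => by
    rw [trace_pullBracket, neg_lt_zero]
    exact hc.metric_pos fun h => hx (by simpa using h)
  have htend : Tendsto (fun w => P.symm (J w)) (𝓝 w₀) (𝓝 b₀) := by
    have := hB.continuousAt.tendsto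
    rwa [hJ₀, hsymm] at this
  have htgt : ∀ᶠ w in 𝓝 w₀, J w ∈ P.target := by
    refine hJ.continuous.continuousAt.eventually (P.open_target.mem_nhds ?_)
    rw [hJ₀]
    exact hmem
  filter_upwards [htend.eventually (eventually_trace_neg hneg), htgt] with w hw hwt I hI
  -- Nothing relates the frame `I` to `I₀`. The inverse branch is definite near `b₀` and has the
  -- 3-form `w`, so global uniqueness identifies it with the bracket of any adapted frame.
  refine eq_pullBracket hc hdim hw hI (bracketForm_of_bracketCoords e hI fun j => ?_)
  have h1 : bracketCoords e (P.symm (J w)) = J w := by rw [← hP]; exact P.right_inv hwt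
  exact congrFun h1 j

end FormBracket

end CartanGeometry

end

noncomputable section

namespace CartanGeometry

open Filter Topology

/-! ### Smooth solutions of linear systems of constant rank. -/

section ConstantRank

/-- A functional on `κ → ℝ` vanishing on the range of `v ↦ (ℓ_i v)` would be a linear relation among
the `ℓ_i`; so that map is onto. -/
lemma exists_dual_family {V κ : Type*} [AddCommGroup V] [Module ℝ V] [Fintype κ] [DecidableEq κ]
    {ℓ : κ → Module.Dual ℝ V} (h : LinearIndependent ℝ ℓ) :
    ∃ v : κ → V, ∀ i k, ℓ i (v k) = if i = k then 1 else 0 := by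
  have hsurj : LinearMap.range (LinearMap.pi ℓ) = ⊤ := by
    by_contra hne
    obtain ⟨f, hf0, hf⟩ := Submodule.exists_le_ker_of_lt_top _ (lt_top_iff_ne_top.2 hne)
    refine hf0 ?_
    have hsum : ∑ i, f (Pi.single i 1) • ℓ i = 0 := by
      ext v
      have h1 := hf (LinearMap.mem_range_self (LinearMap.pi ℓ) v)
      have h2 : ∀ i : κ, (fun j => if i = j then (1 : ℝ) else 0) = Pi.single i 1 := fun i => by
        ext j; simp [Pi.single_apply, eq_comm]
      rw [LinearMap.mem_ker, LinearMap.pi_apply_eq_sum_univ] at h1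
      simpa [mul_comm, h2] using h1
    have h2 := Fintype.linearIndependent_iff.1 h _ hsum
    refine LinearMap.pi_ext' fun i => LinearMap.ext_ring ?_
    simpa using h2 i
  rw [LinearMap.range_eq_top] at hsurj
  choose v hv using fun k : κ => hsurj (Pi.single k 1)
  refine ⟨v, fun i k => ?_⟩
  have := congrFun (hv k) i
  simpa [Pi.single_apply] using this

section CommonKernel

variable {V : Type*} [AddCommGroup V] [Module ℝ V]

/-- The common kernel of a family of linear forms. -/
def commonKer {J : Type*} (ℓ : J → Module.Dual ℝ V) : Submodule ℝ V := ⨅ j, LinearMap.ker (ℓ j)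

lemma mem_commonKer {J : Type*} {ℓ : J → Module.Dual ℝ V} {x : V} :
    x ∈ commonKer ℓ ↔ ∀ j, ℓ j x = 0 := by
  simp [commonKer]

lemma mem_commonKer_of_mem_span {J : Type*} {ℓ : J → Module.Dual ℝ V} {x : V}
    {f : Module.Dual ℝ V} (hf : f ∈ Submodule.span ℝ (Set.range ℓ)) (hx : ∀ j, ℓ j x = 0) :
    f x = 0 := by
  induction hf using Submodule.span_induction with
  | mem f hf => obtain ⟨j, rfl⟩ := hf; exact hx j
  | zero => simp
  | add f g _ _ h1 h2 => simp [h1, h2]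
  | smul c f _ h => simp [h]

lemma finrank_commonKer [FiniteDimensional ℝ V] {κ : Type*} [Fintype κ] [DecidableEq κ] {ℓ : κ → Module.Dual ℝ V}
    (hsurj : Function.Surjective (LinearMap.pi ℓ)) :
    Module.finrank ℝ (commonKer ℓ) + Fintype.card κ = Module.finrank ℝ V := by
  have h1 : commonKer ℓ = LinearMap.ker (LinearMap.pi ℓ) := (LinearMap.ker_pi ℓ).symm
  rw [h1, ← (LinearMap.pi ℓ).finrank_range_add_finrank_ker, LinearMap.range_eq_top.2 hsurj,
    finrank_top, Module.finrank_fintype_fun_eq_card, add_comm]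

lemma finrank_commonKer_eq {J J' : Type*} {ℓ : J → Module.Dual ℝ V} {ℓ' : J' → Module.Dual ℝ V}
    (e : V ≃ₗ[ℝ] V) (h : ∀ x, (∀ j, ℓ j x = 0) ↔ ∀ j, ℓ' j (e x) = 0) :
    Module.finrank ℝ (commonKer ℓ') = Module.finrank ℝ (commonKer ℓ) := by
  have h1 : commonKer ℓ' = (commonKer ℓ).map (e : V →ₗ[ℝ] V) := by
    ext x
    obtain ⟨x, rfl⟩ := e.surjective x
    rw [mem_commonKer, ← h, ← mem_commonKer, Submodule.mem_map]
    exact ⟨fun hx => ⟨x, hx, rfl⟩, fun ⟨y, hy, hxy⟩ => e.injective hxy ▸ hy⟩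
  rw [h1, LinearEquiv.finrank_map_eq]

end CommonKernel

variable {D : Type*} [NormedAddCommGroup D] [NormedSpace ℝ D]
  {V : Type*} [NormedAddCommGroup V] [NormedSpace ℝ V] [FiniteDimensional ℝ V]

/-- A solvable system of linear equations depending smoothly on parameters, of constant rank, has
local smooth solutions. -/
theorem exists_contDiffAt_solution {J : Type*} (ℓ : D → J → Module.Dual ℝ V) (w : D → J → ℝ)
    {z₀ : D} (hℓ : ∀ᶠ z in 𝓝 z₀, ∀ j x, ContDiffAt ℝ ∞ (fun z => ℓ z j x) z)
    (hw : ∀ᶠ z in 𝓝 z₀, ∀ j, ContDiffAt ℝ ∞ (fun z => w z j) z)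
    (hker : ∀ᶠ z in 𝓝 z₀, Module.finrank ℝ (commonKer (ℓ z)) =
      Module.finrank ℝ (commonKer (ℓ z₀)))
    (hsolv : ∀ᶠ z in 𝓝 z₀, ∃ x, ∀ j, ℓ z j x = w z j) :
    ∃ X : D → V, ∀ᶠ z in 𝓝 z₀, ContDiffAt ℝ ∞ X z ∧ ∀ j, ℓ z j (X z) = w z j := by
  classical
  -- A maximal independent subfamily of equations at `z₀` and a dual family of vectors give a square
  -- matrix `S z`. It is the identity at `z₀`, hence invertible nearby, and Cramer's rule solves the
  -- subsystem smoothly.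
  obtain ⟨κ, a, -, hspan, hli⟩ := exists_linearIndependent' ℝ (ℓ z₀)
  have : Finite κ := hli.finite
  have : Fintype κ := Fintype.ofFinite κ
  obtain ⟨v, hv⟩ := exists_dual_family hli
  let S : D → (κ → ℝ) →L[ℝ] (κ → ℝ) := fun z => LinearMap.toContinuousLinearMap
    (Matrix.toLin' (Matrix.of fun i k => ℓ z (a i) (v k)))
  have hSapp : ∀ z c i, S z c i = ∑ k, ℓ z (a i) (v k) * c k := fun z c i => rfl
  have hS : ∀ᶠ z in 𝓝 z₀, ContDiffAt ℝ ∞ S z := by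
    filter_upwards [hℓ] with z hz
    have h1 : S = fun z => ∑ i, ∑ k, ℓ z (a i) (v k) •
        (ContinuousLinearMap.proj k : (κ → ℝ) →L[ℝ] ℝ).smulRight (Pi.single i 1 : κ → ℝ) := by
      funext z
      ext1 c
      funext i
      rw [hSapp]
      simp [Finset.sum_apply, Pi.single_apply]
    rw [h1]
    exact ContDiffAt.sum fun i _ => ContDiffAt.sum fun k _ =>
      (hz (a i) (v k)).smul contDiffAt_const
  have hS₀ : S z₀ = 1 := by
    ext1 c
    funext i
    rw [hSapp]
    simp [show ∀ k, ℓ z₀ (a i) (v k) = if i = k then 1 else 0 from fun k => hv i k]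
  have hunit : ∀ᶠ z in 𝓝 z₀, IsUnit (S z) := by
    refine hS.self_of_nhds.continuousAt.eventually (Units.isOpen.mem_nhds ?_)
    rw [hS₀]
    exact isUnit_one
  refine ⟨fun z => ∑ k, Ring.inverse (S z) (fun i => w z (a i)) k • v k, ?_⟩
  filter_upwards [hS, hunit, hw, hker, hsolv] with z hSz hu hwz hk ⟨x, hx⟩
  constructor
  · have h1 : ContDiffAt ℝ ∞ (fun z => Ring.inverse (S z)) z := by
      obtain ⟨u, hu⟩ := hu
      have := contDiffAt_ringInverse ℝ (n := ∞) u
      rw [hu] at this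
      exact this.comp z hSz
    have h2 := h1.clm_apply (contDiffAt_pi.2 fun i => hwz (a i))
    exact ContDiffAt.sum fun k _ => (contDiffAt_pi.1 h2 k).smul contDiffAt_const
  · have hsurj : Function.Surjective (LinearMap.pi fun i => ℓ z (a i)) := by
      intro c
      refine ⟨∑ k, Ring.inverse (S z) c k • v k, ?_⟩
      have h1 : S z (Ring.inverse (S z) c) = c := by
        rw [← mul_apply_eq_comp, Ring.mul_inverse_cancel _ hu]; rfl
      funext i
      conv_rhs => rw [← h1, hSapp]
      simp [mul_comm]
    have hsurj₀ : Function.Surjective (LinearMap.pi fun i => ℓ z₀ (a i)) := by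
      intro c
      refine ⟨∑ k, c k • v k, ?_⟩
      funext i
      simp [show ∀ k, ℓ z₀ (a i) (v k) = if i = k then 1 else 0 from fun k => hv i k]
    have hker₀ : commonKer (fun i => ℓ z₀ (a i)) = commonKer (ℓ z₀) := by
      ext y
      rw [mem_commonKer, mem_commonKer]
      refine ⟨fun h j => mem_commonKer_of_mem_span (ℓ := ℓ z₀ ∘ a) ?_ h, fun h i => h _⟩
      rw [hspan]
      exact Submodule.subset_span ⟨j, rfl⟩
    -- Here constancy of the rank enters: the kernel of the full system lies in that of the
    -- subsystem and both have the dimension found at `z₀`. Hence a solution of the subsystem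
    -- differs from a solution of the full one by a null vector.
    have hkerz : commonKer (ℓ z) = commonKer (fun i => ℓ z (a i)) := by
      refine Submodule.eq_of_le_of_finrank_eq (fun y hy => ?_) ?_
      · rw [mem_commonKer] at hy ⊢
        exact fun i => hy _
      · have h1 := finrank_commonKer hsurj
        have h2 := finrank_commonKer hsurj₀
        rw [hker₀] at h2
        omega
    set X := ∑ k, Ring.inverse (S z) (fun i => w z (a i)) k • v k with hX
    have hXa : ∀ i, ℓ z (a i) X = w z (a i) := by
      intro i
      have h1 : S z (Ring.inverse (S z) (fun i => w z (a i))) = fun i => w z (a i) := by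
        rw [← mul_apply_eq_comp, Ring.mul_inverse_cancel _ hu]; rfl
      have h2 := congrFun h1 i
      rw [hSapp] at h2
      rw [← h2, hX]
      simp [mul_comm]
    have hmem : X - x ∈ commonKer (ℓ z) := by
      rw [hkerz, mem_commonKer]
      intro i
      rw [map_sub, hXa, hx, sub_self]
    intro j
    have := mem_commonKer.1 hmem j
    rw [map_sub, hx, sub_eq_zero] at this
    exact this

end ConstantRank

end CartanGeometry

end

noncomputable section

namespace CartanGeometry

open Filter Topology

/-! ### Fields of 3-forms of Cartan type on a vector space. -/

section FormFields

variable {E : Type*} [NormedAddCommGroup E] [NormedSpace ℝ E]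

/-- A 3-form as a trilinear map. -/
def tri (w : E [⋀^Fin 3]→L[ℝ] ℝ) : E →ₗ[ℝ] E →ₗ[ℝ] E →ₗ[ℝ] ℝ where
  toFun x := LinearMap.mk₂ ℝ (fun y u => w ![x, y, u])
    (fun y y' u => congrArg (fun f => f ![u]) (map_add (w.curryLeft x).curryLeft y y'))
    (fun c y u => congrArg (fun f => f ![u]) (map_smul (w.curryLeft x).curryLeft c y))
    (fun y u u' => congrArg (fun f => f ![]) (map_add ((w.curryLeft x).curryLeft y).curryLeft u u'))
    (fun c y u => congrArg (fun f => f ![]) (map_smul ((w.curryLeft x).curryLeft y).curryLeft c u))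
  map_add' x x' := LinearMap.ext₂ fun y u =>
    congrArg (fun f => f ![y, u]) (map_add w.curryLeft x x')
  map_smul' c x := LinearMap.ext₂ fun y u =>
    congrArg (fun f => f ![y, u]) (map_smul w.curryLeft c x)

lemma tri_apply (w : E [⋀^Fin 3]→L[ℝ] ℝ) (x y u : E) : tri w x y u = w ![x, y, u] := rfl

/-- The derivation action of an endomorphism on a 3-form. -/
def formAction (w : E [⋀^Fin 3]→L[ℝ] ℝ) (Γ : E →L[ℝ] E) (x y u : E) : ℝ :=
  tri w (Γ x) y u + tri w x (Γ y) u + tri w x y (Γ u)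

/-- The derivation action of an endomorphism on a bracket. -/
def bracketAction (b : E →L[ℝ] E →L[ℝ] E) (Γ : E →L[ℝ] E) : E →L[ℝ] E →L[ℝ] E :=
  b ∘L Γ + (b.flip ∘L Γ).flip - (ContinuousLinearMap.compL ℝ E E E Γ) ∘L b

lemma bracketAction_apply (b : E →L[ℝ] E →L[ℝ] E) (Γ : E →L[ℝ] E) (x y : E) :
    bracketAction b Γ x y = b (Γ x) y + b x (Γ y) - Γ (b x y) := rfl

lemma bracketAction_apply' (b : E →L[ℝ] E →L[ℝ] E) (Γ : E →L[ℝ] E) (x : E) :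
    bracketAction b Γ x = b (Γ x) + b x ∘L Γ - Γ ∘L b x := rfl

variable [FiniteDimensional ℝ E]

lemma traceCLM_comp_comm (f g : E →L[ℝ] E) : traceCLM E (f ∘L g) = traceCLM E (g ∘L f) :=
  LinearMap.trace_comp_comm' _ _

/-- The commutator terms with `Γ` cancel by cyclicity of the trace. -/
lemma trace_bracketAction (b : E →L[ℝ] E →L[ℝ] E) (Γ : E →L[ℝ] E) (s u : E) :
    traceCLM E (bracketAction b Γ s ∘L b u) + traceCLM E (b s ∘L bracketAction b Γ u) =
      traceCLM E (b (Γ s) ∘L b u) + traceCLM E (b s ∘L b (Γ u)) := by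
  rw [bracketAction_apply', bracketAction_apply']
  simp only [ContinuousLinearMap.add_comp, ContinuousLinearMap.sub_comp,
    ContinuousLinearMap.comp_add, ContinuousLinearMap.comp_sub, map_add, map_sub]
  have h : traceCLM E ((Γ ∘L b s) ∘L b u) = traceCLM E (b s ∘L b u ∘L Γ) := by
    rw [ContinuousLinearMap.comp_assoc, traceCLM_comp_comm, ContinuousLinearMap.comp_assoc]
  rw [h, ContinuousLinearMap.comp_assoc]
  ring

/-- The infinitesimal form of the equivariance of `b ↦ bracketForm b` under the general linear
group. -/
lemma bracketForm_bracketAction (b : E →L[ℝ] E →L[ℝ] E) (Γ : E →L[ℝ] E) (x y u : E) :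
    traceCLM E (bracketAction b Γ (b x y) ∘L b u) + traceCLM E (b (bracketAction b Γ x y) ∘L b u) +
        traceCLM E (b (b x y) ∘L bracketAction b Γ u) =
      bracketForm b (Γ x) y u + bracketForm b x (Γ y) u + bracketForm b x y (Γ u) := by
  have h := trace_bracketAction b Γ (b x y) u
  have h2 : traceCLM E (b (bracketAction b Γ x y) ∘L b u) = traceCLM E (b (b (Γ x) y) ∘L b u) +
      traceCLM E (b (b x (Γ y)) ∘L b u) - traceCLM E (b (Γ (b x y)) ∘L b u) := by
    rw [bracketAction_apply]
    simp only [ContinuousLinearMap.add_comp, ContinuousLinearMap.sub_comp, map_add, map_sub]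
  simp only [bracketForm]
  linarith

variable {𝔤 : Type*} [LieRing 𝔤] [LieAlgebra ℝ 𝔤]

open Classical in
/-- The Lie bracket determined by a 3-form of Cartan type. -/
def formBracket (𝔤 : Type*) [LieRing 𝔤] [LieAlgebra ℝ 𝔤] (w : E [⋀^Fin 3]→L[ℝ] ℝ) :
    E →L[ℝ] E →L[ℝ] E :=
  if h : ∃ I : E ≃ₗ[ℝ] 𝔤, IsAdaptedForm w I then pullBracket h.choose else 0

/-- The metric determined by a 3-form of Cartan type. -/
def formMetric (𝔤 : Type*) [LieRing 𝔤] [LieAlgebra ℝ 𝔤] (w : E [⋀^Fin 3]→L[ℝ] ℝ) :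
    E →ₗ[ℝ] E →ₗ[ℝ] ℝ :=
  LinearMap.mk₂ ℝ (fun x y => -traceCLM E (formBracket 𝔤 w x ∘L formBracket 𝔤 w y))
    (by intros; simp only [map_add, ContinuousLinearMap.add_comp]; ring)
    (by intros; simp only [map_smul, ContinuousLinearMap.smul_comp, smul_eq_mul]; ring)
    (by intros; simp only [map_add, ContinuousLinearMap.comp_add]; ring)
    (by intros; simp only [map_smul, ContinuousLinearMap.comp_smul, smul_eq_mul]; ring)

lemma formMetric_apply (w : E [⋀^Fin 3]→L[ℝ] ℝ) (x y : E) :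
    formMetric 𝔤 w x y = -traceCLM E (formBracket 𝔤 w x ∘L formBracket 𝔤 w y) := rfl

variable [Module.Finite ℝ 𝔤] [LieAlgebra.IsSimple ℝ 𝔤]

/-- The definition picks an arbitrary frame; rigidity of the bracket makes the result independent of
the choice. -/
lemma formBracket_eq (hc : IsCompactType 𝔤) (hdim : 3 < Module.finrank ℝ 𝔤)
    {w : E [⋀^Fin 3]→L[ℝ] ℝ} {I : E ≃ₗ[ℝ] 𝔤} (hI : IsAdaptedForm w I) :
    formBracket 𝔤 w = pullBracket I := by
  have h : ∃ I : E ≃ₗ[ℝ] 𝔤, IsAdaptedForm w I := ⟨I, hI⟩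
  rw [formBracket, dif_pos h]
  refine eq_pullBracket hc hdim (fun x hx => ?_) hI (bracketForm_pullBracket h.choose_spec)
  rw [trace_pullBracket, neg_lt_zero]
  exact hc.metric_pos fun h => hx (by simpa using h)

lemma formMetric_eq (hc : IsCompactType 𝔤) (hdim : 3 < Module.finrank ℝ 𝔤)
    {w : E [⋀^Fin 3]→L[ℝ] ℝ} {I : E ≃ₗ[ℝ] 𝔤} (hI : IsAdaptedForm w I) (x y : E) :
    formMetric 𝔤 w x y = metric (I x) (I y) := by
  rw [formMetric_apply, formBracket_eq hc hdim hI, trace_pullBracket, neg_neg]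

/-- A smooth field of 3-forms of Cartan type on a neighbourhood of each point of `U`. -/
structure IsCartanOn (𝔤 : Type*) [LieRing 𝔤] [LieAlgebra ℝ 𝔤]
    (θ : E → E [⋀^Fin 3]→L[ℝ] ℝ) (U : Set E) : Prop where
  isOpen : IsOpen U
  contDiffAt : ∀ z ∈ U, ContDiffAt ℝ ∞ θ z
  exists_frame : ∀ z ∈ U, ∃ I : E ≃ₗ[ℝ] 𝔤, IsAdaptedForm (θ z) I

variable {θ : E → E [⋀^Fin 3]→L[ℝ] ℝ} {U : Set E} {z : E}

lemma IsCartanOn.contDiffAt_formBracket (h : IsCartanOn 𝔤 θ U) (hc : IsCompactType 𝔤)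
    (hdim : 3 < Module.finrank ℝ 𝔤) (hz : z ∈ U) :
    ContDiffAt ℝ ∞ (fun z => formBracket 𝔤 (θ z)) z := by
  obtain ⟨I, hI⟩ := h.exists_frame z hz
  obtain ⟨B, hB, hev⟩ := exists_contDiffAt_bracket hc hdim hI
  have h1 : ContDiffAt ℝ ∞ (fun z => B (θ z)) z := hB.comp z (h.contDiffAt z hz)
  refine h1.congr_of_eventuallyEq ?_
  filter_upwards [(h.contDiffAt z hz).continuousAt.eventually hev, h.isOpen.mem_nhds hz]
    with z' hz' hU
  obtain ⟨I', hI'⟩ := h.exists_frame z' hU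
  rw [formBracket_eq hc hdim hI', hz' I' hI']

lemma IsCartanOn.contDiffAt_formMetric (h : IsCartanOn 𝔤 θ U) (hc : IsCompactType 𝔤)
    (hdim : 3 < Module.finrank ℝ 𝔤) (hz : z ∈ U) (x y : E) :
    ContDiffAt ℝ ∞ (fun z => formMetric 𝔤 (θ z) x y) z := by
  have hb := h.contDiffAt_formBracket hc hdim hz
  simp only [formMetric_apply]
  exact ((traceCLM E).contDiff.contDiffAt.comp z
    ((hb.clm_apply contDiffAt_const).clm_comp (hb.clm_apply contDiffAt_const))).neg

section Derivative

variable (h : IsCartanOn 𝔤 θ U) (hc : IsCompactType 𝔤) (hdim : 3 < Module.finrank ℝ 𝔤) (hz : z ∈ U)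

include h hc hdim hz

lemma IsCartanOn.hasFDerivAt_formBracket :
    HasFDerivAt (fun z => formBracket 𝔤 (θ z)) (fderiv ℝ (fun z => formBracket 𝔤 (θ z)) z) z :=
  ((h.contDiffAt_formBracket hc hdim hz).differentiableAt (by simp)).hasFDerivAt

lemma IsCartanOn.fderiv_formMetric (x y v : E) :
    fderiv ℝ (fun z => formMetric 𝔤 (θ z) x y) z v =
      -(traceCLM E (fderiv ℝ (fun z => formBracket 𝔤 (θ z)) z v x ∘L formBracket 𝔤 (θ z) y) +
        traceCLM E (formBracket 𝔤 (θ z) x ∘L fderiv ℝ (fun z => formBracket 𝔤 (θ z)) z v y)) := by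
  have hb := h.hasFDerivAt_formBracket hc hdim hz
  have h1 : ∀ x, HasFDerivAt (fun z => formBracket 𝔤 (θ z) x)
      ((fderiv ℝ (fun z => formBracket 𝔤 (θ z)) z).flip x) z := fun x => by
    simpa using! hb.clm_apply (hasFDerivAt_const x z)
  obtain ⟨L, hL, hv⟩ := (h1 x).traceCLM_comp (h1 y)
  have h2 := hL.neg.fderiv
  simp only [formMetric_apply]
  rw [show (fun z => -traceCLM E (formBracket 𝔤 (θ z) x ∘L formBracket 𝔤 (θ z) y)) =
    -fun z => traceCLM E (formBracket 𝔤 (θ z) x ∘L formBracket 𝔤 (θ z) y) from rfl, h2]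
  rw [_root_.neg_apply, hv]
  rfl

lemma IsCartanOn.tri_fderiv (v x y u : E) :
    tri (fderiv ℝ θ z v) x y u =
      traceCLM E (fderiv ℝ (fun z => formBracket 𝔤 (θ z)) z v (formBracket 𝔤 (θ z) x y) ∘L
        formBracket 𝔤 (θ z) u) +
      traceCLM E (formBracket 𝔤 (θ z) (fderiv ℝ (fun z => formBracket 𝔤 (θ z)) z v x y) ∘L
        formBracket 𝔤 (θ z) u) +
      traceCLM E (formBracket 𝔤 (θ z) (formBracket 𝔤 (θ z) x y) ∘L
        fderiv ℝ (fun z => formBracket 𝔤 (θ z)) z v u) := by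
  obtain ⟨L, hL, hv⟩ := (h.hasFDerivAt_formBracket hc hdim hz).bracketForm x y u
  rw [← hv]
  have h1 : HasFDerivAt (fun z => θ z ![x, y, u])
      (ContinuousAlternatingMap.apply ℝ E ℝ ![x, y, u] ∘L fderiv ℝ θ z) z :=
    (ContinuousAlternatingMap.apply ℝ E ℝ ![x, y, u]).hasFDerivAt.comp z
      ((h.contDiffAt z hz).differentiableAt (by simp)).hasFDerivAt
  have h2 : (fun z => θ z ![x, y, u]) =ᶠ[𝓝 z] fun z => bracketForm (formBracket 𝔤 (θ z)) x y u := by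
    filter_upwards [h.isOpen.mem_nhds hz] with z' hz'
    obtain ⟨I, hI⟩ := h.exists_frame z' hz'
    rw [formBracket_eq hc hdim hI, bracketForm_pullBracket hI]
  rw [← h1.unique (hL.congr_of_eventuallyEq h2)]
  rfl

/-- A connection form in the direction `v` preserves the 3-form if and only if it preserves the
bracket. -/
lemma IsCartanOn.fderiv_formBracket_eq_iff (v : E) (Γ : E →L[ℝ] E) :
    fderiv ℝ (fun z => formBracket 𝔤 (θ z)) z v = bracketAction (formBracket 𝔤 (θ z)) Γ ↔
      ∀ x y u, tri (fderiv ℝ θ z v) x y u = formAction (θ z) Γ x y u := by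
  obtain ⟨I, hI⟩ := h.exists_frame z hz
  have hform : ∀ x y u, bracketForm (formBracket 𝔤 (θ z)) x y u = tri (θ z) x y u := fun x y u => by
    rw [formBracket_eq hc hdim hI, bracketForm_pullBracket hI]; rfl
  have hact := bracketForm_bracketAction (formBracket 𝔤 (θ z)) Γ
  simp only [hform] at hact
  constructor
  · intro h1 x y u
    rw [h.tri_fderiv hc hdim hz, h1, hact, formAction]
  -- Both sides of the claim are variations of the bracket inducing the same variation of the form,
  -- so infinitesimal rigidity equates them.
  · intro h1
    rw [← sub_eq_zero]
    refine bracket_variation_pullBracket hc hdim I fun x y u => ?_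
    rw [← formBracket_eq hc hdim hI]
    have h2 := h1 x y u
    rw [h.tri_fderiv hc hdim hz, formAction, ← hact] at h2
    simp only [_root_.sub_apply, map_sub, ContinuousLinearMap.sub_comp,
      ContinuousLinearMap.comp_sub]
    linarith

/-- A connection form preserving the 3-form preserves the metric. -/
lemma IsCartanOn.fderiv_formMetric_eq {v : E} {Γ : E →L[ℝ] E}
    (hΓ : ∀ x y u, tri (fderiv ℝ θ z v) x y u = formAction (θ z) Γ x y u) (x y : E) :
    fderiv ℝ (fun z => formMetric 𝔤 (θ z) x y) z v =
      formMetric 𝔤 (θ z) (Γ x) y + formMetric 𝔤 (θ z) x (Γ y) := by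
  rw [h.fderiv_formMetric hc hdim hz, (h.fderiv_formBracket_eq_iff hc hdim hz v Γ).2 hΓ,
    trace_bracketAction, formMetric_apply, formMetric_apply]
  ring

/-- The derivative of a 3-form of Cartan type is tangent to its orbit. -/
lemma IsCartanOn.exists_formAction (v : E) :
    ∃ Γ : E →L[ℝ] E, ∀ x y u, tri (fderiv ℝ θ z v) x y u = formAction (θ z) Γ x y u := by
  obtain ⟨I, hI⟩ := h.exists_frame z hz
  have hb := h.hasFDerivAt_formBracket hc hdim hz
  set b := fun z => formBracket 𝔤 (θ z) with hbdef
  have hbz : b z = pullBracket I := formBracket_eq hc hdim hI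
  have h1 : ∀ x, HasFDerivAt (fun z => b z x) ((fderiv ℝ b z).flip x) z := fun x => by
    simpa using! hb.clm_apply (hasFDerivAt_const x z)
  have h2 : ∀ x y, HasFDerivAt (fun z => b z x y) (((fderiv ℝ b z).flip x).flip y) z :=
    fun x y => by simpa using! (h1 x).clm_apply (hasFDerivAt_const y z)
  have h3 : ∀ x y u, HasFDerivAt (fun z => b z x (b z y u))
      (b z x ∘L ((fderiv ℝ b z).flip y).flip u + ((fderiv ℝ b z).flip x).flip (b z y u)) z :=
    fun x y u => (h1 x).clm_apply (h2 y u)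
  -- Near `z` every `b z` is a Lie bracket. Differentiating antisymmetry and the Jacobi identity in
  -- the direction `v` shows that the derivative is a 2-cocycle for the bracket at `z`.
  have hskew : ∀ x y, fderiv ℝ b z v x y = -fderiv ℝ b z v y x := by
    intro x y
    have h4 : (fun z => b z x y) =ᶠ[𝓝 z] -fun z => b z y x := by
      filter_upwards [h.isOpen.mem_nhds hz] with z' hz'
      obtain ⟨I', hI'⟩ := h.exists_frame z' hz'
      simp only [hbdef, formBracket_eq hc hdim hI', Pi.neg_apply, pullBracket_apply]
      rw [← lie_skew, map_neg]
    have h5 := (h2 x y).unique ((h2 y x).neg.congr_of_eventuallyEq h4)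
    simpa using congrArg (fun l => l v) h5
  have hjac : ∀ x y u, fderiv ℝ b z v x (b z y u) + b z x (fderiv ℝ b z v y u) +
      (fderiv ℝ b z v y (b z u x) + b z y (fderiv ℝ b z v u x)) +
      (fderiv ℝ b z v u (b z x y) + b z u (fderiv ℝ b z v x y)) = 0 := by
    intro x y u
    have h4 : (fun z => b z x (b z y u) + b z y (b z u x) + b z u (b z x y)) =ᶠ[𝓝 z]
        fun _ => 0 := by
      filter_upwards [h.isOpen.mem_nhds hz] with z' hz'
      obtain ⟨I', hI'⟩ := h.exists_frame z' hz'
      simp only [hbdef, formBracket_eq hc hdim hI', pullBracket_apply, I'.apply_symm_apply]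
      rw [← map_add, ← map_add, lie_jacobi, map_zero]
    have h5 := (((h3 x y u).add (h3 y u x)).add (h3 u x y)).unique
      ((hasFDerivAt_const (0 : E) z).congr_of_eventuallyEq h4)
    have h6 := congrArg (fun l => l v) h5
    simp only [_root_.add_apply, ContinuousLinearMap.comp_apply, ContinuousLinearMap.flip_apply,
      _root_.zero_apply] at h6
    rw [← h6]
    abel
  obtain ⟨τ, hτ⟩ := exists_primitive_of_cocycle hc (pushBilin I (fderiv ℝ b z v))
    (fun x y => by rw [pushBilin_apply, hskew, map_neg]; rfl) (fun x y u => by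
      have h4 := congrArg I (hjac (I.symm x) (I.symm y) (I.symm u))
      simp only [hbz, pullBracket_apply, I.apply_symm_apply, map_add, map_zero] at h4
      exact h4)
  -- A primitive of the cocycle, transported to `E`, is an endomorphism whose action on the bracket
  -- is its derivative.
  let Γ : E →L[ℝ] E := LinearMap.toContinuousLinearMap (I.symm.toLinearMap ∘ₗ τ ∘ₗ I.toLinearMap)
  have hΓ : ∀ x, Γ x = I.symm (τ (I x)) := fun x => rfl
  refine ⟨Γ, (h.fderiv_formBracket_eq_iff hc hdim hz v Γ).1 ?_⟩
  have hbz' : formBracket 𝔤 (θ z) = pullBracket I := hbz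
  ext1 x
  ext1 y
  rw [bracketAction_apply, hbz']
  simp only [pullBracket_apply, hΓ, I.apply_symm_apply]
  apply I.injective
  have h4 := hτ (I x) (I y)
  rw [pushBilin_apply, I.symm_apply_apply, I.symm_apply_apply] at h4
  rw [map_sub, map_add, I.apply_symm_apply, I.apply_symm_apply, I.apply_symm_apply, add_comm, ← h4]

end Derivative

end FormFields

end CartanGeometry

end

noncomputable section

namespace CartanGeometry

open Filter Topology

/-! ### Pointwise and local existence of Christoffel symbols. -/

section ConnectionForms

variable {E : Type*} [NormedAddCommGroup E] [NormedSpace ℝ E]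

/-- The connection form `Γ` at `z` preserves the 3-form `θ`. -/
def PreservesForm (θ : E → E [⋀^Fin 3]→L[ℝ] ℝ) (z : E) (Γ : E →L[ℝ] E →L[ℝ] E) : Prop :=
  ∀ v x y u, tri (fderiv ℝ θ z v) x y u = formAction (θ z) (Γ v) x y u

/-- The linear forms expressing that a connection form annihilates a 3-form. -/
def formFunctional (w : E [⋀^Fin 3]→L[ℝ] ℝ) (j : E × E × E × E) :
    Module.Dual ℝ (E →L[ℝ] E →L[ℝ] E) where
  toFun Γ := formAction w (Γ j.1) j.2.1 j.2.2.1 j.2.2.2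
  map_add' Γ Γ' := by simp only [formAction, _root_.add_apply, map_add, LinearMap.add_apply]; ring
  map_smul' c Γ := by
    simp only [formAction, _root_.smul_apply, map_smul, LinearMap.smul_apply, smul_eq_mul,
      RingHom.id_apply]
    ring

lemma formFunctional_apply (w : E [⋀^Fin 3]→L[ℝ] ℝ) (j : E × E × E × E)
    (Γ : E →L[ℝ] E →L[ℝ] E) :
    formFunctional w j Γ = formAction w (Γ j.1) j.2.1 j.2.2.1 j.2.2.2 := rfl

variable {𝔤 : Type*} [LieRing 𝔤] [LieAlgebra ℝ 𝔤]
  {θ : E → E [⋀^Fin 3]→L[ℝ] ℝ} {U : Set E} {z : E}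

lemma IsCartanOn.eventually_mem (h : IsCartanOn 𝔤 θ U) (hz : z ∈ U) : ∀ᶠ z' in 𝓝 z, z' ∈ U :=
  h.isOpen.mem_nhds hz

lemma IsCartanOn.contDiffAt_tri (h : IsCartanOn 𝔤 θ U) (hz : z ∈ U) (x y u : E) :
    ContDiffAt ℝ ∞ (fun z => tri (θ z) x y u) z :=
  (ContinuousAlternatingMap.apply ℝ E ℝ ![x, y, u]).contDiff.contDiffAt.comp z (h.contDiffAt z hz)

lemma IsCartanOn.contDiffAt_tri_fderiv (h : IsCartanOn 𝔤 θ U) (hz : z ∈ U) (v x y u : E) :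
    ContDiffAt ℝ ∞ (fun z => tri (fderiv ℝ θ z v) x y u) z := by
  have h1 : ContDiffAt ℝ ∞ (fderiv ℝ θ) z := (h.contDiffAt z hz).fderiv_right (by simp)
  exact (ContinuousAlternatingMap.apply ℝ E ℝ ![x, y, u]).contDiff.contDiffAt.comp z
    (h1.clm_apply contDiffAt_const)

variable [FiniteDimensional ℝ E]

variable (𝔤) in

/-- The connection form `Γ` at `z` preserves the metric of the 3-form `θ`. -/
def PreservesMetric (θ : E → E [⋀^Fin 3]→L[ℝ] ℝ) (z : E) (Γ : E →L[ℝ] E →L[ℝ] E) : Prop :=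
  ∀ v x y, fderiv ℝ (fun z => formMetric 𝔤 (θ z) x y) z v =
    formMetric 𝔤 (θ z) (Γ v x) y + formMetric 𝔤 (θ z) x (Γ v y)

variable (𝔤) in
/-- The torsion of the connection form `Γ` is skew-symmetric. -/
def HasSkewTorsionForm (w : E [⋀^Fin 3]→L[ℝ] ℝ) (Γ : E →L[ℝ] E →L[ℝ] E) : Prop :=
  ∀ u v x, formMetric 𝔤 w (Γ u v - Γ v u) x = -formMetric 𝔤 w (Γ u x - Γ x u) v

/-- Conjugation of bilinear maps by a linear automorphism. -/
def conjBilin (A : E ≃ₗ[ℝ] E) : (E →L[ℝ] E →L[ℝ] E) ≃ₗ[ℝ] (E →L[ℝ] E →L[ℝ] E) :=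
  (toCLM₂ E E).symm ≪≫ₗ A.arrowCongr (A.arrowCongr A) ≪≫ₗ toCLM₂ E E

lemma conjBilin_apply (A : E ≃ₗ[ℝ] E) (Γ : E →L[ℝ] E →L[ℝ] E) (x y : E) :
    conjBilin A Γ (A x) (A y) = A (Γ x y) := by
  change A (Γ (A.symm (A x)) (A.symm (A y))) = _
  simp

/-- The linear forms expressing that the torsion of a connection form is skew-symmetric. -/
def skewFunctional (g : E →ₗ[ℝ] E →ₗ[ℝ] ℝ) (j : E × E × E) :
    Module.Dual ℝ (E →L[ℝ] E →L[ℝ] E) where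
  toFun Γ := g (Γ j.1 j.2.1 - Γ j.2.1 j.1) j.2.2 + g (Γ j.1 j.2.2 - Γ j.2.2 j.1) j.2.1
  map_add' Γ Γ' := by
    simp only [_root_.add_apply, map_add, map_sub, LinearMap.add_apply, LinearMap.sub_apply]; ring
  map_smul' c Γ := by
    simp only [_root_.smul_apply, map_smul, map_sub, LinearMap.smul_apply, LinearMap.sub_apply,
      smul_eq_mul, RingHom.id_apply]
    ring

lemma formFunctional_conj {A : E ≃ₗ[ℝ] E} {w w' : E [⋀^Fin 3]→L[ℝ] ℝ}
    (hA : ∀ x y u, tri w' (A x) (A y) (A u) = tri w x y u) (j : E × E × E × E)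
    (Γ : E →L[ℝ] E →L[ℝ] E) :
    formFunctional w' (A j.1, A j.2.1, A j.2.2.1, A j.2.2.2) (conjBilin A Γ) =
      formFunctional w j Γ := by
  simp only [formFunctional_apply, formAction, conjBilin_apply, hA]

lemma skewFunctional_conj {A : E ≃ₗ[ℝ] E} {g g' : E →ₗ[ℝ] E →ₗ[ℝ] ℝ}
    (hA : ∀ x y, g' (A x) (A y) = g x y) (j : E × E × E) (Γ : E →L[ℝ] E →L[ℝ] E) :
    skewFunctional g' (A j.1, A j.2.1, A j.2.2) (conjBilin A Γ) = skewFunctional g j Γ := by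
  change g' (_ - _) _ + g' (_ - _) _ = g (_ - _) _ + g (_ - _) _
  simp only [conjBilin_apply, ← map_sub A, hA]

/-- The linear forms expressing that a connection form is skew for a metric. -/
def metricFunctional (g : E →ₗ[ℝ] E →ₗ[ℝ] ℝ) (j : E × E × E) :
    Module.Dual ℝ (E →L[ℝ] E →L[ℝ] E) where
  toFun Γ := g (Γ j.1 j.2.1) j.2.2 + g j.2.1 (Γ j.1 j.2.2)
  map_add' Γ Γ' := by
    simp only [_root_.add_apply, map_add, LinearMap.add_apply]; ring
  map_smul' c Γ := by
    simp only [_root_.smul_apply, map_smul, LinearMap.smul_apply, smul_eq_mul, RingHom.id_apply]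
    ring

/-- The linear forms expressing that the torsion of a connection form vanishes. -/
def torsionFunctional (g : E →ₗ[ℝ] E →ₗ[ℝ] ℝ) (j : E × E × E) :
    Module.Dual ℝ (E →L[ℝ] E →L[ℝ] E) where
  toFun Γ := g (Γ j.1 j.2.1 - Γ j.2.1 j.1) j.2.2
  map_add' Γ Γ' := by
    simp only [_root_.add_apply, map_add, map_sub, LinearMap.add_apply, LinearMap.sub_apply]; ring
  map_smul' c Γ := by
    simp only [_root_.smul_apply, map_smul, map_sub, LinearMap.smul_apply, LinearMap.sub_apply,
      smul_eq_mul, RingHom.id_apply]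
    ring

variable [Module.Finite ℝ 𝔤] [LieAlgebra.IsSimple ℝ 𝔤]

section

variable (h : IsCartanOn 𝔤 θ U) (hc : IsCompactType 𝔤) (hdim : 3 < Module.finrank ℝ 𝔤) (hz : z ∈ U)

include h hc hdim hz

lemma IsCartanOn.formMetric_comm (x y : E) :
    formMetric 𝔤 (θ z) x y = formMetric 𝔤 (θ z) y x := by
  obtain ⟨I, hI⟩ := h.exists_frame z hz
  rw [formMetric_eq hc hdim hI, formMetric_eq hc hdim hI, metric_comm]

lemma IsCartanOn.eq_zero_of_formMetric {x : E} (hx : ∀ y, formMetric 𝔤 (θ z) x y = 0) : x = 0 := by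
  obtain ⟨I, hI⟩ := h.exists_frame z hz
  have := hx x
  rw [formMetric_eq hc hdim hI] at this
  simpa using hc.eq_zero_of_metric_self this

lemma IsCartanOn.exists_formMetric_repr (T : E →ₗ[ℝ] E →ₗ[ℝ] E →ₗ[ℝ] ℝ) :
    ∃ Γ : E →L[ℝ] E →L[ℝ] E, ∀ v x y, formMetric 𝔤 (θ z) (Γ v x) y = T v x y := by
  have hinj : Function.Injective (formMetric 𝔤 (θ z)) := by
    rw [injective_iff_map_eq_zero]
    intro x hx
    exact h.eq_zero_of_formMetric hc hdim hz fun y => by rw [hx, LinearMap.zero_apply]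
  let k := LinearEquiv.ofInjectiveOfFinrankEq (formMetric 𝔤 (θ z)) hinj
    (Subspace.dual_finrank_eq (K := ℝ) (V := E)).symm
  refine ⟨toCLM₂ E E (T.compr₂ k.symm.toLinearMap), fun v x y => ?_⟩
  exact congrArg (fun f => f y) (k.apply_symm_apply (T v x))

/-- The endomorphisms found direction by direction need not depend linearly on the direction. They
are kept only on a basis and extended linearly, which is enough because the equation is linear in
the pair formed by `v` and `Γ v`. -/
lemma IsCartanOn.exists_preservesForm : ∃ Γ : E →L[ℝ] E →L[ℝ] E, PreservesForm θ z Γ := by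
  let e := Module.finBasis ℝ E
  choose γ hγ using fun v => h.exists_formAction hc hdim hz v
  let Γ : E →L[ℝ] E →L[ℝ] E := LinearMap.toContinuousLinearMap (e.constr ℝ fun i => γ (e i))
  have hΓ : ∀ i, Γ (e i) = γ (e i) := fun i => e.constr_basis ℝ _ i
  refine ⟨Γ, fun v x y u => ?_⟩
  refine basis_induction e (p := fun v => tri (fderiv ℝ θ z v) x y u =
    formAction (θ z) (Γ v) x y u) (fun i => ?_) ?_ (fun a b ha hb => ?_) (fun c a ha => ?_) v
  · rw [hΓ, hγ]
  · simp only [map_zero, formAction, _root_.zero_apply, LinearMap.zero_apply, add_zero]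
    rfl
  · simp only [formAction, map_add, _root_.add_apply, LinearMap.add_apply] at ha hb ⊢
    rw [show tri (fderiv ℝ θ z a + fderiv ℝ θ z b) x y u = tri (fderiv ℝ θ z a) x y u +
      tri (fderiv ℝ θ z b) x y u from rfl, ha, hb]
    ring
  · simp only [formAction, map_smul, _root_.smul_apply, LinearMap.smul_apply, smul_eq_mul] at ha ⊢
    rw [show tri (c • fderiv ℝ θ z a) x y u = c * tri (fderiv ℝ θ z a) x y u from rfl, ha]
    ring

/-- The derivative of the metric as a trilinear form. -/
lemma IsCartanOn.exists_metricDeriv : ∃ T : E →ₗ[ℝ] E →ₗ[ℝ] E →ₗ[ℝ] ℝ, ∀ v x y,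
    T v x y = fderiv ℝ (fun z => formMetric 𝔤 (θ z) x y) z v := by
  set b := formBracket 𝔤 (θ z)
  set b' := fderiv ℝ (fun z => formBracket 𝔤 (θ z)) z
  refine ⟨{ toFun := fun v => LinearMap.mk₂ ℝ (fun x y =>
              -(traceCLM E (b' v x ∘L b y) + traceCLM E (b x ∘L b' v y)))
              (by intros; simp only [map_add, ContinuousLinearMap.add_comp]; ring)
              (by intros; simp only [map_smul, ContinuousLinearMap.smul_comp, smul_eq_mul]; ring)
              (by intros; simp only [map_add, ContinuousLinearMap.comp_add]; ring)
              (by intros; simp only [map_smul, ContinuousLinearMap.comp_smul, smul_eq_mul]; ring)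
            map_add' := ?_
            map_smul' := ?_ }, fun v x y => (h.fderiv_formMetric hc hdim hz x y v).symm⟩
  · intro v v'
    ext x y
    simp only [LinearMap.mk₂_apply, LinearMap.add_apply, map_add, _root_.add_apply,
      ContinuousLinearMap.add_comp, ContinuousLinearMap.comp_add]
    ring
  · intro c v
    ext x y
    simp only [LinearMap.mk₂_apply, LinearMap.smul_apply, map_smul, _root_.smul_apply,
      ContinuousLinearMap.smul_comp, ContinuousLinearMap.comp_smul, smul_eq_mul, RingHom.id_apply]
    ring

/-- The Koszul formula. -/
lemma IsCartanOn.exists_preservesMetric : ∃ Γ : E →L[ℝ] E →L[ℝ] E,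
    PreservesMetric 𝔤 θ z Γ ∧ ∀ u v, Γ u v = Γ v u := by
  obtain ⟨T, hT⟩ := h.exists_metricDeriv hc hdim hz
  have hsymm : ∀ v x y, T v x y = T v y x := by
    intro v x y
    rw [hT, hT]
    have : (fun z => formMetric 𝔤 (θ z) x y) =ᶠ[𝓝 z] fun z => formMetric 𝔤 (θ z) y x := by
      filter_upwards [h.eventually_mem hz] with z' hz'
      exact h.formMetric_comm hc hdim hz' x y
    rw [this.fderiv_eq]
  -- The three terms represent `T v x y`, `T x v y` and `T y v x`, the summands of the Koszul
  -- formula.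
  obtain ⟨Γ₁, h₁⟩ := h.exists_formMetric_repr hc hdim hz T
  obtain ⟨Γ₂, h₂⟩ := h.exists_formMetric_repr hc hdim hz T.flip
  obtain ⟨Γ₃, h₃⟩ := h.exists_formMetric_repr hc hdim hz (LinearMap.lflip.toLinearMap ∘ₗ T.flip)
  have hΓ' : ∀ v x y, formMetric 𝔤 (θ z) (((1 / 2 : ℝ) • (Γ₁ + Γ₂ - Γ₃)) v x) y =
      1 / 2 * (T v x y + T x v y - T y v x) := by
    intro v x y
    simp only [_root_.smul_apply, _root_.add_apply, _root_.sub_apply, map_smul, map_add, map_sub,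
      LinearMap.smul_apply, LinearMap.add_apply, LinearMap.sub_apply, h₁, h₂, h₃, smul_eq_mul]
    rfl
  refine ⟨(1 / 2 : ℝ) • (Γ₁ + Γ₂ - Γ₃), fun v x y => ?_, fun u v => ?_⟩
  · rw [← hT, h.formMetric_comm hc hdim hz x, hΓ', hΓ', hsymm v y x, hsymm x v y, hsymm y v x]
    ring
  · rw [← sub_eq_zero]
    refine h.eq_zero_of_formMetric hc hdim hz fun y => ?_
    rw [map_sub, LinearMap.sub_apply, hΓ', hΓ', hsymm y]
    ring

/-- Two adapted frames compose to an isomorphism between the data at two points. It carries kernel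
to kernel in the linear systems below, which supplies the constant rank. -/
lemma IsCartanOn.exists_conj {z' : E} (hz' : z' ∈ U) : ∃ A : E ≃ₗ[ℝ] E,
    (∀ x y u, tri (θ z') (A x) (A y) (A u) = tri (θ z) x y u) ∧
    ∀ x y, formMetric 𝔤 (θ z') (A x) (A y) = formMetric 𝔤 (θ z) x y := by
  obtain ⟨I, hI⟩ := h.exists_frame z hz
  obtain ⟨I', hI'⟩ := h.exists_frame z' hz'
  refine ⟨I.trans I'.symm, fun x y u => ?_, fun x y => ?_⟩
  · rw [tri_apply, tri_apply, hI, hI']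
    simp
  · rw [formMetric_eq hc hdim hI, formMetric_eq hc hdim hI']
    simp

/-- Local smooth connection forms preserving the 3-form. -/
theorem IsCartanOn.exists_local_preservesForm : ∃ X : E → E →L[ℝ] E →L[ℝ] E,
    ∀ᶠ z' in 𝓝 z, ContDiffAt ℝ ∞ X z' ∧ PreservesForm θ z' (X z') := by
  obtain ⟨X, hX⟩ := exists_contDiffAt_solution (V := E →L[ℝ] E →L[ℝ] E) (z₀ := z) (J := E × E × E × E)
    (fun z => formFunctional (θ z))
    (fun z j => tri (fderiv ℝ θ z j.1) j.2.1 j.2.2.1 j.2.2.2)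
    (by
      filter_upwards [h.eventually_mem hz] with z' hz' j Γ
      exact ((h.contDiffAt_tri hz' _ _ _).add (h.contDiffAt_tri hz' _ _ _)).add
        (h.contDiffAt_tri hz' _ _ _))
    (by
      filter_upwards [h.eventually_mem hz] with z' hz' j
      exact h.contDiffAt_tri_fderiv hz' _ _ _ _)
    (by
      filter_upwards [h.eventually_mem hz] with z' hz'
      obtain ⟨A, hA, -⟩ := h.exists_conj hc hdim hz hz'
      refine finrank_commonKer_eq (conjBilin A) fun Γ => ?_
      refine ⟨?_, fun hj j => ?_⟩
      · rintro hj ⟨v, x, y, u⟩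
        obtain ⟨v, rfl⟩ := A.surjective v
        obtain ⟨x, rfl⟩ := A.surjective x
        obtain ⟨y, rfl⟩ := A.surjective y
        obtain ⟨u, rfl⟩ := A.surjective u
        exact (formFunctional_conj hA (v, x, y, u) Γ).trans (hj _)
      · exact (formFunctional_conj hA j Γ).symm.trans (hj _))
    (by
      filter_upwards [h.eventually_mem hz] with z' hz'
      obtain ⟨Γ, hΓ⟩ := h.exists_preservesForm hc hdim hz'
      exact ⟨Γ, fun j => (hΓ _ _ _ _).symm⟩)
  refine ⟨X, ?_⟩
  filter_upwards [hX] with z' hz'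
  exact ⟨hz'.1, fun v x y u => (hz'.2 (v, x, y, u)).symm⟩

/-- Local smooth connection forms preserving the 3-form, with skew-symmetric torsion. -/
theorem IsCartanOn.exists_local_skew (hs : ∀ z ∈ U, ∃ Γ : E →L[ℝ] E →L[ℝ] E,
      PreservesForm θ z Γ ∧ HasSkewTorsionForm 𝔤 (θ z) Γ) :
    ∃ X : E → E →L[ℝ] E →L[ℝ] E, ∀ᶠ z' in 𝓝 z, ContDiffAt ℝ ∞ X z' ∧
      PreservesForm θ z' (X z') ∧ HasSkewTorsionForm 𝔤 (θ z') (X z') := by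
  obtain ⟨X, hX⟩ := exists_contDiffAt_solution (V := E →L[ℝ] E →L[ℝ] E) (z₀ := z) (J := (E × E × E × E) ⊕ (E × E × E))
    (fun z => Sum.elim (formFunctional (θ z)) (skewFunctional (formMetric 𝔤 (θ z))))
    (fun z => Sum.elim (fun j => tri (fderiv ℝ θ z j.1) j.2.1 j.2.2.1 j.2.2.2) fun _ => 0)
    (by
      filter_upwards [h.eventually_mem hz] with z' hz'
      rintro (j | j) Γ
      · exact ((h.contDiffAt_tri hz' _ _ _).add (h.contDiffAt_tri hz' _ _ _)).add
          (h.contDiffAt_tri hz' _ _ _)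
      · exact (h.contDiffAt_formMetric hc hdim hz' _ _).add
          (h.contDiffAt_formMetric hc hdim hz' _ _))
    (by
      filter_upwards [h.eventually_mem hz] with z' hz'
      rintro (j | j)
      · exact h.contDiffAt_tri_fderiv hz' _ _ _ _
      · exact contDiffAt_const)
    (by
      filter_upwards [h.eventually_mem hz] with z' hz'
      obtain ⟨A, hA, hA'⟩ := h.exists_conj hc hdim hz hz'
      refine finrank_commonKer_eq (conjBilin A) fun Γ => ?_
      refine ⟨?_, fun hj => ?_⟩
      · rintro hj (⟨v, x, y, u⟩ | ⟨x, y, u⟩)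
        · obtain ⟨v, rfl⟩ := A.surjective v
          obtain ⟨x, rfl⟩ := A.surjective x
          obtain ⟨y, rfl⟩ := A.surjective y
          obtain ⟨u, rfl⟩ := A.surjective u
          exact (formFunctional_conj hA (v, x, y, u) Γ).trans (hj (.inl _))
        · obtain ⟨x, rfl⟩ := A.surjective x
          obtain ⟨y, rfl⟩ := A.surjective y
          obtain ⟨u, rfl⟩ := A.surjective u
          exact (skewFunctional_conj hA' (x, y, u) Γ).trans (hj (.inr _))
      · rintro (j | j)
        · exact (formFunctional_conj hA j Γ).symm.trans (hj (.inl _))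
        · exact (skewFunctional_conj hA' j Γ).symm.trans (hj (.inr _)))
    (by
      filter_upwards [h.eventually_mem hz] with z' hz'
      obtain ⟨Γ, hΓ, hΓ'⟩ := hs z' hz'
      refine ⟨Γ, ?_⟩
      rintro (j | j)
      · exact (hΓ _ _ _ _).symm
      · exact eq_neg_iff_add_eq_zero.1 (hΓ' _ _ _))
  refine ⟨X, ?_⟩
  filter_upwards [hX] with z' hz'
  exact ⟨hz'.1, fun v x y u => (hz'.2 (.inl (v, x, y, u))).symm,
    fun u v x => eq_neg_iff_add_eq_zero.2 (hz'.2 (.inr (u, v, x)))⟩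

/-- Local smooth Levi-Civita connection forms. -/
theorem IsCartanOn.exists_local_preservesMetric : ∃ X : E → E →L[ℝ] E →L[ℝ] E,
    ∀ᶠ z' in 𝓝 z, ContDiffAt ℝ ∞ X z' ∧ PreservesMetric 𝔤 θ z' (X z') ∧
      ∀ u v, X z' u v = X z' v u := by
  -- Uniqueness of the Levi-Civita connection: a tensor symmetric in its first two slots and skew in
  -- its last two vanishes. The rank is thus constant because the kernel is zero.
  have hker : ∀ z' ∈ U, Module.finrank ℝ (commonKer (Sum.elim
      (metricFunctional (formMetric 𝔤 (θ z'))) (torsionFunctional (formMetric 𝔤 (θ z'))))) = 0 := by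
    intro z' hz'
    rw [Submodule.finrank_eq_zero, eq_bot_iff]
    intro Γ hΓ
    rw [mem_commonKer] at hΓ
    have hm : ∀ v x y, formMetric 𝔤 (θ z') (Γ v x) y + formMetric 𝔤 (θ z') x (Γ v y) = 0 :=
      fun v x y => hΓ (.inl (v, x, y))
    have ht : ∀ u v, Γ u v = Γ v u := fun u v => sub_eq_zero.1
      (h.eq_zero_of_formMetric hc hdim hz' fun y => hΓ (.inr (u, v, y)))
    rw [Submodule.mem_bot]
    ext v x
    refine h.eq_zero_of_formMetric hc hdim hz' fun y => ?_
    have h1 := hm v x y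
    have h2 := hm x y v
    have h3 := hm y v x
    rw [h.formMetric_comm hc hdim hz' x] at h1
    rw [h.formMetric_comm hc hdim hz' y] at h2
    rw [h.formMetric_comm hc hdim hz' v] at h3
    rw [ht x v] at h2
    rw [ht y v, ht y x] at h3
    linarith
  obtain ⟨X, hX⟩ := exists_contDiffAt_solution (V := E →L[ℝ] E →L[ℝ] E) (z₀ := z) (J := (E × E × E) ⊕ (E × E × E))
    (fun z => Sum.elim (metricFunctional (formMetric 𝔤 (θ z)))
      (torsionFunctional (formMetric 𝔤 (θ z))))
    (fun z => Sum.elim (fun j => fderiv ℝ (fun z => formMetric 𝔤 (θ z) j.2.1 j.2.2) z j.1)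
      fun _ => 0)
    (by
      filter_upwards [h.eventually_mem hz] with z' hz'
      rintro (j | j) Γ
      · exact (h.contDiffAt_formMetric hc hdim hz' _ _).add
          (h.contDiffAt_formMetric hc hdim hz' _ _)
      · exact h.contDiffAt_formMetric hc hdim hz' _ _)
    (by
      filter_upwards [h.eventually_mem hz] with z' hz'
      rintro (j | j)
      · exact ((h.contDiffAt_formMetric hc hdim hz' _ _).fderiv_right (m := ∞)
          (by simp)).clm_apply contDiffAt_const
      · exact contDiffAt_const)
    (by
      filter_upwards [h.eventually_mem hz] with z' hz'
      rw [hker z' hz', hker z hz])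
    (by
      filter_upwards [h.eventually_mem hz] with z' hz'
      obtain ⟨Γ, hΓ, hΓ'⟩ := h.exists_preservesMetric hc hdim hz'
      refine ⟨Γ, ?_⟩
      rintro (j | j)
      · exact (hΓ _ _ _).symm
      · change formMetric 𝔤 (θ z') (Γ j.1 j.2.1 - Γ j.2.1 j.1) j.2.2 = 0
        rw [hΓ' j.1, sub_self, map_zero, LinearMap.zero_apply])
  refine ⟨X, ?_⟩
  filter_upwards [hX, h.eventually_mem hz] with z' hz' hU
  exact ⟨hz'.1, fun v x y => (hz'.2 (.inl (v, x, y))).symm, fun u v => sub_eq_zero.1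
    (h.eq_zero_of_formMetric hc hdim hU fun y => hz'.2 (.inr (u, v, y)))⟩

end

end ConnectionForms

end CartanGeometry

end

open scoped Manifold ContDiff
noncomputable section
namespace CartanGeometry
open Filter Topology

/-! ### Frames and vector fields read in a chart. -/

section ChartFrames

variable {E : Type*} [NormedAddCommGroup E] [NormedSpace ℝ E]
  {M : Type*} [TopologicalSpace M] [ChartedSpace E M] {x₀ y : M} {z : E}

theorem symm_mem_source (hz : z ∈ (extChartAt 𝓘(ℝ, E) x₀).target) :
    (extChartAt 𝓘(ℝ, E) x₀).symm z ∈ (extChartAt 𝓘(ℝ, E) x₀).source :=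
  (extChartAt 𝓘(ℝ, E) x₀).map_target hz

theorem target_mem_nhds (hz : z ∈ (extChartAt 𝓘(ℝ, E) x₀).target) :
    (extChartAt 𝓘(ℝ, E) x₀).target ∈ 𝓝 z :=
  (isOpen_extChartAt_target (I := 𝓘(ℝ, E)) x₀).mem_nhds hz

variable [IsManifold 𝓘(ℝ, E) ∞ M]

/-- The frame of `T_y M` given by the chart at `x₀`. -/
def chartFrame (x₀ y : M) : E →L[ℝ] TangentSpace 𝓘(ℝ, E) y :=
  (trivializationAt E (TangentSpace 𝓘(ℝ, E) : M → Type _) x₀).symmL ℝ y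

/-- The coframe of `T_y M` given by the chart at `x₀`. -/
def chartCoframe (x₀ y : M) : TangentSpace 𝓘(ℝ, E) y →L[ℝ] E :=
  (trivializationAt E (TangentSpace 𝓘(ℝ, E) : M → Type _) x₀).continuousLinearMapAt ℝ y

/-- The expression of a vector field in the chart at `x₀`. -/
def chartRead (x₀ : M) (X : ∀ x : M, TangentSpace 𝓘(ℝ, E) x) (z : E) :
    E :=
  chartCoframe x₀ ((extChartAt 𝓘(ℝ, E) x₀).symm z) (X ((extChartAt 𝓘(ℝ, E) x₀).symm z))

theorem mem_baseSet_iff :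
    y ∈ (trivializationAt E (TangentSpace 𝓘(ℝ, E) : M → Type _) x₀).baseSet ↔
      y ∈ (extChartAt 𝓘(ℝ, E) x₀).source := by
  simp [TangentBundle.trivializationAt_baseSet]

theorem chartFrame_chartCoframe (hy : y ∈ (extChartAt 𝓘(ℝ, E) x₀).source)
    (v : TangentSpace 𝓘(ℝ, E) y) : chartFrame x₀ y (chartCoframe x₀ y v) = v :=
  (trivializationAt E (TangentSpace 𝓘(ℝ, E) : M → Type _) x₀).symmₗ_linearMapAt
    (mem_baseSet_iff.2 hy) v

theorem chartCoframe_chartFrame (hy : y ∈ (extChartAt 𝓘(ℝ, E) x₀).source) (v : E) :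
    chartCoframe x₀ y (chartFrame x₀ y v) = v :=
  (trivializationAt E (TangentSpace 𝓘(ℝ, E) : M → Type _) x₀).linearMapAt_symmₗ
    (mem_baseSet_iff.2 hy) v

/-- The chart coframe as a linear equivalence. -/
def chartEquiv (x₀ y : M) (hy : y ∈ (extChartAt 𝓘(ℝ, E) x₀).source) :
    TangentSpace 𝓘(ℝ, E) y ≃ₗ[ℝ] E :=
  LinearEquiv.ofLinearMap (chartCoframe x₀ y).toLinearMap (chartFrame x₀ y).toLinearMap
    (LinearMap.ext (chartCoframe_chartFrame hy)) (LinearMap.ext (chartFrame_chartCoframe hy))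

theorem contMDiffAt_chart_symm (hz : z ∈ (extChartAt 𝓘(ℝ, E) x₀).target) :
    ContMDiffAt 𝓘(ℝ, E) 𝓘(ℝ, E) ∞ (extChartAt 𝓘(ℝ, E) x₀).symm z :=
  (contMDiffOn_extChartAt_symm x₀).contMDiffAt (target_mem_nhds hz)

theorem contMDiffAt_chart (hy : y ∈ (extChartAt 𝓘(ℝ, E) x₀).source) :
    ContMDiffAt 𝓘(ℝ, E) 𝓘(ℝ, E) ∞ (extChartAt 𝓘(ℝ, E) x₀) y :=
  contMDiffAt_extChartAt' (by simpa using hy)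

/-- Forms are read in charts by means of the derivative of the inverse chart, vector fields by means
of the bundle trivialization; this identifies the two. -/
theorem mfderiv_chart_symm (hz : z ∈ (extChartAt 𝓘(ℝ, E) x₀).target) :
    mfderiv 𝓘(ℝ, E) 𝓘(ℝ, E) (extChartAt 𝓘(ℝ, E) x₀).symm z =
      chartFrame (E := E) x₀ ((extChartAt 𝓘(ℝ, E) x₀).symm z) := by
  have h := TangentBundle.symmL_trivializationAt (I := 𝓘(ℝ, E))
    (x₀ := x₀) (x := (extChartAt 𝓘(ℝ, E) x₀).symm z) (by simpa using symm_mem_source hz)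
  rw [chartFrame, h, (extChartAt 𝓘(ℝ, E) x₀).right_inv hz, modelWithCornersSelf_coe, Set.range_id,
    mfderivWithin_univ]

theorem inChart_apply (Ω : ThreeForm E M) (hz : z ∈ (extChartAt 𝓘(ℝ, E) x₀).target) (u v w : E) :
    Ω.inChart x₀ z ![u, v, w] = Ω ((extChartAt 𝓘(ℝ, E) x₀).symm z)
      ![chartFrame x₀ _ u, chartFrame x₀ _ v, chartFrame x₀ _ w] := by
  refine congrArg (Ω ((extChartAt 𝓘(ℝ, E) x₀).symm z)) (funext fun i => ?_)
  have h (v : E) := congrArg (fun L : E →L[ℝ] TangentSpace 𝓘(ℝ, E) _ => L v) (mfderiv_chart_symm hz)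
  fin_cases i
  exacts [h u, h v, h w]

theorem form_apply_eq (Ω : ThreeForm E M) (hz : z ∈ (extChartAt 𝓘(ℝ, E) x₀).target)
    (u v w : TangentSpace 𝓘(ℝ, E) ((extChartAt 𝓘(ℝ, E) x₀).symm z)) :
    Ω ((extChartAt 𝓘(ℝ, E) x₀).symm z) ![u, v, w] =
      tri (Ω.inChart x₀ z) (chartCoframe x₀ _ u) (chartCoframe x₀ _ v) (chartCoframe x₀ _ w) := by
  rw [tri_apply, inChart_apply Ω hz]
  simp only [chartFrame_chartCoframe (symm_mem_source hz)]

theorem mvfderiv_chartFrame {f : M → ℝ} (hz : z ∈ (extChartAt 𝓘(ℝ, E) x₀).target)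
    (hf : MDifferentiableAt 𝓘(ℝ, E) 𝓘(ℝ, ℝ) f ((extChartAt 𝓘(ℝ, E) x₀).symm z)) (v : E) :
    mvfderiv 𝓘(ℝ, E) f ((extChartAt 𝓘(ℝ, E) x₀).symm z) (chartFrame x₀ _ v) =
      fderiv ℝ (fun z => f ((extChartAt 𝓘(ℝ, E) x₀).symm z)) z v := by
  have h := mfderiv_comp_apply z hf
    ((contMDiffAt_chart_symm hz).mdifferentiableAt (by simp)) v
  rw [mfderiv_chart_symm hz, mfderiv_eq_fderiv] at h
  exact h.symm

theorem mdifferentiableAt_of_chart {f : M → ℝ} (hz : z ∈ (extChartAt 𝓘(ℝ, E) x₀).target)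
    (hf : DifferentiableAt ℝ (fun z => f ((extChartAt 𝓘(ℝ, E) x₀).symm z)) z) :
    MDifferentiableAt 𝓘(ℝ, E) 𝓘(ℝ, ℝ) f ((extChartAt 𝓘(ℝ, E) x₀).symm z) := by
  have h1 : MDifferentiableAt 𝓘(ℝ, E) 𝓘(ℝ, ℝ)
      ((fun z => f ((extChartAt 𝓘(ℝ, E) x₀).symm z)) ∘ extChartAt 𝓘(ℝ, E) x₀)
      ((extChartAt 𝓘(ℝ, E) x₀).symm z) := by
    refine MDifferentiableAt.comp _ ?_
      ((contMDiffAt_chart (symm_mem_source hz)).mdifferentiableAt (by simp))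
    rw [(extChartAt 𝓘(ℝ, E) x₀).right_inv hz]
    exact hf.mdifferentiableAt
  refine h1.congr_of_eventuallyEq ?_
  filter_upwards [extChartAt_source_mem_nhds' (I := 𝓘(ℝ, E)) (symm_mem_source hz)] with y hy
  exact congrArg f ((extChartAt 𝓘(ℝ, E) x₀).left_inv hy).symm

theorem contDiffAt_chartRead {X : ∀ x : M, TangentSpace 𝓘(ℝ, E) x}
    (hz : z ∈ (extChartAt 𝓘(ℝ, E) x₀).target)
    (hX : ContMDiffAt 𝓘(ℝ, E) (𝓘(ℝ, E).prod 𝓘(ℝ, E)) ∞ (T% X) ((extChartAt 𝓘(ℝ, E) x₀).symm z)) :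
    ContDiffAt ℝ ∞ (chartRead x₀ X) z := by
  have hb := mem_baseSet_iff.2 (symm_mem_source hz)
  have h := ((Bundle.Trivialization.contMDiffAt_section_iff _ hb).1 hX).comp z
    (contMDiffAt_chart_symm hz)
  refine (contMDiffAt_iff_contDiffAt.1 h).congr_of_eventuallyEq ?_
  filter_upwards [target_mem_nhds hz] with z' hz'
  exact (Bundle.Trivialization.continuousLinearMapAt_apply_of_mem ℝ _
    (mem_baseSet_iff.2 (symm_mem_source hz')) _)

theorem differentiableAt_chartRead {X : ∀ x : M, TangentSpace 𝓘(ℝ, E) x}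
    (hz : z ∈ (extChartAt 𝓘(ℝ, E) x₀).target)
    (hX : MDifferentiableAt 𝓘(ℝ, E) (𝓘(ℝ, E).prod 𝓘(ℝ, E)) (T% X)
      ((extChartAt 𝓘(ℝ, E) x₀).symm z)) :
    DifferentiableAt ℝ (chartRead x₀ X) z := by
  have hb := mem_baseSet_iff.2 (symm_mem_source hz)
  have h := ((Bundle.Trivialization.mdifferentiableAt_section_iff _ _ _ hb).1 hX).comp z
    ((contMDiffAt_chart_symm hz).mdifferentiableAt (by simp))
  refine (mdifferentiableAt_iff_differentiableAt.1 h).congr_of_eventuallyEq ?_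
  filter_upwards [target_mem_nhds hz] with z' hz'
  exact (Bundle.Trivialization.continuousLinearMapAt_apply_of_mem ℝ _
    (mem_baseSet_iff.2 (symm_mem_source hz')) _)

end ChartFrames

end CartanGeometry
end

open scoped Manifold ContDiff
noncomputable section
namespace CartanGeometry
open Filter Topology

/-! ### Leibniz rules for forms and metrics evaluated on vector fields. -/

section ProductRules

variable {E : Type*} [NormedAddCommGroup E] [NormedSpace ℝ E]

theorem hasFDerivAt_form_apply {θ : E → E [⋀^Fin 3]→L[ℝ] ℝ} {a b c : E → E} {z : E}
    (hθ : DifferentiableAt ℝ θ z) (ha : DifferentiableAt ℝ a z) (hb : DifferentiableAt ℝ b z)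
    (hc : DifferentiableAt ℝ c z) :
    DifferentiableAt ℝ (fun z => tri (θ z) (a z) (b z) (c z)) z ∧
    ∀ v, fderiv ℝ (fun z => tri (θ z) (a z) (b z) (c z)) z v =
      tri (fderiv ℝ θ z v) (a z) (b z) (c z) + tri (θ z) (fderiv ℝ a z v) (b z) (c z) +
        tri (θ z) (a z) (fderiv ℝ b z v) (c z) + tri (θ z) (a z) (b z) (fderiv ℝ c z v) := by
  have h := HasFDerivAt.continuousAlternatingMap_apply hθ.hasFDerivAt
    (g := ![a, b, c]) (g' := ![fderiv ℝ a z, fderiv ℝ b z, fderiv ℝ c z])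
    (fun i => by fin_cases i; exacts [ha.hasFDerivAt, hb.hasFDerivAt, hc.hasFDerivAt])
  have e : (fun z => tri (θ z) (a z) (b z) (c z)) = fun z => θ z fun i => ![a, b, c] i z := by
    funext z'
    rw [tri_apply]
    congr 1
    ext i
    fin_cases i <;> rfl
  rw [e]
  refine ⟨h.differentiableAt, fun v => ?_⟩
  rw [h.fderiv]
  have e0 : (fun i => ![a, b, c] i z) = ![a z, b z, c z] := by
    ext i
    fin_cases i <;> rfl
  simp only [e0, Fin.sum_univ_three, _root_.add_apply, ContinuousLinearMap.comp_apply,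
    ContinuousAlternatingMap.apply_apply, ContinuousAlternatingMap.toContinuousLinearMap_apply,
    Matrix.cons_val_zero, Matrix.cons_val_one, Matrix.cons_val, tri_apply]
  rw [← add_assoc, ← add_assoc]
  congr 2
  · congr 2
    ext i
    fin_cases i <;> rfl
  · congr 1
    ext i
    fin_cases i <;> rfl
  · ext i
    fin_cases i <;> rfl

variable [FiniteDimensional ℝ E]

set_option maxSynthPendingDepth 3 in
theorem differentiableAt_toCLM₂ {G : E → E →ₗ[ℝ] E →ₗ[ℝ] ℝ} {z : E}
    (hG : ∀ x y, DifferentiableAt ℝ (fun z => G z x y) z) :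
    DifferentiableAt ℝ (fun z => toCLM₂ E ℝ (G z)) z := by
  let b := Module.finBasis ℝ E
  -- Expansion in elementary bilinear forms reduces differentiability of `G` to that of its finitely
  -- many entries.
  obtain ⟨L, hL⟩ : ∃ L : Fin (Module.finrank ℝ E) → Fin (Module.finrank ℝ E) → E →L[ℝ] E →L[ℝ] ℝ,
      ∀ z', toCLM₂ E ℝ (G z') = ∑ i, ∑ j, G z' (b i) (b j) • L i j := by
    refine ⟨fun i j => toCLM₂ E ℝ (LinearMap.mk₂ ℝ (fun x y => b.repr x i * b.repr y j)
      (by intros; simp [add_mul]) (by intros; simp [mul_assoc]) (by intros; simp [mul_add])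
      (by intros; simp [mul_left_comm])), fun z' => ?_⟩
    refine (toCLM₂ E ℝ).symm.injective (b.ext fun k => b.ext fun l => ?_)
    simp [Finsupp.single_apply]
  simp only [hL]
  exact DifferentiableAt.fun_sum fun i _ => DifferentiableAt.fun_sum fun j _ =>
    (hG (b i) (b j)).smul_const (L i j)

theorem hasFDerivAt_bilin_apply {G : E → E →ₗ[ℝ] E →ₗ[ℝ] ℝ} {a b : E → E} {z : E}
    (hG : ∀ x y, DifferentiableAt ℝ (fun z => G z x y) z) (ha : DifferentiableAt ℝ a z)
    (hb : DifferentiableAt ℝ b z) :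
    DifferentiableAt ℝ (fun z => G z (a z) (b z)) z ∧
    ∀ v, fderiv ℝ (fun z => G z (a z) (b z)) z v =
      fderiv ℝ (fun z' => G z' (a z) (b z)) z v + G z (fderiv ℝ a z v) (b z) +
        G z (a z) (fderiv ℝ b z v) := by
  have hF := (differentiableAt_toCLM₂ hG).hasFDerivAt
  have h := (hF.clm_apply ha.hasFDerivAt).clm_apply hb.hasFDerivAt
  have hc := (hF.clm_apply (hasFDerivAt_const (a z) z)).clm_apply (hasFDerivAt_const (b z) z)
  refine ⟨h.differentiableAt, fun v => ?_⟩
  have h' := congrArg (fun L : E →L[ℝ] ℝ => L v) h.fderiv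
  have hc' := congrArg (fun L : E →L[ℝ] ℝ => L v) hc.fderiv
  simp at h' hc'
  rw [h', hc']
  ring

end ProductRules
end CartanGeometry
end

open scoped Manifold ContDiff
noncomputable section
namespace CartanGeometry
open Filter Topology VectorField

/-! ### Covariant derivative and torsion in terms of Christoffel symbols. -/

section ChartFormulas

variable {E : Type*} [NormedAddCommGroup E] [NormedSpace ℝ E]
  {M : Type*} [TopologicalSpace M] [ChartedSpace E M] [IsManifold 𝓘(ℝ, E) ∞ M]
  {𝔤 : Type*} [LieRing 𝔤] [LieAlgebra ℝ 𝔤] {x₀ : M} {z : E}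
  {X Y : ∀ x : M, TangentSpace 𝓘(ℝ, E) x}

theorem mpullback_chart_symm (X : ∀ x : M, TangentSpace 𝓘(ℝ, E) x)
    (hz : z ∈ (extChartAt 𝓘(ℝ, E) x₀).target) :
    mpullback 𝓘(ℝ, E) 𝓘(ℝ, E) (extChartAt 𝓘(ℝ, E) x₀).symm X z = chartRead x₀ X z := by
  have h : (chartFrame (E := E) x₀ ((extChartAt 𝓘(ℝ, E) x₀).symm z)).inverse =
      chartCoframe x₀ ((extChartAt 𝓘(ℝ, E) x₀).symm z) :=
    ContinuousLinearMap.inverse_eq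
      (ContinuousLinearMap.ext fun v => chartFrame_chartCoframe (symm_mem_source hz) v)
      (ContinuousLinearMap.ext fun v => chartCoframe_chartFrame (symm_mem_source hz) v)
  have h' := mfderiv_chart_symm hz
  rw [mpullback_apply, chartRead, ← h, h']
  rfl

theorem chartCoframe_mlieBracket [FiniteDimensional ℝ E]
    (hz : z ∈ (extChartAt 𝓘(ℝ, E) x₀).target)
    (hX : MDiffAt (T% X) ((extChartAt 𝓘(ℝ, E) x₀).symm z))
    (hY : MDiffAt (T% Y) ((extChartAt 𝓘(ℝ, E) x₀).symm z)) :
    chartCoframe x₀ _ (mlieBracket 𝓘(ℝ, E) X Y ((extChartAt 𝓘(ℝ, E) x₀).symm z)) =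
      fderiv ℝ (chartRead x₀ Y) z (chartRead x₀ X z) -
        fderiv ℝ (chartRead x₀ X) z (chartRead x₀ Y z) := by
  have : CompleteSpace E := FiniteDimensional.complete ℝ E
  have : IsManifold 𝓘(ℝ, E) (minSmoothness ℝ 2) M := by
    rw [minSmoothness_of_isRCLikeNormedField]
    infer_instance
  have h := mpullback_mlieBracket (n := ∞) hX hY (contMDiffAt_chart_symm hz)
    (by rw [minSmoothness_of_isRCLikeNormedField]; exact ENat.LEInfty.out)
  rw [mpullback_chart_symm _ hz] at h
  have e (X : ∀ x : M, TangentSpace 𝓘(ℝ, E) x) :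
      mpullback 𝓘(ℝ, E) 𝓘(ℝ, E) (extChartAt 𝓘(ℝ, E) x₀).symm X =ᶠ[𝓝 z] chartRead x₀ X := by
    filter_upwards [target_mem_nhds hz] with z' hz'
    exact mpullback_chart_symm X hz'
  refine h.trans (((e X).mlieBracket_vectorField_eq (e Y)).trans ?_)
  refine (congrFun (mlieBracketWithin_eq_lieBracketWithin (V := chartRead x₀ X)
    (W := chartRead x₀ Y) (s := Set.univ)) z).trans ?_
  rw [lieBracketWithin_univ]
  rfl

theorem chartRead_extend (u : TangentSpace 𝓘(ℝ, E) ((extChartAt 𝓘(ℝ, E) x₀).symm z)) :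
    chartRead x₀ (FiberBundle.extend E u) z = chartCoframe x₀ _ u := by
  rw [chartRead, FiberBundle.extend_apply_self]

/-- The operator `D`, the value at a point of a connection, has Christoffel symbols `Γ` in the chart
at `x₀`. -/
def Represents (x₀ : M) (z : E)
    (D : (∀ x : M, TangentSpace 𝓘(ℝ, E) x) →
      TangentSpace 𝓘(ℝ, E) ((extChartAt 𝓘(ℝ, E) x₀).symm z) →L[ℝ]
        TangentSpace 𝓘(ℝ, E) ((extChartAt 𝓘(ℝ, E) x₀).symm z))
    (Γ : E →L[ℝ] E →L[ℝ] E) : Prop :=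
  ∀ X : ∀ x : M, TangentSpace 𝓘(ℝ, E) x, MDiffAt (T% X) ((extChartAt 𝓘(ℝ, E) x₀).symm z) →
    ∀ w, chartCoframe x₀ _ (D X (chartFrame x₀ _ w)) =
      fderiv ℝ (chartRead x₀ X) z w + Γ w (chartRead x₀ X z)

/-- Pointwise form of the defining properties of a covariant derivative. -/
def derivationsAt (y : M) : Set ((∀ x : M, TangentSpace 𝓘(ℝ, E) x) →
    TangentSpace 𝓘(ℝ, E) y →L[ℝ] TangentSpace 𝓘(ℝ, E) y) :=
  {D | (∀ X Y, MDiffAt (T% X) y → MDiffAt (T% Y) y → D (X + Y) = D X + D Y) ∧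
    ∀ X (g : M → ℝ), MDiffAt (T% X) y → MDiffAt g y →
      D (g • X) = g y • D X + (mvfderiv 𝓘(ℝ, E) g y).smulRight (X y)}

/-- The covariant derivative of a 3-form, in pointwise form. -/
def covDerivAt {y : M} (D : (∀ x : M, TangentSpace 𝓘(ℝ, E) x) →
    TangentSpace 𝓘(ℝ, E) y →L[ℝ] TangentSpace 𝓘(ℝ, E) y) (Ω : ThreeForm E M)
    (v u₁ u₂ u₃ : TangentSpace 𝓘(ℝ, E) y) : ℝ :=
  mvfderiv 𝓘(ℝ, E) (fun y => Ω y ![FiberBundle.extend E u₁ y, FiberBundle.extend E u₂ y,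
      FiberBundle.extend E u₃ y]) y v
    - Ω y ![D (FiberBundle.extend E u₁) v, u₂, u₃]
    - Ω y ![u₁, D (FiberBundle.extend E u₂) v, u₃]
    - Ω y ![u₁, u₂, D (FiberBundle.extend E u₃) v]

/-- Pointwise form of the condition that a connection preserve the 3-form `Ω`. -/
def preservingAt (Ω : ThreeForm E M) (y : M) : Set ((∀ x : M, TangentSpace 𝓘(ℝ, E) x) →
    TangentSpace 𝓘(ℝ, E) y →L[ℝ] TangentSpace 𝓘(ℝ, E) y) :=
  {D | ∀ v u₁ u₂ u₃, covDerivAt D Ω v u₁ u₂ u₃ = 0}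

/-- The torsion of a connection, in pointwise form. -/
def torsionAt {y : M} (D : (∀ x : M, TangentSpace 𝓘(ℝ, E) x) →
    TangentSpace 𝓘(ℝ, E) y →L[ℝ] TangentSpace 𝓘(ℝ, E) y) (X Y : ∀ x : M, TangentSpace 𝓘(ℝ, E) x) :
    TangentSpace 𝓘(ℝ, E) y :=
  D Y (X y) - D X (Y y) - mlieBracket 𝓘(ℝ, E) X Y y

/-- Pointwise form of the condition that a connection have skew-symmetric torsion. -/
def skewTorsionAt (𝔤 : Type*) [LieRing 𝔤] [LieAlgebra ℝ 𝔤] (Ω : ThreeForm E M) (y : M) :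
    Set ((∀ x : M, TangentSpace 𝓘(ℝ, E) x) →
      TangentSpace 𝓘(ℝ, E) y →L[ℝ] TangentSpace 𝓘(ℝ, E) y) :=
  {D | ∀ u v w : TangentSpace 𝓘(ℝ, E) y,
    assocMetric 𝔤 Ω y (torsionAt D (FiberBundle.extend E u) (FiberBundle.extend E v)) w =
      -assocMetric 𝔤 Ω y (torsionAt D (FiberBundle.extend E u) (FiberBundle.extend E w)) v}

/-- Pointwise form of the condition that a connection be torsion-free. -/
def torsionFreeAt (y : M) : Set ((∀ x : M, TangentSpace 𝓘(ℝ, E) x) →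
    TangentSpace 𝓘(ℝ, E) y →L[ℝ] TangentSpace 𝓘(ℝ, E) y) :=
  {D | ∀ X Y, MDiffAt (T% X) y → MDiffAt (T% Y) y → torsionAt D X Y = 0}

/-- Pointwise form of the compatibility of a connection with the associated metric. -/
def metricAt (𝔤 : Type*) [LieRing 𝔤] [LieAlgebra ℝ 𝔤] (Ω : ThreeForm E M) (y : M) :
    Set ((∀ x : M, TangentSpace 𝓘(ℝ, E) x) →
      TangentSpace 𝓘(ℝ, E) y →L[ℝ] TangentSpace 𝓘(ℝ, E) y) :=
  {D | ∀ X Y, MDiffAt (T% X) y → MDiffAt (T% Y) y → ∀ v : TangentSpace 𝓘(ℝ, E) y,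
    mvfderiv 𝓘(ℝ, E) (fun y => assocMetric 𝔤 Ω y (X y) (Y y)) y v =
      assocMetric 𝔤 Ω y (D X v) (Y y) + assocMetric 𝔤 Ω y (X y) (D Y v)}

variable {D : (∀ x : M, TangentSpace 𝓘(ℝ, E) x) →
      TangentSpace 𝓘(ℝ, E) ((extChartAt 𝓘(ℝ, E) x₀).symm z) →L[ℝ]
        TangentSpace 𝓘(ℝ, E) ((extChartAt 𝓘(ℝ, E) x₀).symm z)}
  {Γ : E →L[ℝ] E →L[ℝ] E} {Ω : ThreeForm E M}

theorem exists_chartFrame (hz : z ∈ (extChartAt 𝓘(ℝ, E) x₀).target)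
    (v : TangentSpace 𝓘(ℝ, E) ((extChartAt 𝓘(ℝ, E) x₀).symm z)) :
    ∃ w : E, v = chartFrame x₀ _ w :=
  ⟨_, (chartFrame_chartCoframe (symm_mem_source hz) v).symm⟩

theorem mdifferentiableAt_extend_vectorField {y : M} (u : TangentSpace 𝓘(ℝ, E) y) :
    MDiffAt (T% (FiberBundle.extend E u : ∀ x : M, TangentSpace 𝓘(ℝ, E) x)) y :=
  FiberBundle.mdifferentiableAt_extend ..

theorem differentiableAt_chartRead_extend (hz : z ∈ (extChartAt 𝓘(ℝ, E) x₀).target)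
    (u : TangentSpace 𝓘(ℝ, E) ((extChartAt 𝓘(ℝ, E) x₀).symm z)) :
    DifferentiableAt ℝ (chartRead x₀ (FiberBundle.extend E u)) z :=
  differentiableAt_chartRead hz (mdifferentiableAt_extend_vectorField u)

/-- By the product rule, the derivatives of the extended fields cancel against the derivative parts
of `D`, so the result does not depend on the extensions. -/
theorem covDerivAt_eq (hz : z ∈ (extChartAt 𝓘(ℝ, E) x₀).target)
    (hΩ : DifferentiableAt ℝ (Ω.inChart x₀) z) (hD : Represents x₀ z D Γ)
    (v u₁ u₂ u₃ : TangentSpace 𝓘(ℝ, E) ((extChartAt 𝓘(ℝ, E) x₀).symm z)) :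
    covDerivAt D Ω v u₁ u₂ u₃ =
      tri (fderiv ℝ (Ω.inChart x₀) z (chartCoframe x₀ _ v)) (chartCoframe x₀ _ u₁)
        (chartCoframe x₀ _ u₂) (chartCoframe x₀ _ u₃) -
      formAction (Ω.inChart x₀ z) (Γ (chartCoframe x₀ _ v)) (chartCoframe x₀ _ u₁)
        (chartCoframe x₀ _ u₂) (chartCoframe x₀ _ u₃) := by
  obtain ⟨v, rfl⟩ := exists_chartFrame hz v
  have hf := hasFDerivAt_form_apply hΩ (differentiableAt_chartRead_extend hz u₁)
    (differentiableAt_chartRead_extend hz u₂) (differentiableAt_chartRead_extend hz u₃)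
  let f : M → ℝ := fun y => Ω y ![FiberBundle.extend E u₁ y, FiberBundle.extend E u₂ y,
    FiberBundle.extend E u₃ y]
  have e : (fun z => f ((extChartAt 𝓘(ℝ, E) x₀).symm z)) =ᶠ[𝓝 z]
      fun z => tri (Ω.inChart x₀ z) (chartRead x₀ (FiberBundle.extend E u₁) z)
        (chartRead x₀ (FiberBundle.extend E u₂) z) (chartRead x₀ (FiberBundle.extend E u₃) z) := by
    filter_upwards [target_mem_nhds hz] with z' hz'
    exact form_apply_eq Ω hz' _ _ _
  have hm := mdifferentiableAt_of_chart (f := f) hz (hf.1.congr_of_eventuallyEq e)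
  have hv := mvfderiv_chartFrame hz hm v
  rw [e.fderiv_eq] at hv
  rw [covDerivAt, hv, form_apply_eq Ω hz, form_apply_eq Ω hz, form_apply_eq Ω hz]
  refine (congrArg (fun a : ℝ => a - _ - _ - _) (hf.2 v)).trans ?_
  simp only [chartRead_extend, hD _ (mdifferentiableAt_extend_vectorField _),
    chartCoframe_chartFrame (symm_mem_source hz), map_add, formAction, LinearMap.add_apply]
  ring

theorem mem_preservingAt_iff (hz : z ∈ (extChartAt 𝓘(ℝ, E) x₀).target)
    (hΩ : DifferentiableAt ℝ (Ω.inChart x₀) z) (hD : Represents x₀ z D Γ) :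
    D ∈ preservingAt Ω _ ↔ PreservesForm (Ω.inChart x₀) z Γ := by
  constructor
  · intro h v x y u
    have := h (chartFrame x₀ _ v) (chartFrame x₀ _ x) (chartFrame x₀ _ y) (chartFrame x₀ _ u)
    rw [covDerivAt_eq hz hΩ hD] at this
    simpa only [chartCoframe_chartFrame (symm_mem_source hz)] using sub_eq_zero.1 this
  · intro h v u₁ u₂ u₃
    rw [covDerivAt_eq hz hΩ hD, h, sub_self]

/-- The derivative parts of `D Y X - D X Y` form the Lie bracket of the fields read in the chart,
and cancel against it. -/
theorem chartCoframe_torsionAt [FiniteDimensional ℝ E]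
    (hz : z ∈ (extChartAt 𝓘(ℝ, E) x₀).target) (hD : Represents x₀ z D Γ)
    (hX : MDiffAt (T% X) ((extChartAt 𝓘(ℝ, E) x₀).symm z))
    (hY : MDiffAt (T% Y) ((extChartAt 𝓘(ℝ, E) x₀).symm z)) :
    chartCoframe x₀ _ (torsionAt D X Y) =
      Γ (chartRead x₀ X z) (chartRead x₀ Y z) - Γ (chartRead x₀ Y z) (chartRead x₀ X z) := by
  have h1 := hD Y hY (chartRead x₀ X z)
  have h2 := hD X hX (chartRead x₀ Y z)
  rw [chartRead, chartFrame_chartCoframe (symm_mem_source hz)] at h1 h2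
  rw [torsionAt, map_sub, map_sub, chartCoframe_mlieBracket hz hX hY, h1, h2]
  simp only [chartRead]
  abel

end ChartFormulas
end CartanGeometry
end

open scoped Manifold ContDiff
noncomputable section
namespace CartanGeometry
open Filter Topology VectorField

/-! ### The associated metric and metric connections in a chart. -/

section ChartMetric

variable {E : Type*} [NormedAddCommGroup E] [NormedSpace ℝ E]
  {M : Type*} [TopologicalSpace M] [ChartedSpace E M] [IsManifold 𝓘(ℝ, E) ∞ M]
  {𝔤 : Type*} [LieRing 𝔤] [LieAlgebra ℝ 𝔤] {Ω : ThreeForm E M} {x₀ : M} {z : E}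

/-- A frame of the tangent space at a point of the chart domain, as a frame of the model space. -/
def modelFrame (hz : z ∈ (extChartAt 𝓘(ℝ, E) x₀).target)
    (I : TangentSpace 𝓘(ℝ, E) ((extChartAt 𝓘(ℝ, E) x₀).symm z) ≃ₗ[ℝ] 𝔤) : E ≃ₗ[ℝ] 𝔤 :=
  (chartEquiv x₀ _ (symm_mem_source hz)).symm.trans I

theorem modelFrame_apply (hz : z ∈ (extChartAt 𝓘(ℝ, E) x₀).target)
    (I : TangentSpace 𝓘(ℝ, E) ((extChartAt 𝓘(ℝ, E) x₀).symm z) ≃ₗ[ℝ] 𝔤) (v : E) :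
    modelFrame hz I v = I (chartFrame x₀ _ v) := rfl

theorem modelFrame_chartCoframe (hz : z ∈ (extChartAt 𝓘(ℝ, E) x₀).target)
    (I : TangentSpace 𝓘(ℝ, E) ((extChartAt 𝓘(ℝ, E) x₀).symm z) ≃ₗ[ℝ] 𝔤)
    (v : TangentSpace 𝓘(ℝ, E) ((extChartAt 𝓘(ℝ, E) x₀).symm z)) :
    modelFrame hz I (chartCoframe x₀ _ v) = I v := by
  rw [modelFrame_apply, chartFrame_chartCoframe (symm_mem_source hz)]

theorem modelFrame_symm_apply (hz : z ∈ (extChartAt 𝓘(ℝ, E) x₀).target)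
    (I : TangentSpace 𝓘(ℝ, E) ((extChartAt 𝓘(ℝ, E) x₀).symm z) ≃ₗ[ℝ] 𝔤) (a : 𝔤) :
    (modelFrame hz I).symm a = chartCoframe x₀ _ (I.symm a) := rfl

theorem IsAdapted.modelFrame {I : TangentSpace 𝓘(ℝ, E) ((extChartAt 𝓘(ℝ, E) x₀).symm z) ≃ₗ[ℝ] 𝔤}
    (hI : IsAdapted Ω _ I) (hz : z ∈ (extChartAt 𝓘(ℝ, E) x₀).target) :
    IsAdaptedForm (Ω.inChart x₀ z) (modelFrame hz I) := fun u v w => by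
  rw [inChart_apply Ω hz, hI]
  rfl

theorem IsOfCartanType.isCartanOn (hΩ : IsOfCartanType 𝔤 Ω) (x₀ : M) :
    IsCartanOn 𝔤 (Ω.inChart x₀) (extChartAt 𝓘(ℝ, E) x₀).target where
  isOpen := isOpen_extChartAt_target x₀
  contDiffAt z hz := (hΩ.1 x₀).contDiffAt (target_mem_nhds hz)
  exists_frame z hz := by
    obtain ⟨I, hI⟩ := hΩ.2 ((extChartAt 𝓘(ℝ, E) x₀).symm z)
    exact ⟨_, hI.modelFrame hz⟩

theorem IsOfCartanType.differentiableAt (hΩ : IsOfCartanType 𝔤 Ω)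
    (hz : z ∈ (extChartAt 𝓘(ℝ, E) x₀).target) : DifferentiableAt ℝ (Ω.inChart x₀) z :=
  ((hΩ.isCartanOn x₀).contDiffAt z hz).differentiableAt (by simp)

variable [FiniteDimensional ℝ E]

theorem mem_torsionFreeAt_iff (hz : z ∈ (extChartAt 𝓘(ℝ, E) x₀).target)
    {D : (∀ x : M, TangentSpace 𝓘(ℝ, E) x) →
      TangentSpace 𝓘(ℝ, E) ((extChartAt 𝓘(ℝ, E) x₀).symm z) →L[ℝ]
        TangentSpace 𝓘(ℝ, E) ((extChartAt 𝓘(ℝ, E) x₀).symm z)}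
    {Γ : E →L[ℝ] E →L[ℝ] E} (hD : Represents x₀ z D Γ) :
    D ∈ torsionFreeAt _ ↔ ∀ u v, Γ u v = Γ v u := by
  constructor
  · intro h u v
    have := congrArg (chartCoframe x₀ _) (h _ _
      (mdifferentiableAt_extend_vectorField (chartFrame x₀ _ u))
      (mdifferentiableAt_extend_vectorField (chartFrame x₀ _ v)))
    rw [chartCoframe_torsionAt hz hD (mdifferentiableAt_extend_vectorField _)
      (mdifferentiableAt_extend_vectorField _), chartRead_extend, chartRead_extend,
      chartCoframe_chartFrame (symm_mem_source hz), chartCoframe_chartFrame (symm_mem_source hz),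
      map_zero] at this
    exact sub_eq_zero.1 this
  · intro h X Y hX hY
    rw [← chartFrame_chartCoframe (symm_mem_source hz) (torsionAt D X Y),
      chartCoframe_torsionAt hz hD hX hY, h, sub_self, map_zero]

variable [Module.Finite ℝ 𝔤] [LieAlgebra.IsSimple ℝ 𝔤]
  (hΩ : IsOfCartanType 𝔤 Ω) (hc : IsCompactType 𝔤) (hdim : 3 < Module.finrank ℝ 𝔤)
  (hz : z ∈ (extChartAt 𝓘(ℝ, E) x₀).target)
  {D : (∀ x : M, TangentSpace 𝓘(ℝ, E) x) →
    TangentSpace 𝓘(ℝ, E) ((extChartAt 𝓘(ℝ, E) x₀).symm z) →L[ℝ]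
      TangentSpace 𝓘(ℝ, E) ((extChartAt 𝓘(ℝ, E) x₀).symm z)}
  {Γ : E →L[ℝ] E →L[ℝ] E}
include hΩ hc hdim hz

theorem assocMetric_eq_formMetric
    (u v : TangentSpace 𝓘(ℝ, E) ((extChartAt 𝓘(ℝ, E) x₀).symm z)) :
    assocMetric 𝔤 Ω _ u v =
      formMetric 𝔤 (Ω.inChart x₀ z) (chartCoframe x₀ _ u) (chartCoframe x₀ _ v) := by
  have h := hΩ.2 ((extChartAt 𝓘(ℝ, E) x₀).symm z)
  rw [assocMetric, dif_pos h, formMetric_eq hc hdim (h.choose_spec.modelFrame hz),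
    modelFrame_chartCoframe, modelFrame_chartCoframe]

theorem mem_skewTorsionAt_iff (hD : Represents x₀ z D Γ) :
    D ∈ skewTorsionAt 𝔤 Ω _ ↔ HasSkewTorsionForm 𝔤 (Ω.inChart x₀ z) Γ := by
  have h (u v w : TangentSpace 𝓘(ℝ, E) ((extChartAt 𝓘(ℝ, E) x₀).symm z)) :
      assocMetric 𝔤 Ω _ (torsionAt D (FiberBundle.extend E u) (FiberBundle.extend E v)) w =
      formMetric 𝔤 (Ω.inChart x₀ z) (Γ (chartCoframe x₀ _ u) (chartCoframe x₀ _ v) -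
        Γ (chartCoframe x₀ _ v) (chartCoframe x₀ _ u)) (chartCoframe x₀ _ w) := by
    rw [assocMetric_eq_formMetric hΩ hc hdim hz, chartCoframe_torsionAt hz hD
      (mdifferentiableAt_extend_vectorField u) (mdifferentiableAt_extend_vectorField v),
      chartRead_extend, chartRead_extend]
  constructor
  · intro hs u v x
    have := hs (chartFrame x₀ _ u) (chartFrame x₀ _ v) (chartFrame x₀ _ x)
    rw [h, h] at this
    simpa only [chartCoframe_chartFrame (symm_mem_source hz)] using this
  · intro hs u v w
    rw [h, h, hs]

theorem mvfderiv_assocMetric {X Y : ∀ x : M, TangentSpace 𝓘(ℝ, E) x}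
    (hX : MDiffAt (T% X) ((extChartAt 𝓘(ℝ, E) x₀).symm z))
    (hY : MDiffAt (T% Y) ((extChartAt 𝓘(ℝ, E) x₀).symm z)) (v : E) :
    mvfderiv 𝓘(ℝ, E) (fun y => assocMetric 𝔤 Ω y (X y) (Y y)) ((extChartAt 𝓘(ℝ, E) x₀).symm z)
      (chartFrame x₀ _ v) =
      fderiv ℝ (fun z' => formMetric 𝔤 (Ω.inChart x₀ z') (chartRead x₀ X z) (chartRead x₀ Y z)) z v
      + formMetric 𝔤 (Ω.inChart x₀ z) (fderiv ℝ (chartRead x₀ X) z v) (chartRead x₀ Y z)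
      + formMetric 𝔤 (Ω.inChart x₀ z) (chartRead x₀ X z) (fderiv ℝ (chartRead x₀ Y) z v) := by
  have hf := hasFDerivAt_bilin_apply (G := fun z => formMetric 𝔤 (Ω.inChart x₀ z))
    (fun x y => ((hΩ.isCartanOn x₀).contDiffAt_formMetric hc hdim hz x y).differentiableAt
      (by simp)) (differentiableAt_chartRead hz hX) (differentiableAt_chartRead hz hY)
  let f : M → ℝ := fun y => assocMetric 𝔤 Ω y (X y) (Y y)
  have e : (fun z => f ((extChartAt 𝓘(ℝ, E) x₀).symm z)) =ᶠ[𝓝 z]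
      fun z => formMetric 𝔤 (Ω.inChart x₀ z) (chartRead x₀ X z) (chartRead x₀ Y z) := by
    filter_upwards [target_mem_nhds hz] with z' hz'
    exact assocMetric_eq_formMetric hΩ hc hdim hz' _ _
  have hv := mvfderiv_chartFrame hz (mdifferentiableAt_of_chart (f := f) hz
    (hf.1.congr_of_eventuallyEq e)) v
  rw [e.fderiv_eq] at hv
  exact hv.trans (hf.2 v)

theorem mem_metricAt_iff (hD : Represents x₀ z D Γ) :
    D ∈ metricAt 𝔤 Ω _ ↔ PreservesMetric 𝔤 (Ω.inChart x₀) z Γ := by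
  have h {X Y : ∀ x : M, TangentSpace 𝓘(ℝ, E) x}
      (hX : MDiffAt (T% X) ((extChartAt 𝓘(ℝ, E) x₀).symm z))
      (hY : MDiffAt (T% Y) ((extChartAt 𝓘(ℝ, E) x₀).symm z)) (v : E) :
      mvfderiv 𝓘(ℝ, E) (fun y => assocMetric 𝔤 Ω y (X y) (Y y)) ((extChartAt 𝓘(ℝ, E) x₀).symm z)
        (chartFrame x₀ _ v) = assocMetric 𝔤 Ω _ (D X (chartFrame x₀ _ v)) (Y _) +
          assocMetric 𝔤 Ω _ (X _) (D Y (chartFrame x₀ _ v)) ↔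
      fderiv ℝ (fun z' => formMetric 𝔤 (Ω.inChart x₀ z') (chartRead x₀ X z) (chartRead x₀ Y z)) z v
        = formMetric 𝔤 (Ω.inChart x₀ z) (Γ v (chartRead x₀ X z)) (chartRead x₀ Y z) +
          formMetric 𝔤 (Ω.inChart x₀ z) (chartRead x₀ X z) (Γ v (chartRead x₀ Y z)) := by
    rw [mvfderiv_assocMetric hΩ hc hdim hz hX hY, assocMetric_eq_formMetric hΩ hc hdim hz,
      assocMetric_eq_formMetric hΩ hc hdim hz, hD X hX, hD Y hY, map_add, map_add,
      LinearMap.add_apply]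
    have hr (X : ∀ x : M, TangentSpace 𝓘(ℝ, E) x) : chartCoframe x₀ _ (X _) = chartRead x₀ X z := rfl
    rw [hr X, hr Y]
    constructor <;> intro h <;> linarith
  constructor
  · intro hm v x y
    have := (h (mdifferentiableAt_extend_vectorField (chartFrame x₀ _ x))
      (mdifferentiableAt_extend_vectorField (chartFrame x₀ _ y)) v).1
      (hm _ _ (mdifferentiableAt_extend_vectorField _) (mdifferentiableAt_extend_vectorField _) _)
    simpa only [chartRead_extend, chartCoframe_chartFrame (symm_mem_source hz)] using this
  · intro hm X Y hX hY v
    obtain ⟨v, rfl⟩ := exists_chartFrame hz v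
    exact (h hX hY v).2 (hm v _ _)

end ChartMetric
end CartanGeometry
end

open scoped Manifold ContDiff
noncomputable section
namespace CartanGeometry
open Filter Topology VectorField

/-! ### The pointwise conditions on a connection are convex. -/

section Convexity

variable {E : Type*} [NormedAddCommGroup E] [NormedSpace ℝ E]
  {M : Type*} [TopologicalSpace M] [ChartedSpace E M]
  {𝔤 : Type*} [LieRing 𝔤] [LieAlgebra ℝ 𝔤] {Ω : ThreeForm E M} {y : M}

theorem form_combination₁ (a b : ℝ) (p q u v : TangentSpace 𝓘(ℝ, E) y) :
    Ω y ![a • p + b • q, u, v] = a * Ω y ![p, u, v] + b * Ω y ![q, u, v] := by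
  have h : ∀ p q u v : E, tri (E := E) (Ω y) (a • p + b • q) u v =
    a * tri (E := E) (Ω y) p u v + b * tri (E := E) (Ω y) q u v := fun p q u v => by simp
  exact h p q u v

theorem form_combination₂ (a b : ℝ) (p q u v : TangentSpace 𝓘(ℝ, E) y) :
    Ω y ![u, a • p + b • q, v] = a * Ω y ![u, p, v] + b * Ω y ![u, q, v] := by
  have h : ∀ p q u v : E, tri (E := E) (Ω y) u (a • p + b • q) v =
    a * tri (E := E) (Ω y) u p v + b * tri (E := E) (Ω y) u q v := fun p q u v => by simp
  exact h p q u v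

theorem form_combination₃ (a b : ℝ) (p q u v : TangentSpace 𝓘(ℝ, E) y) :
    Ω y ![u, v, a • p + b • q] = a * Ω y ![u, v, p] + b * Ω y ![u, v, q] := by
  have h : ∀ p q u v : E, tri (E := E) (Ω y) u v (a • p + b • q) =
    a * tri (E := E) (Ω y) u v p + b * tri (E := E) (Ω y) u v q := fun p q u v => by simp
  exact h p q u v

theorem assocMetric_combination_left (a b : ℝ) (p q u : TangentSpace 𝓘(ℝ, E) y) :
    assocMetric 𝔤 Ω y (a • p + b • q) u =
      a * assocMetric 𝔤 Ω y p u + b * assocMetric 𝔤 Ω y q u := by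
  unfold assocMetric
  split_ifs with h
  · simp only [map_add, map_smul, metric, LinearMap.add_apply, LinearMap.smul_apply, smul_eq_mul]
    ring
  · simp

theorem assocMetric_combination_right (a b : ℝ) (p q u : TangentSpace 𝓘(ℝ, E) y) :
    assocMetric 𝔤 Ω y u (a • p + b • q) =
      a * assocMetric 𝔤 Ω y u p + b * assocMetric 𝔤 Ω y u q := by
  unfold assocMetric
  split_ifs with h
  · simp only [map_add, map_smul, metric, smul_eq_mul]
    ring
  · simp

/-- The Lie bracket term does not involve `D`; it is reproduced because the weights sum to one. -/
theorem torsionAt_combination {D D' : (∀ x : M, TangentSpace 𝓘(ℝ, E) x) →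
    TangentSpace 𝓘(ℝ, E) y →L[ℝ] TangentSpace 𝓘(ℝ, E) y} {a b : ℝ} (hab : a + b = 1)
    (X Y : ∀ x : M, TangentSpace 𝓘(ℝ, E) x) :
    torsionAt (a • D + b • D') X Y = a • torsionAt D X Y + b • torsionAt D' X Y := by
  simp only [torsionAt, Pi.add_apply, Pi.smul_apply, _root_.add_apply, _root_.smul_apply]
  rw [← eq_sub_iff_add_eq] at hab
  subst hab
  module

variable [IsManifold 𝓘(ℝ, E) ∞ M]

/-- This and the following conditions are affine in `D`. Inhomogeneous terms, such as the derivative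
of `g` in the Leibniz rule, survive because the weights sum to one. -/
theorem convex_derivationsAt (y : M) : Convex ℝ (derivationsAt (E := E) y) := by
  rintro D ⟨h, h'⟩ D' ⟨k, k'⟩ a b - - hab
  refine ⟨fun X Y hX hY => ?_, fun X g hX hg => ?_⟩
  · simp only [Pi.add_apply, Pi.smul_apply, h X Y hX hY, k X Y hX hY]
    module
  · simp only [Pi.add_apply, Pi.smul_apply, h' X g hX hg, k' X g hX hg]
    rw [← eq_sub_iff_add_eq] at hab
    subst hab
    module

theorem convex_preservingAt (Ω : ThreeForm E M) (y : M) : Convex ℝ (preservingAt Ω y) := by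
  rintro D h D' k a b - - hab v u₁ u₂ u₃
  have h1 := h v u₁ u₂ u₃
  have h2 := k v u₁ u₂ u₃
  simp only [covDerivAt, Pi.add_apply, Pi.smul_apply, _root_.add_apply, _root_.smul_apply,
    form_combination₁, form_combination₂, form_combination₃] at h1 h2 ⊢
  linear_combination a * h1 + b * h2 - (mvfderiv 𝓘(ℝ, E) (fun y => Ω y
    ![FiberBundle.extend E u₁ y, FiberBundle.extend E u₂ y, FiberBundle.extend E u₃ y]) y v) * hab

theorem convex_torsionFreeAt (y : M) : Convex ℝ (torsionFreeAt (E := E) y) := by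
  rintro D h D' k a b - - hab X Y hX hY
  rw [torsionAt_combination hab, h X Y hX hY, k X Y hX hY, smul_zero, smul_zero, add_zero]

theorem convex_skewTorsionAt (Ω : ThreeForm E M) (y : M) : Convex ℝ (skewTorsionAt 𝔤 Ω y) := by
  rintro D h D' k a b - - hab u v w
  rw [torsionAt_combination hab, torsionAt_combination hab, assocMetric_combination_left,
    assocMetric_combination_left, h u v w, k u v w]
  ring

theorem convex_metricAt (Ω : ThreeForm E M) (y : M) : Convex ℝ (metricAt 𝔤 Ω y) := by
  rintro D h D' k a b - - hab X Y hX hY v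
  simp only [Pi.add_apply, Pi.smul_apply, _root_.add_apply, _root_.smul_apply,
    assocMetric_combination_left, assocMetric_combination_right]
  linear_combination a * h X Y hX hY v + b * k X Y hX hY v -
    (mvfderiv 𝓘(ℝ, E) (fun y => assocMetric 𝔤 Ω y (X y) (Y y)) y v) * hab

end Convexity

/-! ### Connections on a chart domain from Christoffel symbols. -/

section LocalConnections

variable {E : Type*} [NormedAddCommGroup E] [NormedSpace ℝ E]
  {M : Type*} [TopologicalSpace M] [ChartedSpace E M] [IsManifold 𝓘(ℝ, E) ∞ M]
  {x₀ : M} {z : E}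

/-- The connection on a chart domain with Christoffel symbols `Γ`. -/
def localConnection (x₀ : M) (Γ : E → E →L[ℝ] E →L[ℝ] E) (X : ∀ x : M, TangentSpace 𝓘(ℝ, E) x)
    (y : M) : TangentSpace 𝓘(ℝ, E) y →L[ℝ] TangentSpace 𝓘(ℝ, E) y :=
  chartFrame x₀ y ∘L (fderiv ℝ (chartRead x₀ X) (extChartAt 𝓘(ℝ, E) x₀ y) +
    (Γ (extChartAt 𝓘(ℝ, E) x₀ y)).flip (chartCoframe x₀ y (X y))) ∘L chartCoframe x₀ y

theorem represents_localConnection (Γ : E → E →L[ℝ] E →L[ℝ] E)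
    (hz : z ∈ (extChartAt 𝓘(ℝ, E) x₀).target) :
    Represents x₀ z
      (fun X => localConnection x₀ Γ X ((extChartAt 𝓘(ℝ, E) x₀).symm z)) (Γ z) := by
  intro X _ w
  simp only [localConnection, ContinuousLinearMap.comp_apply, _root_.add_apply,
    ContinuousLinearMap.flip_apply, chartCoframe_chartFrame (symm_mem_source hz),
    (extChartAt 𝓘(ℝ, E) x₀).right_inv hz]
  rfl

theorem chartRead_add (X Y : ∀ x : M, TangentSpace 𝓘(ℝ, E) x) :
    chartRead x₀ (X + Y) = chartRead x₀ X + chartRead x₀ Y :=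
  funext fun _ => map_add _ _ _

theorem chartRead_smul (g : M → ℝ) (X : ∀ x : M, TangentSpace 𝓘(ℝ, E) x) :
    chartRead x₀ (g • X) = fun z => g ((extChartAt 𝓘(ℝ, E) x₀).symm z) • chartRead x₀ X z :=
  funext fun _ => map_smul _ _ _

theorem chartCoframe_ext (hz : z ∈ (extChartAt 𝓘(ℝ, E) x₀).target)
    {L L' : TangentSpace 𝓘(ℝ, E) ((extChartAt 𝓘(ℝ, E) x₀).symm z) →L[ℝ]
      TangentSpace 𝓘(ℝ, E) ((extChartAt 𝓘(ℝ, E) x₀).symm z)}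
    (h : ∀ w, chartCoframe x₀ _ (L (chartFrame x₀ _ w)) =
      chartCoframe x₀ _ (L' (chartFrame x₀ _ w))) : L = L' := by
  ext v
  obtain ⟨w, rfl⟩ := exists_chartFrame hz v
  exact (chartEquiv x₀ _ (symm_mem_source hz)).injective (h w)

theorem Represents.mem_derivationsAt {D : (∀ x : M, TangentSpace 𝓘(ℝ, E) x) →
    TangentSpace 𝓘(ℝ, E) ((extChartAt 𝓘(ℝ, E) x₀).symm z) →L[ℝ]
      TangentSpace 𝓘(ℝ, E) ((extChartAt 𝓘(ℝ, E) x₀).symm z)}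
    {Γ : E →L[ℝ] E →L[ℝ] E} (hD : Represents x₀ z D Γ)
    (hz : z ∈ (extChartAt 𝓘(ℝ, E) x₀).target) : D ∈ derivationsAt _ := by
  refine ⟨fun X Y hX hY => chartCoframe_ext hz fun w => ?_,
    fun X g hX hg => chartCoframe_ext hz fun w => ?_⟩
  · rw [hD _ (mdifferentiableAt_add_section hX hY), _root_.add_apply, map_add, hD X hX, hD Y hY,
      chartRead_add, fderiv_add (differentiableAt_chartRead hz hX)
        (differentiableAt_chartRead hz hY), _root_.add_apply, Pi.add_apply, map_add]
    abel
  · have hg' : DifferentiableAt ℝ (fun z => g ((extChartAt 𝓘(ℝ, E) x₀).symm z)) z :=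
      (hg.comp z ((contMDiffAt_chart_symm hz).mdifferentiableAt (by simp))).differentiableAt
    rw [hD _ (hg.smul_section hX), chartRead_smul,
      fderiv_fun_smul hg' (differentiableAt_chartRead hz hX)]
    simp only [_root_.add_apply, _root_.smul_apply, ContinuousLinearMap.smulRight_apply, map_add,
      map_smul, hD X hX, mvfderiv_chartFrame hz hg]
    rw [chartRead]
    module

end LocalConnections
end CartanGeometry
end

open scoped Manifold ContDiff
noncomputable section
namespace CartanGeometry
open Filter Topology VectorField

/-! ### Gluing local connections by a partition of unity. -/

section Gluing

variable {E : Type*} [NormedAddCommGroup E] [NormedSpace ℝ E]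
  {M : Type*} [TopologicalSpace M] [ChartedSpace E M] [IsManifold 𝓘(ℝ, E) ∞ M]
  {x₀ : M} {z : E}

/-- On the chart domain the difference from the flat connection of the chart is tensorial; it
supplies the symbols. -/
theorem exists_represents [FiniteDimensional ℝ E] (cov : AffineConnection E M)
    (hz : z ∈ (extChartAt 𝓘(ℝ, E) x₀).target) :
    ∃ Γ : E →L[ℝ] E →L[ℝ] E,
      Represents x₀ z (fun X => cov X ((extChartAt 𝓘(ℝ, E) x₀).symm z)) Γ := by
  have hflat : IsCovariantDerivativeOn E (localConnection (E := E) x₀ 0)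
      (extChartAt 𝓘(ℝ, E) x₀).source := by
    have h {y : M} (hy : y ∈ (extChartAt 𝓘(ℝ, E) x₀).source) :
        (fun X => localConnection (E := E) x₀ 0 X y) ∈ derivationsAt (E := E) y := by
      obtain ⟨z, hz, rfl⟩ : ∃ z ∈ (extChartAt 𝓘(ℝ, E) x₀).target,
          y = (extChartAt 𝓘(ℝ, E) x₀).symm z :=
        ⟨_, (extChartAt 𝓘(ℝ, E) x₀).map_source hy, ((extChartAt 𝓘(ℝ, E) x₀).left_inv hy).symm⟩
      exact (represents_localConnection 0 hz).mem_derivationsAt hz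
    exact ⟨fun hX hY hx => (h hx).1 _ _ hX hY, fun hX hg hx => (h hx).2 _ _ hX hg⟩
  have hcov : IsCovariantDerivativeOn E cov (extChartAt 𝓘(ℝ, E) x₀).source :=
    cov.isCovariantDerivativeOn
  let A := IsCovariantDerivativeOn.difference hcov hflat ((extChartAt 𝓘(ℝ, E) x₀).symm z)
  refine ⟨toCLM₂ E E (LinearMap.mk₂ ℝ
    (fun w u => chartCoframe x₀ _ (A (chartFrame x₀ _ u) (chartFrame x₀ _ w)))
    (by intros; simp only [map_add]) (by intros; simp only [map_smul])
    (by intros; simp only [map_add, _root_.add_apply])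
    (by intros; simp only [map_smul, _root_.smul_apply])), fun X hX w => ?_⟩
  have h := IsCovariantDerivativeOn.difference_apply hcov hflat (symm_mem_source hz) hX
  have h0 := represents_localConnection 0 hz X hX w
  have e : cov X ((extChartAt 𝓘(ℝ, E) x₀).symm z) =
      localConnection x₀ 0 X ((extChartAt 𝓘(ℝ, E) x₀).symm z) +
        A (X ((extChartAt 𝓘(ℝ, E) x₀).symm z)) := by
    rw [h]; abel
  simp only [toCLM₂_apply, LinearMap.mk₂_apply]
  rw [e, _root_.add_apply, map_add, h0]
  simp only [chartRead, chartFrame_chartCoframe (symm_mem_source hz)]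
  simp

theorem contMDiffOn_localConnection {Γ : E → E →L[ℝ] E →L[ℝ] E} [FiniteDimensional ℝ E] {W : Set M}
    (hW : IsOpen W) (hs : W ⊆ (extChartAt 𝓘(ℝ, E) x₀).source)
    (hΓ : ∀ y ∈ W, ContDiffAt ℝ ∞ Γ (extChartAt 𝓘(ℝ, E) x₀ y)) :
    ContMDiffCovariantDerivativeOn E ∞ (localConnection x₀ Γ) W := by
  refine ⟨fun {X} hX y hy => ContMDiffAt.contMDiffWithinAt ?_⟩
  let e := trivializationAt (E →L[ℝ] E)
    (fun y : M => TangentSpace 𝓘(ℝ, E) y →L[ℝ] TangentSpace 𝓘(ℝ, E) y) x₀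
  have hb : y ∈ e.baseSet := by
    have := mem_baseSet_iff.2 (hs hy)
    exact ⟨this, this⟩
  rw [e.contMDiffAt_section_iff hb]
  have hX' : ContMDiffAt 𝓘(ℝ, E) (𝓘(ℝ, E).prod 𝓘(ℝ, E)) ∞ (T% X)
      ((extChartAt 𝓘(ℝ, E) x₀).symm (extChartAt 𝓘(ℝ, E) x₀ y)) := by
    rw [(extChartAt 𝓘(ℝ, E) x₀).left_inv (hs hy)]
    exact (hX.contMDiffAt (hW.mem_nhds hy)).of_le le_self_add
  have hr := contDiffAt_chartRead ((extChartAt 𝓘(ℝ, E) x₀).map_source (hs hy)) hX'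
  have hF : ContDiffAt ℝ ∞ (fun z => fderiv ℝ (chartRead x₀ X) z + (Γ z).flip (chartRead x₀ X z))
      (extChartAt 𝓘(ℝ, E) x₀ y) := by
    refine (hr.fderiv_right (by simp)).add ?_
    exact ((ContinuousLinearMap.flipₗᵢ ℝ E E E).contDiff.contDiffAt.comp _ (hΓ y hy)).clm_apply hr
  have hM := hF.contMDiffAt.comp y (contMDiffAt_chart (hs hy))
  refine hM.congr_of_eventuallyEq ?_
  filter_upwards [hW.mem_nhds hy] with y' hy'
  have hy'' := hs hy'
  rw [hom_trivializationAt_apply]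
  ext w
  simp only [ContinuousLinearMap.inCoordinates]
  change chartCoframe x₀ y' (localConnection x₀ Γ X y' (chartFrame x₀ y' w)) = _
  simp only [localConnection, ContinuousLinearMap.comp_apply, _root_.add_apply,
    ContinuousLinearMap.flip_apply, chartCoframe_chartFrame hy'', Function.comp_apply]
  congr 2
  have h (y₁ : M) (h : y₁ = y') : chartCoframe x₀ y' (X y') = chartCoframe x₀ y₁ (X y₁) := by rw [h]
  exact h _ ((extChartAt 𝓘(ℝ, E) x₀).left_inv hy'')

variable [FiniteDimensional ℝ E] [T2Space M] [SecondCountableTopology M]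

/-- A smooth affine connection with a convex pointwise property exists as soon as it exists in
charts. -/
theorem exists_affineConnection
    (P : ∀ y : M, Set ((∀ x : M, TangentSpace 𝓘(ℝ, E) x) →
      TangentSpace 𝓘(ℝ, E) y →L[ℝ] TangentSpace 𝓘(ℝ, E) y))
    (hP : ∀ y, Convex ℝ (P y))
    (hloc : ∀ x₀ : M, ∃ Γ : E → E →L[ℝ] E →L[ℝ] E, ∀ᶠ z in 𝓝 (extChartAt 𝓘(ℝ, E) x₀ x₀),
      ContDiffAt ℝ ∞ Γ z ∧ ∀ D, Represents x₀ z D (Γ z) → D ∈ P ((extChartAt 𝓘(ℝ, E) x₀).symm z)) :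
    ∃ cov : AffineConnection E M, cov.ContMDiffCovariantDerivative ∞ ∧
      ∀ y, (fun X => cov X y) ∈ P y := by
  choose Γ hΓ using hloc
  have hnhds (x₀ : M) : ∃ U : Set M, U ⊆ (extChartAt 𝓘(ℝ, E) x₀).source ∧ (∀ y ∈ U,
      ContDiffAt ℝ ∞ (Γ x₀) (extChartAt 𝓘(ℝ, E) x₀ y) ∧
      (fun X => localConnection x₀ (Γ x₀) X y) ∈ P y ∩ derivationsAt y) ∧ IsOpen U ∧ x₀ ∈ U := by
    have h1 := (continuousAt_extChartAt (I := 𝓘(ℝ, E)) x₀).eventually (hΓ x₀)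
    have h2 := h1.and (extChartAt_source_mem_nhds (I := 𝓘(ℝ, E)) x₀)
    obtain ⟨U, hU, ho, hx⟩ := eventually_nhds_iff.1 h2
    refine ⟨U, fun y hy => (hU y hy).2, fun y hy => ⟨(hU y hy).1.1, ?_⟩, ho, hx⟩
    obtain ⟨⟨-, h3⟩, h4⟩ := hU y hy
    obtain ⟨z, hz, rfl⟩ : ∃ z ∈ (extChartAt 𝓘(ℝ, E) x₀).target,
        y = (extChartAt 𝓘(ℝ, E) x₀).symm z :=
      ⟨_, (extChartAt 𝓘(ℝ, E) x₀).map_source h4, ((extChartAt 𝓘(ℝ, E) x₀).left_inv h4).symm⟩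
    rw [(extChartAt 𝓘(ℝ, E) x₀).right_inv hz] at h3
    have h5 := represents_localConnection (Γ x₀) hz
    exact ⟨h3 _ h5, h5.mem_derivationsAt hz⟩
  choose U hUs hUP hUo hxU using hnhds
  have : LocallyCompactSpace M := ChartedSpace.locallyCompactSpace E M
  -- Each local connection is junk outside its chart domain; subordination of `ρ` ensures that it is
  -- only used where it is valid.
  obtain ⟨ρ, hρ⟩ := SmoothPartitionOfUnity.exists_isSubordinate 𝓘(ℝ, E) isClosed_univ U hUo
    (fun x _ => Set.mem_iUnion_of_mem x (hxU x))
  let cov : (∀ x : M, TangentSpace 𝓘(ℝ, E) x) →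
      ∀ x : M, TangentSpace 𝓘(ℝ, E) x →L[ℝ] TangentSpace 𝓘(ℝ, E) x :=
    fun X y => ∑ᶠ i, ρ i y • localConnection i (Γ i) X y
  have hcov (y : M) : (fun X => cov X y) =
      ∑ᶠ i, ρ i y • fun X => localConnection (E := E) i (Γ i) X y := by
    ext1 X
    have hfin : (Function.support fun i => ρ i y • fun X => localConnection (E := E) i (Γ i) X y).Finite :=
      (ρ.locallyFinite.point_finite y).subset fun i hi => left_ne_zero_of_smul hi
    exact ((Pi.evalAddMonoidHom _ X).map_finsum hfin).symm
  -- The glued operator at `y` is a convex combination of admissible ones. Including the derivation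
  -- property in the convex set also makes the result a covariant derivative.
  have hmem (y : M) : (fun X => cov X y) ∈ P y ∩ derivationsAt y := by
    rw [hcov]
    refine ((hP y).inter (convex_derivationsAt y)).finsum_mem (fun i => ρ.nonneg i y)
      (ρ.sum_eq_one (Set.mem_univ y)) fun i hi => (hUP i y (hρ i (subset_tsupport _ hi))).2
  refine ⟨⟨cov, ⟨fun hX hY _ => (hmem _).2.1 _ _ hX hY, fun hX hg _ => (hmem _).2.2 _ _ hX hg⟩⟩,
    ⟨⟨fun {X} hX => ?_⟩⟩, fun y => (hmem y).1⟩
  refine ContMDiff.contMDiffOn (ContMDiff.finsum_section_of_locallyFinite ?_ fun i => ?_)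
  · exact ρ.locallyFinite.subset fun i x hx => left_ne_zero_of_smul hx
  · refine ContMDiffOn.smul_section_of_tsupport (ρ i).contMDiff.contMDiffOn (hUo i) (hρ i) ?_
    exact (contMDiffOn_localConnection (hUo i) (hUs i) fun y hy => (hUP i y hy).1).contMDiff
      (hX.mono (Set.subset_univ _))

end Gluing
end CartanGeometry
end

open scoped Manifold ContDiff
noncomputable section
namespace CartanGeometry
open Filter Topology VectorField

/-! ### Torsion tensors and global existence of the connections. -/

section Connections

variable {E : Type*} [NormedAddCommGroup E] [NormedSpace ℝ E]
  {M : Type*} [TopologicalSpace M] [ChartedSpace E M]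
  {𝔤 : Type*} [LieRing 𝔤] [LieAlgebra ℝ 𝔤] {Ω : ThreeForm E M}

variable (E) in
/-- Every point is the image of a point of a chart target. -/
theorem exists_chart_symm_eq (y : M) :
    ∃ (x₀ : M) (z : E), z ∈ (extChartAt 𝓘(ℝ, E) x₀).target ∧ (extChartAt 𝓘(ℝ, E) x₀).symm z = y :=
  ⟨y, extChartAt 𝓘(ℝ, E) y y, mem_extChartAt_target y, extChartAt_to_inv y⟩

variable [IsManifold 𝓘(ℝ, E) ∞ M] {cov lc : AffineConnection E M}

theorem isAutConnection_iff : IsAutConnection Ω cov ↔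
    cov.ContMDiffCovariantDerivative ∞ ∧ ∀ y, (fun X => cov X y) ∈ preservingAt Ω y := Iff.rfl

variable [FiniteDimensional ℝ E]

theorem hasSkewTorsion_iff : HasSkewTorsion 𝔤 Ω cov ↔
    ∀ y, (fun X => cov X y) ∈ skewTorsionAt 𝔤 Ω y := by
  have h (y : M) (u v : TangentSpace 𝓘(ℝ, E) y) : cov.torsion y u v =
      torsionAt (fun X => cov X y) (FiberBundle.extend E u) (FiberBundle.extend E v) :=
    cov.torsion_apply_eq_extend u v
  simp only [HasSkewTorsion, h]
  rfl

theorem isLeviCivita_iff : IsLeviCivita 𝔤 Ω cov ↔ cov.ContMDiffCovariantDerivative ∞ ∧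
    ∀ y, (fun X => cov X y) ∈ torsionFreeAt y ∩ metricAt 𝔤 Ω y := by
  rw [IsLeviCivita, cov.torsion_eq_zero_iff]
  constructor
  · rintro ⟨h1, h2, h3⟩
    exact ⟨h1, fun y => ⟨fun X Y hX hY => sub_eq_zero.2 (h2 hX hY),
      fun X Y hX hY v => h3 X Y y v hX hY⟩⟩
  · rintro ⟨h1, h2⟩
    exact ⟨h1, fun hX hY => sub_eq_zero.1 ((h2 _).1 _ _ hX hY),
      fun X Y y v hX hY => (h2 y).2 X Y hX hY v⟩

theorem torsionTensor_apply {x₀ : M} {z : E} (hz : z ∈ (extChartAt 𝓘(ℝ, E) x₀).target)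
    {Γ Γ' : E →L[ℝ] E →L[ℝ] E}
    (hΓ : Represents x₀ z (fun X => lc X ((extChartAt 𝓘(ℝ, E) x₀).symm z)) Γ)
    (hΓ' : Represents x₀ z (fun X => cov X ((extChartAt 𝓘(ℝ, E) x₀).symm z)) Γ')
    (I : TangentSpace 𝓘(ℝ, E) ((extChartAt 𝓘(ℝ, E) x₀).symm z) ≃ₗ[ℝ] 𝔤) :
    torsionTensor lc cov _ I = pushBilin (modelFrame hz I) (Γ' - Γ) := by
  refine LinearMap.ext fun a => LinearMap.ext fun b => ?_
  change I (cov.difference lc _ (I.symm b) (I.symm a)) = _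
  rw [pushBilin_apply, modelFrame_symm_apply, modelFrame_symm_apply]
  generalize I.symm a = v
  generalize I.symm b = u
  have hX := mdifferentiableAt_extend_vectorField u
  have h := IsCovariantDerivativeOn.difference_apply cov.isCovariantDerivativeOnUniv
    lc.isCovariantDerivativeOnUniv (Set.mem_univ _) hX
  rw [FiberBundle.extend_apply_self] at h
  rw [CovariantDerivative.difference, h, ← modelFrame_chartCoframe hz]
  obtain ⟨v, rfl⟩ := exists_chartFrame hz v
  have h1 := hΓ _ hX v
  have h2 := hΓ' _ hX v
  rw [chartRead_extend] at h1 h2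
  rw [_root_.sub_apply, map_sub, h1, h2, chartCoframe_chartFrame (symm_mem_source hz)]
  simp

/-- The covariant derivative of `Ω` in terms of the torsion tensor of a connection preserving
`Ω`. -/
theorem covDerivForm_eq_rhoCartan (hΩ : IsOfCartanType 𝔤 Ω) (hcov : IsAutConnection Ω cov) {x : M}
    {I : TangentSpace 𝓘(ℝ, E) x ≃ₗ[ℝ] 𝔤} (hI : IsAdapted Ω x I)
    (v u₁ u₂ u₃ : TangentSpace 𝓘(ℝ, E) x) :
    covDerivForm lc Ω x v u₁ u₂ u₃ =
      -rhoCartan (torsionTensor lc cov x I (I v)) (I u₁) (I u₂) (I u₃) := by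
  obtain ⟨x₀, z, hz, rfl⟩ := exists_chart_symm_eq E x
  obtain ⟨Γ, hΓ⟩ := exists_represents lc hz
  obtain ⟨Γ', hΓ'⟩ := exists_represents cov hz
  have h1 := (mem_preservingAt_iff hz (hΩ.differentiableAt hz) hΓ').1 (hcov.2 _)
  have hJ := hI.modelFrame hz
  have h2 := covDerivAt_eq hz (hΩ.differentiableAt hz) hΓ v u₁ u₂ u₃
  refine h2.trans ?_
  -- Since `cov` preserves Ω, the derivative of Ω in the chart is the action of `Γ'`; subtracting
  -- the action of `Γ` leaves that of the difference tensor.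
  rw [h1, torsionTensor_apply hz hΓ hΓ', rhoCartan, ← modelFrame_chartCoframe hz,
    ← modelFrame_chartCoframe hz, ← modelFrame_chartCoframe hz, ← modelFrame_chartCoframe hz]
  simp only [pushBilin_apply, LinearEquiv.symm_apply_apply]
  rw [← hJ, ← hJ, ← hJ]
  simp only [formAction, ← tri_apply, _root_.sub_apply, map_sub, LinearMap.sub_apply]
  ring

variable [Module.Finite ℝ 𝔤] [LieAlgebra.IsSimple ℝ 𝔤]

/-- The torsion tensor of a connection preserving `Ω` is metric-skew. -/
theorem torsionTensor_skew (hΩ : IsOfCartanType 𝔤 Ω) (hc : IsCompactType 𝔤)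
    (hdim : 3 < Module.finrank ℝ 𝔤) (hlc : IsLeviCivita 𝔤 Ω lc) (hcov : IsAutConnection Ω cov)
    {x : M} {I : TangentSpace 𝓘(ℝ, E) x ≃ₗ[ℝ] 𝔤} (hI : IsAdapted Ω x I) (a b c : 𝔤) :
    metric (torsionTensor lc cov x I a b) c = -metric b (torsionTensor lc cov x I a c) := by
  obtain ⟨x₀, z, hz, rfl⟩ := exists_chart_symm_eq E x
  obtain ⟨Γ, hΓ⟩ := exists_represents lc hz
  obtain ⟨Γ', hΓ'⟩ := exists_represents cov hz
  have h1 := (mem_preservingAt_iff hz (hΩ.differentiableAt hz) hΓ').1 (hcov.2 _)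
  have h2 := (mem_metricAt_iff hΩ hc hdim hz hΓ).1 ((isLeviCivita_iff.1 hlc).2 _).2
  have hJ := hI.modelFrame hz
  -- The metric is built from the form, so `cov` is a metric connection as well; the difference of
  -- two metric connections is skew.
  have h3 := (hΩ.isCartanOn x₀).fderiv_formMetric_eq hc hdim hz
    (h1 ((modelFrame hz I).symm a)) ((modelFrame hz I).symm b) ((modelFrame hz I).symm c)
  rw [h2] at h3
  simp only [formMetric_eq hc hdim hJ, LinearEquiv.apply_symm_apply] at h3
  rw [torsionTensor_apply hz hΓ hΓ']
  simp only [pushBilin_apply, _root_.sub_apply, map_sub, metric_sub_left, metric_sub_right]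
  linarith

/-- As `lc` is torsion-free, the torsion of `cov` is the antisymmetrization of the difference
tensor. -/
theorem torsionTensor_mem_skewTensors (hΩ : IsOfCartanType 𝔤 Ω) (hc : IsCompactType 𝔤)
    (hdim : 3 < Module.finrank ℝ 𝔤) (hlc : IsLeviCivita 𝔤 Ω lc) (hcov : IsAutConnection Ω cov)
    (hskew : HasSkewTorsion 𝔤 Ω cov)
    {x : M} {I : TangentSpace 𝓘(ℝ, E) x ≃ₗ[ℝ] 𝔤} (hI : IsAdapted Ω x I) :
    torsionTensor lc cov x I ∈ skewTensors 𝔤 := by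
  refine skewTensors_of_skew_torsion hc (torsionTensor_skew hΩ hc hdim hlc hcov hI) ?_
  obtain ⟨x₀, z, hz, rfl⟩ := exists_chart_symm_eq E x
  obtain ⟨Γ, hΓ⟩ := exists_represents lc hz
  obtain ⟨Γ', hΓ'⟩ := exists_represents cov hz
  have h1 := (mem_torsionFreeAt_iff hz hΓ).1 ((isLeviCivita_iff.1 hlc).2 _).1
  have h2 := (mem_skewTorsionAt_iff hΩ hc hdim hz hΓ').1 (hasSkewTorsion_iff.1 hskew _)
  have hJ := hI.modelFrame hz
  intro u v w
  have h3 := h2 ((modelFrame hz I).symm u) ((modelFrame hz I).symm v) ((modelFrame hz I).symm w)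
  rw [torsionTensor_apply hz hΓ hΓ']
  simp only [formMetric_eq hc hdim hJ, LinearEquiv.apply_symm_apply] at h3
  simp only [pushBilin_apply, _root_.sub_apply, map_sub]
  rw [h1 ((modelFrame hz I).symm v) ((modelFrame hz I).symm u),
    h1 ((modelFrame hz I).symm w) ((modelFrame hz I).symm u)]
  simpa only [map_sub, sub_sub_sub_cancel_right] using h3

variable [T2Space M] [SecondCountableTopology M]

theorem exists_isAutConnection (hΩ : IsOfCartanType 𝔤 Ω) (hc : IsCompactType 𝔤)
    (hdim : 3 < Module.finrank ℝ 𝔤) : ∃ cov : AffineConnection E M, IsAutConnection Ω cov := by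
  refine exists_affineConnection (preservingAt Ω) (convex_preservingAt Ω) fun x₀ => ?_
  have h := hΩ.isCartanOn x₀
  have hz := mem_extChartAt_target (I := 𝓘(ℝ, E)) x₀
  obtain ⟨X, hX⟩ := h.exists_local_preservesForm hc hdim hz
  refine ⟨X, ?_⟩
  filter_upwards [hX, target_mem_nhds hz] with z hz hzt
  exact ⟨hz.1, fun D hD => (mem_preservingAt_iff hzt (hΩ.differentiableAt hzt) hD).2 hz.2⟩

theorem exists_isLeviCivita (hΩ : IsOfCartanType 𝔤 Ω) (hc : IsCompactType 𝔤)
    (hdim : 3 < Module.finrank ℝ 𝔤) : ∃ lc : AffineConnection E M, IsLeviCivita 𝔤 Ω lc := by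
  simp only [isLeviCivita_iff]
  refine exists_affineConnection (fun y => torsionFreeAt y ∩ metricAt 𝔤 Ω y)
    (fun y => (convex_torsionFreeAt y).inter (convex_metricAt Ω y)) fun x₀ => ?_
  have h := hΩ.isCartanOn x₀
  have hz := mem_extChartAt_target (I := 𝓘(ℝ, E)) x₀
  obtain ⟨X, hX⟩ := h.exists_local_preservesMetric hc hdim hz
  refine ⟨X, ?_⟩
  filter_upwards [hX, target_mem_nhds hz] with z hz hzt
  exact ⟨hz.1, fun D hD => ⟨(mem_torsionFreeAt_iff hzt hD).2 hz.2.2,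
    (mem_metricAt_iff hΩ hc hdim hzt hD).2 hz.2.1⟩⟩

theorem exists_isAutConnection_hasSkewTorsion (hΩ : IsOfCartanType 𝔤 Ω) (hc : IsCompactType 𝔤)
    (hdim : 3 < Module.finrank ℝ 𝔤)
    (hs : ∀ (x₀ : M), ∀ z ∈ (extChartAt 𝓘(ℝ, E) x₀).target, ∃ Γ : E →L[ℝ] E →L[ℝ] E,
      PreservesForm (Ω.inChart x₀) z Γ ∧ HasSkewTorsionForm 𝔤 (Ω.inChart x₀ z) Γ) :
    ∃ cov : AffineConnection E M, IsAutConnection Ω cov ∧ HasSkewTorsion 𝔤 Ω cov := by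
  obtain ⟨cov, h1, h2⟩ := exists_affineConnection
    (fun y => preservingAt Ω y ∩ skewTorsionAt 𝔤 Ω y)
    (fun y => (convex_preservingAt Ω y).inter (convex_skewTorsionAt Ω y)) fun x₀ => by
      have h := hΩ.isCartanOn x₀
      have hz := mem_extChartAt_target (I := 𝓘(ℝ, E)) x₀
      obtain ⟨X, hX⟩ := h.exists_local_skew hc hdim hz (hs x₀)
      refine ⟨X, ?_⟩
      filter_upwards [hX, target_mem_nhds hz] with z hz hzt
      exact ⟨hz.1, fun D hD => ⟨(mem_preservingAt_iff hzt (hΩ.differentiableAt hzt) hD).2 hz.2.1,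
        (mem_skewTorsionAt_iff hΩ hc hdim hzt hD).2 hz.2.2⟩⟩
  exact ⟨cov, isAutConnection_iff.2 ⟨h1, fun y => (h2 y).1⟩,
    hasSkewTorsion_iff.2 fun y => (h2 y).2⟩

end Connections
end CartanGeometry
end

open scoped Manifold ContDiff
noncomputable section
namespace CartanGeometry
open Filter Topology VectorField

/-! ### `dΩ` and `d^*Ω` in terms of the torsion tensor. -/

section ExteriorDerivative

variable {E : Type*} [NormedAddCommGroup E] [NormedSpace ℝ E]

theorem tri_swap₁₂ (w : E [⋀^Fin 3]→L[ℝ] ℝ) (x y u : E) : tri w x y u = -tri w y x u := by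
  have h := w.toAlternatingMap.map_swap ![y, x, u] (show (0 : Fin 3) ≠ 1 by decide)
  have e : ![y, x, u] ∘ Equiv.swap (0 : Fin 3) 1 = ![x, y, u] := by
    ext i
    fin_cases i <;> simp [Equiv.swap_apply_def]
  rw [e] at h
  exact h

theorem tri_swap₂₃ (w : E [⋀^Fin 3]→L[ℝ] ℝ) (x y u : E) : tri w x y u = -tri w x u y := by
  have h := w.toAlternatingMap.map_swap ![x, u, y] (show (1 : Fin 3) ≠ 2 by decide)
  have e : ![x, u, y] ∘ Equiv.swap (1 : Fin 3) 2 = ![x, y, u] := by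
    ext i
    fin_cases i <;> simp [Equiv.swap_apply_def]
  rw [e] at h
  exact h

theorem extDeriv_apply_eq {θ : E → E [⋀^Fin 3]→L[ℝ] ℝ} {z : E} (v₀ v₁ v₂ v₃ : E) :
    extDeriv θ z ![v₀, v₁, v₂, v₃] =
      tri (fderiv ℝ θ z v₀) v₁ v₂ v₃ - tri (fderiv ℝ θ z v₁) v₀ v₂ v₃ +
        tri (fderiv ℝ θ z v₂) v₀ v₁ v₃ - tri (fderiv ℝ θ z v₃) v₀ v₁ v₂ := by
  have e0 : (0 : Fin 4).removeNth ![v₀, v₁, v₂, v₃] = ![v₁, v₂, v₃] := by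
    ext i; fin_cases i <;> rfl
  have e1 : (1 : Fin 4).removeNth ![v₀, v₁, v₂, v₃] = ![v₀, v₂, v₃] := by
    ext i; fin_cases i <;> rfl
  have e2 : (2 : Fin 4).removeNth ![v₀, v₁, v₂, v₃] = ![v₀, v₁, v₃] := by
    ext i; fin_cases i <;> rfl
  have e3 : (3 : Fin 4).removeNth ![v₀, v₁, v₂, v₃] = ![v₀, v₁, v₂] := by
    ext i; fin_cases i <;> rfl
  rw [extDeriv, ContinuousAlternatingMap.alternatizeUncurryFin_apply, Fin.sum_univ_four, e0, e1, e2,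
    e3]
  simp [tri_apply]
  ring

variable {M : Type*} [TopologicalSpace M] [ChartedSpace E M] [IsManifold 𝓘(ℝ, E) ∞ M]
  {𝔤 : Type*} [LieRing 𝔤] [LieAlgebra ℝ 𝔤] {Ω : ThreeForm E M} {x₀ : M} {z : E}

/-- In the alternating sum the Christoffel terms cancel in pairs, by symmetry of `Γ` and
antisymmetry of the form. -/
theorem extDeriv_eq_covDerivAt (hz : z ∈ (extChartAt 𝓘(ℝ, E) x₀).target)
    (hΩ : DifferentiableAt ℝ (Ω.inChart x₀) z)
    {D : (∀ x : M, TangentSpace 𝓘(ℝ, E) x) →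
      TangentSpace 𝓘(ℝ, E) ((extChartAt 𝓘(ℝ, E) x₀).symm z) →L[ℝ]
        TangentSpace 𝓘(ℝ, E) ((extChartAt 𝓘(ℝ, E) x₀).symm z)}
    {Γ : E →L[ℝ] E →L[ℝ] E} (hD : Represents x₀ z D Γ) (hs : ∀ u v, Γ u v = Γ v u)
    (v₀ v₁ v₂ v₃ : TangentSpace 𝓘(ℝ, E) ((extChartAt 𝓘(ℝ, E) x₀).symm z)) :
    extDeriv (Ω.inChart x₀) z ![chartCoframe x₀ _ v₀, chartCoframe x₀ _ v₁, chartCoframe x₀ _ v₂,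
        chartCoframe x₀ _ v₃] =
      covDerivAt D Ω v₀ v₁ v₂ v₃ - covDerivAt D Ω v₁ v₀ v₂ v₃ + covDerivAt D Ω v₂ v₀ v₁ v₃ -
        covDerivAt D Ω v₃ v₀ v₁ v₂ := by
  rw [extDeriv_apply_eq, covDerivAt_eq hz hΩ hD, covDerivAt_eq hz hΩ hD, covDerivAt_eq hz hΩ hD,
    covDerivAt_eq hz hΩ hD]
  generalize chartCoframe x₀ _ v₀ = a
  generalize chartCoframe x₀ _ v₁ = b
  generalize chartCoframe x₀ _ v₂ = c
  generalize chartCoframe x₀ _ v₃ = d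
  generalize Ω.inChart x₀ z = w
  simp only [formAction]
  rw [hs b a, hs c a, hs d a, hs c b, hs d b, hs d c, tri_swap₁₂ w (Γ a c) b d,
    tri_swap₁₂ w (Γ a d) b c, tri_swap₂₃ w b (Γ a d) c, tri_swap₂₃ w a (Γ b d) c]
  ring

theorem extDerivAt_eq_zero_iff_extDeriv (Ω : ThreeForm E M) (x : M) :
    Ω.extDerivAt x = 0 ↔ ∀ v₀ v₁ v₂ v₃ : E,
      extDeriv (Ω.inChart x) (extChartAt 𝓘(ℝ, E) x x) ![v₀, v₁, v₂, v₃] = 0 := by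
  -- The derivative of the preferred chart at its own base point is the identity.
  rw [ThreeForm.extDerivAt, mfderiv_extChartAt_self]
  constructor
  · intro h v₀ v₁ v₂ v₃
    exact congrArg (fun f : E [⋀^Fin 4]→L[ℝ] ℝ => f ![v₀, v₁, v₂, v₃]) h
  · intro h
    refine ContinuousAlternatingMap.ext fun v => ?_
    have e : v = ![v 0, v 1, v 2, v 3] := by ext i; fin_cases i <;> rfl
    rw [e]
    exact h (v 0) (v 1) (v 2) (v 3)

variable [FiniteDimensional ℝ E] {lc cov : AffineConnection E M}

theorem extDerivAt_eq_zero_iff (hΩ : IsOfCartanType 𝔤 Ω) (hlc : IsLeviCivita 𝔤 Ω lc) (x : M) :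
    Ω.extDerivAt x = 0 ↔ ∀ v₀ v₁ v₂ v₃ : TangentSpace 𝓘(ℝ, E) x,
      covDerivForm lc Ω x v₀ v₁ v₂ v₃ - covDerivForm lc Ω x v₁ v₀ v₂ v₃ +
        covDerivForm lc Ω x v₂ v₀ v₁ v₃ - covDerivForm lc Ω x v₃ v₀ v₁ v₂ = 0 := by
  -- Stated as a predicate of the point, the claim can be carried from `symm (chart x)` to `x` in
  -- spite of the dependent tangent spaces.
  let Q (y : M) : Prop := ∀ v₀ v₁ v₂ v₃ : TangentSpace 𝓘(ℝ, E) y,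
      covDerivForm lc Ω y v₀ v₁ v₂ v₃ - covDerivForm lc Ω y v₁ v₀ v₂ v₃ +
        covDerivForm lc Ω y v₂ v₀ v₁ v₃ - covDerivForm lc Ω y v₃ v₀ v₁ v₂ = 0
  have hz := mem_extChartAt_target (I := 𝓘(ℝ, E)) x
  obtain ⟨Γ, hΓ⟩ := exists_represents lc hz
  have h1 := (mem_torsionFreeAt_iff hz hΓ).1 ((isLeviCivita_iff.1 hlc).2 _).1
  have h2 := extDeriv_eq_covDerivAt hz (hΩ.differentiableAt hz) hΓ h1
  have h3 : (∀ v₀ v₁ v₂ v₃ : E,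
      extDeriv (Ω.inChart x) (extChartAt 𝓘(ℝ, E) x x) ![v₀, v₁, v₂, v₃] = 0) ↔
      Q ((extChartAt 𝓘(ℝ, E) x).symm (extChartAt 𝓘(ℝ, E) x x)) := by
    constructor
    · intro h v₀ v₁ v₂ v₃
      exact (h2 v₀ v₁ v₂ v₃).symm.trans (h _ _ _ _)
    · intro h v₀ v₁ v₂ v₃
      have h4 := (h2 (chartFrame x _ v₀) (chartFrame x _ v₁) (chartFrame x _ v₂)
        (chartFrame x _ v₃)).trans (h _ _ _ _)
      simpa only [chartCoframe_chartFrame (symm_mem_source hz)] using h4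
  rw [extDerivAt_eq_zero_iff_extDeriv, h3, extChartAt_to_inv]

theorem extDerivAt_eq_zero_iff_dPlus (hΩ : IsOfCartanType 𝔤 Ω) (hlc : IsLeviCivita 𝔤 Ω lc)
    (hcov : IsAutConnection Ω cov) {x : M} {I : TangentSpace 𝓘(ℝ, E) x ≃ₗ[ℝ] 𝔤}
    (hI : IsAdapted Ω x I) :
    Ω.extDerivAt x = 0 ↔ ∀ a b c d, dPlus (torsionTensor lc cov x I) a b c d = 0 := by
  rw [extDerivAt_eq_zero_iff hΩ hlc]
  simp only [covDerivForm_eq_rhoCartan hΩ hcov hI, dPlus]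
  constructor
  · intro h a b c d
    have := h (I.symm a) (I.symm b) (I.symm c) (I.symm d)
    simp only [LinearEquiv.apply_symm_apply] at this
    linarith
  · intro h v₀ v₁ v₂ v₃
    linarith [h (I v₀) (I v₁) (I v₂) (I v₃)]

variable [Module.Finite ℝ 𝔤] [LieAlgebra.IsSimple ℝ 𝔤]

theorem assocMetric_eq (hΩ : IsOfCartanType 𝔤 Ω) (hc : IsCompactType 𝔤)
    (hdim : 3 < Module.finrank ℝ 𝔤) {x : M} {I : TangentSpace 𝓘(ℝ, E) x ≃ₗ[ℝ] 𝔤}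
    (hI : IsAdapted Ω x I) (u v : TangentSpace 𝓘(ℝ, E) x) :
    assocMetric 𝔤 Ω x u v = metric (I u) (I v) := by
  obtain ⟨x₀, z, hz, rfl⟩ := exists_chart_symm_eq E x
  rw [assocMetric_eq_formMetric hΩ hc hdim hz, formMetric_eq hc hdim (hI.modelFrame hz),
    modelFrame_chartCoframe, modelFrame_chartCoframe]

/-- An adapted frame matches orthonormal bases of the tangent space with those of 𝔤, after a
reindexing by equality of dimensions. The sign in `d^*` cancels the one in
`covDerivForm_eq_rhoCartan`. -/
theorem isCoclosedAt_iff_dMinus (hΩ : IsOfCartanType 𝔤 Ω) (hc : IsCompactType 𝔤)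
    (hdim : 3 < Module.finrank ℝ 𝔤) (hcov : IsAutConnection Ω cov)
    {x : M} {I : TangentSpace 𝓘(ℝ, E) x ≃ₗ[ℝ] 𝔤} (hI : IsAdapted Ω x I) :
    IsCoclosedAt 𝔤 lc Ω x ↔ ∀ e : Module.Basis (Fin (Module.finrank ℝ 𝔤)) ℝ 𝔤,
      (∀ i j, metric (e i) (e j) = if i = j then 1 else 0) →
        ∀ y z, dMinus e (torsionTensor lc cov x I) y z = 0 := by
  have hdimE : Module.finrank ℝ E = Module.finrank ℝ 𝔤 := I.finrank_eq
  simp only [IsCoclosedAt, covDerivForm_eq_rhoCartan hΩ hcov hI, dMinus,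
    assocMetric_eq hΩ hc hdim hI, Finset.sum_neg_distrib, neg_neg]
  constructor
  · intro h e he y z
    have := h ((e.map I.symm).reindex (finCongr hdimE.symm)) (fun i j => by simp [he])
      (I.symm y) (I.symm z)
    simp only [Module.Basis.reindex_apply, Module.Basis.map_apply, LinearEquiv.apply_symm_apply]
      at this
    rw [← this]
    exact ((finCongr hdimE.symm).symm.sum_comp fun i =>
      rhoCartan (torsionTensor lc cov x I (e i)) (e i) y z).symm
  · intro h e he v w
    have := h ((e.map I).reindex (finCongr hdimE)) (fun i j => by simp [he]) (I v) (I w)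
    simp only [Module.Basis.reindex_apply, Module.Basis.map_apply] at this
    rw [← this]
    exact ((finCongr hdimE).symm.sum_comp fun i =>
      rhoCartan (torsionTensor lc cov x I (I (e i))) (I (e i)) (I v) (I w)).symm

end ExteriorDerivative
end CartanGeometry
end

open scoped Manifold ContDiff
noncomputable section
namespace CartanGeometry
open Filter Topology VectorField

/-! ### The intrinsic torsion and its geometric meaning. -/

section IntrinsicTorsion

theorem formAction_eq_neg_rhoCartan {E : Type*} [NormedAddCommGroup E] [NormedSpace ℝ E]
    {𝔤 : Type*} [LieRing 𝔤] [LieAlgebra ℝ 𝔤] {w : E [⋀^Fin 3]→L[ℝ] ℝ} {J : E ≃ₗ[ℝ] 𝔤}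
    (hJ : IsAdaptedForm w J) {γ : E →L[ℝ] E} {τ : 𝔤 →ₗ[ℝ] 𝔤} (h : ∀ y, J (γ y) = τ (J y))
    (x y u : E) : formAction w γ x y u = -rhoCartan τ (J x) (J y) (J u) := by
  simp only [formAction, tri_apply, rhoCartan, neg_neg]
  rw [hJ, hJ, hJ, h, h, h]

section Algebra

variable {𝔤 : Type*} [LieRing 𝔤] [LieAlgebra ℝ 𝔤] [Module.Finite ℝ 𝔤] [LieAlgebra.IsKilling ℝ 𝔤]

theorem dPlus_projPerp_comp (η : 𝔤 →ₗ[ℝ] 𝔤 →ₗ[ℝ] 𝔤) (a b c d : 𝔤) :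
    dPlus (projPerp ∘ₗ η) a b c d = dPlus η a b c d := by
  rw [← dPlus_add_adComp _ (adPart ∘ₗ η), projPerp_comp_eq]

theorem dMinus_projPerp_comp {ι : Type*} [Fintype ι] (e : Module.Basis ι ℝ 𝔤)
    (η : 𝔤 →ₗ[ℝ] 𝔤 →ₗ[ℝ] 𝔤) (y z : 𝔤) :
    dMinus e (projPerp ∘ₗ η) y z = dMinus e η y z := by
  rw [← dMinus_add_adComp _ _ (adPart ∘ₗ η), projPerp_comp_eq]

theorem rhoCartan_projPerp_comp (η : 𝔤 →ₗ[ℝ] 𝔤 →ₗ[ℝ] 𝔤) (u x y z : 𝔤) :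
    rhoCartan ((projPerp ∘ₗ η) u) x y z = rhoCartan (η u) x y z := by
  rw [← rhoCartan_add_adComp _ (adPart ∘ₗ η), projPerp_comp_eq]

end Algebra

variable {E : Type*} [NormedAddCommGroup E] [NormedSpace ℝ E] [FiniteDimensional ℝ E]
  {M : Type*} [TopologicalSpace M] [ChartedSpace E M] [IsManifold 𝓘(ℝ, E) ∞ M]
  {𝔤 : Type*} [LieRing 𝔤] [LieAlgebra ℝ 𝔤] [Module.Finite ℝ 𝔤] [LieAlgebra.IsSimple ℝ 𝔤]
  {Ω : ThreeForm E M} {lc cov cov' : AffineConnection E M}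

/-- The intrinsic torsion does not depend on the connection preserving `Ω`. -/
theorem intrinsicTorsion_eq (hΩ : IsOfCartanType 𝔤 Ω) (hc : IsCompactType 𝔤)
    (hdim : 3 < Module.finrank ℝ 𝔤) (hlc : IsLeviCivita 𝔤 Ω lc) (hcov : IsAutConnection Ω cov)
    (hcov' : IsAutConnection Ω cov') {x : M} {I : TangentSpace 𝓘(ℝ, E) x ≃ₗ[ℝ] 𝔤}
    (hI : IsAdapted Ω x I) : intrinsicTorsion lc cov x I = intrinsicTorsion lc cov' x I := by
  refine LinearMap.ext fun a => sub_eq_zero.1 ?_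
  change projPerp (torsionTensor lc cov x I a) - projPerp (torsionTensor lc cov' x I a) = 0
  rw [← map_sub]
  -- Two connections preserving Ω differ, in each direction, by a skew endomorphism annihilating the
  -- Cartan form. This is a derivation, hence inner, and the projection kills it.
  obtain ⟨b, hb⟩ := exists_ad_of_rhoCartan hc
    (τ := torsionTensor lc cov x I a - torsionTensor lc cov' x I a)
    (fun y z => by
      have h1 := torsionTensor_skew hΩ hc hdim hlc hcov hI a y z
      have h2 := torsionTensor_skew hΩ hc hdim hlc hcov' hI a y z
      simp only [LinearMap.sub_apply, metric_sub_left, metric_sub_right, h1, h2]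
      ring)
    (fun y z w => by
      have h1 := covDerivForm_eq_rhoCartan (lc := lc) hΩ hcov hI (I.symm a) (I.symm y) (I.symm z)
        (I.symm w)
      have h2 := covDerivForm_eq_rhoCartan (lc := lc) hΩ hcov' hI (I.symm a) (I.symm y) (I.symm z)
        (I.symm w)
      simp only [LinearEquiv.apply_symm_apply] at h1 h2
      rw [rhoCartan_sub]
      linarith)
  rw [hb, projPerp_ad hc]

theorem intrinsicTorsion_mem_skewTorsionModule (hΩ : IsOfCartanType 𝔤 Ω) (hc : IsCompactType 𝔤)
    (hdim : 3 < Module.finrank ℝ 𝔤) (hlc : IsLeviCivita 𝔤 Ω lc) (hcov : IsAutConnection Ω cov)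
    (hskew : HasSkewTorsion 𝔤 Ω cov) {x : M} {I : TangentSpace 𝓘(ℝ, E) x ≃ₗ[ℝ] 𝔤}
    (hI : IsAdapted Ω x I) : intrinsicTorsion lc cov x I ∈ skewTorsionModule 𝔤 :=
  projPerp_comp_mem hc (torsionTensor_mem_skewTensors hΩ hc hdim hlc hcov hskew hI)

theorem extDerivAt_eq_zero_iff_mem_closedModule (hΩ : IsOfCartanType 𝔤 Ω) (hc : IsCompactType 𝔤)
    (hdim : 3 < Module.finrank ℝ 𝔤) (hlc : IsLeviCivita 𝔤 Ω lc) (hcov : IsAutConnection Ω cov)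
    (hskew : HasSkewTorsion 𝔤 Ω cov) {x : M} {I : TangentSpace 𝓘(ℝ, E) x ≃ₗ[ℝ] 𝔤}
    (hI : IsAdapted Ω x I) :
    Ω.extDerivAt x = 0 ↔ intrinsicTorsion lc cov x I ∈ closedModule 𝔤 := by
  rw [extDerivAt_eq_zero_iff_dPlus hΩ hlc hcov hI]
  simp only [← dPlus_projPerp_comp (torsionTensor lc cov x I)]
  exact (and_iff_right
    (intrinsicTorsion_mem_skewTorsionModule hΩ hc hdim hlc hcov hskew hI)).symm

theorem isCoclosedAt_iff_mem_coclosedModule (hΩ : IsOfCartanType 𝔤 Ω) (hc : IsCompactType 𝔤)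
    (hdim : 3 < Module.finrank ℝ 𝔤) (hlc : IsLeviCivita 𝔤 Ω lc) (hcov : IsAutConnection Ω cov)
    (hskew : HasSkewTorsion 𝔤 Ω cov) {x : M} {I : TangentSpace 𝓘(ℝ, E) x ≃ₗ[ℝ] 𝔤}
    (hI : IsAdapted Ω x I) :
    IsCoclosedAt 𝔤 lc Ω x ↔ intrinsicTorsion lc cov x I ∈ coclosedModule 𝔤 := by
  rw [isCoclosedAt_iff_dMinus hΩ hc hdim hcov hI]
  simp only [← dMinus_projPerp_comp _ (torsionTensor lc cov x I)]
  exact (and_iff_right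
    (intrinsicTorsion_mem_skewTorsionModule hΩ hc hdim hlc hcov hskew hI)).symm

/-- If the intrinsic torsion vanishes, the Levi-Civita connection preserves `Ω`. -/
theorem isAutConnection_of_intrinsicTorsion_eq_zero (hΩ : IsOfCartanType 𝔤 Ω)
    (hlc : IsLeviCivita 𝔤 Ω lc) (hcov : IsAutConnection Ω cov)
    (h : ∀ (x : M) (I : TangentSpace 𝓘(ℝ, E) x ≃ₗ[ℝ] 𝔤), IsAdapted Ω x I →
      intrinsicTorsion lc cov x I = 0) : IsAutConnection Ω lc := by
  refine ⟨hlc.1, fun x v u₁ u₂ u₃ => ?_⟩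
  obtain ⟨I, hI⟩ := hΩ.2 x
  rw [covDerivForm_eq_rhoCartan hΩ hcov hI, ← rhoCartan_projPerp_comp,
    show projPerp ∘ₗ torsionTensor lc cov x I = 0 from h x I hI]
  simp [rhoCartan, cartanForm]

/-- Existence of a connection with skew torsion preserving `Ω` at a point of a chart. -/
theorem exists_preservesForm_hasSkewTorsionForm (hΩ : IsOfCartanType 𝔤 Ω) (hc : IsCompactType 𝔤)
    (hdim : 3 < Module.finrank ℝ 𝔤) (hlc : IsLeviCivita 𝔤 Ω lc) (hcov : IsAutConnection Ω cov)
    (h : ∀ (x : M) (I : TangentSpace 𝓘(ℝ, E) x ≃ₗ[ℝ] 𝔤), IsAdapted Ω x I →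
      intrinsicTorsion lc cov x I ∈ skewTorsionModule 𝔤)
    {x₀ : M} {z : E} (hz : z ∈ (extChartAt 𝓘(ℝ, E) x₀).target) :
    ∃ Γ : E →L[ℝ] E →L[ℝ] E,
      PreservesForm (Ω.inChart x₀) z Γ ∧ HasSkewTorsionForm 𝔤 (Ω.inChart x₀ z) Γ := by
  obtain ⟨I, hI⟩ := hΩ.2 ((extChartAt 𝓘(ℝ, E) x₀).symm z)
  obtain ⟨Γ, hΓ⟩ := exists_represents lc hz
  obtain ⟨Γ', hΓ'⟩ := exists_represents cov hz
  have hpres := (mem_preservingAt_iff hz (hΩ.differentiableAt hz) hΓ').1 (hcov.2 _)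
  have hsymm := (mem_torsionFreeAt_iff hz hΓ).1 ((isLeviCivita_iff.1 hlc).2 _).1
  have hJ := hI.modelFrame hz
  have hη := torsionTensor_apply hz hΓ hΓ' I
  set J := modelFrame hz I
  obtain ⟨-, β, hβ⟩ := (mem_skewTorsionModule_iff hc).1 (h _ I hI)
  rw [intrinsicTorsion, hη] at hβ
  set η := pushBilin J (Γ' - Γ) with hη_def
  set η' := projPerp ∘ₗ η + adComp β with hη'_def
  -- The new symbols add the totally skew tensor `η'` to the Levi-Civita ones. As `η'` and `η`
  -- differ by `ad`-terms, they act alike on the form, so it stays preserved; the torsion is now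
  -- that of `η'`.
  let γ : E →L[ℝ] E →L[ℝ] E := toCLM₂ E E (LinearMap.mk₂ ℝ (fun x y => J.symm (η' (J x) (J y)))
    (by intros; simp) (by intros; simp) (by intros; simp) (by intros; simp))
  have hγ (x y : E) : J (γ x y) = η' (J x) (J y) := by
    simp only [γ, toCLM₂_apply, LinearMap.mk₂_apply, LinearEquiv.apply_symm_apply]
  refine ⟨Γ + γ, fun v x y u => ?_, fun u v x => ?_⟩
  · have h1 := formAction_eq_neg_rhoCartan hJ (hγ v) x y u
    have h2 := formAction_eq_neg_rhoCartan hJ (γ := (Γ' - Γ) v) (τ := η (J v))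
      (fun y => by rw [hη_def, pushBilin_apply, J.symm_apply_apply, J.symm_apply_apply]) x y u
    rw [hη'_def, rhoCartan_add_adComp, rhoCartan_projPerp_comp, ← h2] at h1
    rw [hpres]
    simp only [formAction, _root_.sub_apply, _root_.add_apply, map_sub, map_add,
      LinearMap.sub_apply, LinearMap.add_apply] at h1 ⊢
    linarith
  · have h1 := skew_torsion_of_skewTensors hβ (J u) (J v) (J x)
    simp only [_root_.add_apply, hsymm v u, hsymm x u, add_sub_add_left_eq_sub]
    rw [formMetric_eq hc hdim hJ, formMetric_eq hc hdim hJ, map_sub, map_sub, hγ, hγ, hγ, hγ]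
    exact h1

end IntrinsicTorsion
end CartanGeometry
end


/-! ### Proof of the theorem. -/

open CartanGeometry in
theorem corollary4p12
    {𝔤 : Type*} [LieRing 𝔤] [LieAlgebra ℝ 𝔤] [Module.Finite ℝ 𝔤] [LieAlgebra.IsSimple ℝ 𝔤]
    (hcompact : ∀ X : 𝔤, X ≠ 0 → killingForm ℝ 𝔤 X X < 0)
    (hdim : 8 ≤ Module.finrank ℝ 𝔤)
    {E : Type*} [NormedAddCommGroup E] [NormedSpace ℝ E] [FiniteDimensional ℝ E]
    {M : Type*} [TopologicalSpace M] [T2Space M] [SecondCountableTopology M]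
    [ChartedSpace E M] [IsManifold 𝓘(ℝ, E) ∞ M]
    (Ω : ThreeForm E M) (hΩ : IsOfCartanType 𝔤 Ω) :
    -- the three spaces are `𝔤`-modules, and the first is the direct sum of the other two
    (∀ (a : 𝔤), ∀ ξ ∈ skewTorsionModule 𝔤, ⁅a, ξ⁆ ∈ skewTorsionModule 𝔤) ∧
    (∀ (a : 𝔤), ∀ ξ ∈ closedModule 𝔤, ⁅a, ξ⁆ ∈ closedModule 𝔤) ∧
    (∀ (a : 𝔤), ∀ ξ ∈ coclosedModule 𝔤, ⁅a, ξ⁆ ∈ coclosedModule 𝔤) ∧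
    closedModule 𝔤 ⊓ coclosedModule 𝔤 = ⊥ ∧
    closedModule 𝔤 ⊔ coclosedModule 𝔤 = skewTorsionModule 𝔤 ∧
    -- the objects used below exist
    (∃ lc : AffineConnection E M, IsLeviCivita 𝔤 Ω lc) ∧
    (∃ cov : AffineConnection E M, IsAutConnection Ω cov) ∧
    ∀ lc : AffineConnection E M, IsLeviCivita 𝔤 Ω lc →
      -- `M` has an `Aut(𝔤)`-connection with skew-symmetric torsion if and only if its intrinsic
      -- torsion, computed with any `Aut(𝔤)`-connection, takes values in the first space
      (∀ cov₀ : AffineConnection E M, IsAutConnection Ω cov₀ →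
        ((∃ cov : AffineConnection E M, IsAutConnection Ω cov ∧ HasSkewTorsion 𝔤 Ω cov) ↔
          ∀ (x : M) (I : TangentSpace 𝓘(ℝ, E) x ≃ₗ[ℝ] 𝔤), IsAdapted Ω x I →
            intrinsicTorsion lc cov₀ x I ∈ skewTorsionModule 𝔤)) ∧
      -- the two summands correspond to `dΩ = 0` and to `d^* Ω = 0`
      (∀ cov : AffineConnection E M, IsAutConnection Ω cov → HasSkewTorsion 𝔤 Ω cov →
        ∀ (x : M) (I : TangentSpace 𝓘(ℝ, E) x ≃ₗ[ℝ] 𝔤), IsAdapted Ω x I →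
          intrinsicTorsion lc cov x I ∈ skewTorsionModule 𝔤 ∧
          (Ω.extDerivAt x = 0 ↔ intrinsicTorsion lc cov x I ∈ closedModule 𝔤) ∧
          (IsCoclosedAt 𝔤 lc Ω x ↔ intrinsicTorsion lc cov x I ∈ coclosedModule 𝔤)) ∧
      -- a harmonic form with such a connection is torsion-free
      ((∃ cov : AffineConnection E M, IsAutConnection Ω cov ∧ HasSkewTorsion 𝔤 Ω cov) →
        (∀ x, Ω.extDerivAt x = 0) → (∀ x, IsCoclosedAt 𝔤 lc Ω x) →
        (∀ cov : AffineConnection E M, IsAutConnection Ω cov →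
          ∀ (x : M) (I : TangentSpace 𝓘(ℝ, E) x ≃ₗ[ℝ] 𝔤), IsAdapted Ω x I →
            intrinsicTorsion lc cov x I = 0) ∧
        IsAutConnection Ω lc) := by
  have hc : IsCompactType 𝔤 := hcompact
  -- What rigidity of the bracket needs is the exclusion of dimension three.
  have hd : 3 < Module.finrank ℝ 𝔤 := by omega
  refine ⟨fun a ξ h => lie_mem_skewTorsionModule hc a h, fun a ξ h => lie_mem_closedModule hc a h,
    fun a ξ h => lie_mem_coclosedModule hc a h, closedModule_inf_coclosedModule hc,
    closedModule_sup_coclosedModule hc, exists_isLeviCivita hΩ hc hd,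
    exists_isAutConnection hΩ hc hd, fun lc hlc => ⟨fun cov₀ hcov₀ => ⟨?_, fun h => ?_⟩,
      fun cov hcov hskew x I hI => ⟨?_, ?_, ?_⟩, ?_⟩⟩
  · rintro ⟨cov, hcov, hskew⟩ x I hI
    rw [intrinsicTorsion_eq hΩ hc hd hlc hcov₀ hcov hI]
    exact intrinsicTorsion_mem_skewTorsionModule hΩ hc hd hlc hcov hskew hI
  · exact exists_isAutConnection_hasSkewTorsion hΩ hc hd fun x₀ z hz =>
      exists_preservesForm_hasSkewTorsionForm hΩ hc hd hlc hcov₀ h hz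
  · exact intrinsicTorsion_mem_skewTorsionModule hΩ hc hd hlc hcov hskew hI
  · exact extDerivAt_eq_zero_iff_mem_closedModule hΩ hc hd hlc hcov hskew hI
  · exact isCoclosedAt_iff_mem_coclosedModule hΩ hc hd hlc hcov hskew hI
  · rintro ⟨cov, hcov, hskew⟩ hclosed hcoclosed
    have h (cov' : AffineConnection E M) (hcov' : IsAutConnection Ω cov') (x : M)
        (I : TangentSpace 𝓘(ℝ, E) x ≃ₗ[ℝ] 𝔤) (hI : IsAdapted Ω x I) :
        intrinsicTorsion lc cov' x I = 0 := by
      -- The characterizations of `dΩ = 0` and `d^*Ω = 0` are available for the connection with skew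
      -- torsion; independence of the connection transfers the vanishing to every other one.
      rw [intrinsicTorsion_eq hΩ hc hd hlc hcov' hcov hI, ← Submodule.mem_bot ℝ,
        ← closedModule_inf_coclosedModule hc]
      exact ⟨(extDerivAt_eq_zero_iff_mem_closedModule hΩ hc hd hlc hcov hskew hI).1 (hclosed x),
        (isCoclosedAt_iff_mem_coclosedModule hΩ hc hd hlc hcov hskew hI).1 (hcoclosed x)⟩
    exact ⟨h, isAutConnection_of_intrinsicTorsion_eq_zero hΩ hlc hcov (h cov hcov)⟩
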